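/- **Setting.** Let $T$ be a strongly binary tree (every internal node has exactly two children) with node set $V$, root $r$, leaf set $L$, $n=|L|\ge 1$ leaves and height $h$ (number of edges of a longest root-to-leaf path). For $i\in V$ let $L(i)$ be the set of leaves below $i$. A *cut* $c$ of $T$ is given by a set $\mathcal{AB}(c)$ of internal nodes (the nodes above $c$) that contains all ancestors of its elements; the other nodes are below $c$. The *lower boundary* $\mathcal{LB}(c)$ is the set of nodes below $c$ all of whose proper ancestors are above $c$, and $\mathcal C(c)=\{L(i): i\in\mathcal{LB}(c)\}$ is the induced clustering of $L$. Put $y(i)=0$ if $i$ is above and $y(i)=1$ if $i$ is below the cut. Let $\widetilde K(T,c)$ be the number of leaves of the subtree of $T$ with node set $(\mathcal{AB}(c)\cup\mathcal{LB}(c))\setminus L$. A *prior* is given by numbers $\Pr(i)\in[0,1]$, $i\in V$, with $\Pr(i)=1$ for $i\in L$, through $\Pr(c)=\prod_{i\in\mathcal{AB}(c)}(1-\Pr(i))\prod_{j\in\mathcal{LB}(c)}\Pr(j)$; assume that $\Pr(c)>0$ for every cut $c$. Let $\mathbb E$ denote expectation over a cut $c^*\sim\Pr$. The similarity matrix $\sigma_{\mathcal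 C}$ of a clustering $\mathcal C$ is $1$ at pairs of leaves in a common cluster and $-1$ at the other pairs; $\Sigma^*$ is the similarity matrix of $\mathcal C(c^*)$, and $d_H(\Sigma^*,\mathcal C)$ is the number of ordered pairs of leaves at which $\Sigma^*$ and $\sigma_{\mathcal C}$ differ. *Noise:* for $\lambda\in[0,1/2)$, a set of $\lfloor\lambda\binom n2\rfloor$ unordered pairs of distinct leaves is drawn uniformly at random, and $\Sigma$ is obtained from $\Sigma^*$ by changing the sign of these entries. A query to a pair of leaves returns its entry in $\Sigma$. **WDP** on a tree $S$ with a prior and access to labels $y(i)$ keeps a forest $F$ of disjoint subtrees of $S$, initially $\{S\}$. For a node $i$ of the subtree with root $r'$ let $q(i)=\Pr(i)\prod_j(1-\Pr(j))$, the product being over the proper ancestors $j$ of $i$ in that subtree. While $F\neq\emptyset$: (a) among all bottom-up paths from a leaf $\ell$ of a tree of $F$ to the root $r'$ of that tree, select one that maximizes the entropy $-\sum_i q(i)\log_2q(i)$ (ties broken arbitrarily). (b) Binary search on that path: while the current segment $i_0,\dots,i_m$ (in order of decreasing depth) has $m\ge1$, choose $k\in\{0,\dots,m-1\}$ for which $\sum_{j\le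 k}q(i_j)$ is closest to $\frac12\sum_{j\le m}q(i_j)$, request $y(i_{k+1})$, and continue with $i_0,\dots,i_k$ if the answer is $0$, with $i_{k+1},\dots,i_m$ if it is $1$. Let $u$ be the remaining node. (c) $L(u)$ becomes a cluster of the output; the tree with root $r'$ is removed from $F$; for each child $j$ of a proper ancestor of $u$ in that tree such that $j$ is neither $u$ nor an ancestor of $u$, if $j$ is a leaf of $S$ then $L(j)$ becomes a cluster, otherwise the subtree rooted at $j$ is added to $F$. **N-WDP** with constant $\alpha>0$ and confidence $\delta$: let $f=\alpha\log(n/\delta)/(1-2\lambda)^2$. Label with $1$ each internal node $i$ with $|L(\mathrm{left}(i))|\cdot|L(\mathrm{right}(i))|<f$, together with all its descendants. Let $T_\lambda$ be the tree formed by the unlabeled nodes and those of their children that are labeled or are leaves of $T$ (the root alone if the root is labeled or is a leaf). Run WDP on $T_\lambda$ with $\Pr(\cdot)$ reset to $1$ at its leaves; each requested label $y(i)$ is determined by a majority vote over the answers to queries at a uniformly random set of $\lceil f\rceil$ pairs from $L(\mathrm{left}(i))\times L(\mathrm{right}(i))$. Let $\widehat{\mathcal C}$ be the output clustering (of $L$).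 **Theorem.** For every sufficiently large absolute constant $\alpha$ there is a constant $C$, depending only on $\alpha$, such that for all $T$, $\Pr$, $\lambda\in[0,1/2)$ and $\delta\in(0,1/2)$ as above, and however ties are broken, the following holds with probability at least $1-\delta$ over the noise, for every outcome of the internal random draws of N-WDP (hence also with probability at least $1-\delta$ over the noise and the internal draws jointly): for every ground-truth cut $c^*$ the output $\widehat{\mathcal C}$ is a clustering induced by a cut of $T$ with $$\frac{1}{n^2}\,d_H(\Sigma^*,\widehat{\mathcal C})\le C\,\frac1n\,\frac{(\log(n/\delta))^{3/2}}{(1-2\lambda)^3},$$ and the number of queries to pairs of leaves has expectation over $c^*\sim\Pr$ at most $$C\,\frac{\log(n/\delta)}{(1-2\lambda)^2}\;\mathbb E\big[\widetilde K(T,c^*)\big]\,\log h .$$ -/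

import Mathlib

/-! ### Hierarchies, nodes and leaves

A strongly binary tree is a term of Mathlib's `BinaryTree Unit`: `BinaryTree.nil` is a leaf and
`BinaryTree.node () l r` is an internal node with two children. `BinaryTree.numLeaves` is the number `n` of
leaves and `BinaryTree.height` is the height `h` (the number of edges of a longest root-to-leaf path). -/

/-- A node is given by its address: the list of left (`false`) / right (`true`) turns on the way
from the root `[]` to the node. The ancestors of a node (itself included) are its prefixes. -/
abbrev Node : Type := List Bool

/-- The internal nodes of a tree. -/
def internalNodes : BinaryTree Unit → Finset Node
  | .nil => ∅
  | .node _ l r =>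
      insert [] ((internalNodes l).image (List.cons false) ∪ (internalNodes r).image (List.cons true))

/-- The leaves `L` of a tree; they are the items that have to be clustered. -/
def leafNodes : BinaryTree Unit → Finset Node
  | .nil => {[]}
  | .node _ l r => (leafNodes l).image (List.cons false) ∪ (leafNodes r).image (List.cons true)

/-- All nodes `V` of a tree. -/
def allNodes (T : BinaryTree Unit) : Finset Node := internalNodes T ∪ leafNodes T

/-- The left child of a node. -/
def leftChild (i : Node) : Node := i ++ [false]

/-- The right child of a node. -/
def rightChild (i : Node) : Node := i ++ [true]

/-- The sibling of a node different from the root: the last turn is reversed. -/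
def sibling (i : Node) : Node := i.dropLast ++ (i.getLast?.map not).toList

/-- `L(i)`: the leaves of the subtree rooted at node `i`. -/
def leavesBelow (T : BinaryTree Unit) (i : Node) : Finset Node :=
  (leafNodes T).filter (fun x => i <+: x)

/-- `L(left(i)) × L(right(i))`: the pairs of leaves that can be queried to determine `y(i)`. -/
def crossPairs (T : BinaryTree Unit) (i : Node) : Finset (Node × Node) :=
  leavesBelow T (leftChild i) ×ˢ leavesBelow T (rightChild i)

/-! ### Cuts, clusterings and the prior -/

/-- The cuts of `T`. A cut is given by the set of the nodes above it, a set of internal nodes that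
contains all ancestors of its elements; all other nodes (in particular, all leaves) are below it. -/
def cuts (T : BinaryTree Unit) : Finset (Finset Node) :=
  (internalNodes T).powerset.filter (fun A => ∀ i ∈ A, ∀ k ∈ Finset.range i.length, i.take k ∈ A)

/-- The lower boundary of a cut: the nodes below the cut all of whose proper ancestors are above. -/
def lowerBoundary (T : BinaryTree Unit) (A : Finset Node) : Finset Node :=
  (allNodes T).filter (fun i => i ∉ A ∧ ∀ k ∈ Finset.range i.length, i.take k ∈ A)

/-- The clustering of the leaves that is induced by a cut. -/
def cutClustering (T : BinaryTree Unit) (A : Finset Node) : Finset (Finset Node) :=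
  (lowerBoundary T A).image (leavesBelow T)

/-- `T'_c`: the nodes of `T` that are above the cut or on its lower boundary, without the leaves
of `T`. -/
def cutSubtree (T : BinaryTree Unit) (A : Finset Node) : Finset Node :=
  (A ∪ lowerBoundary T A) \ leafNodes T

/-- `K̃(T, c)`: the number of leaves of the subtree `T'_c`. -/
def Ktilde (T : BinaryTree Unit) (A : Finset Node) : ℕ :=
  ((cutSubtree T A).filter
    (fun i => leftChild i ∉ cutSubtree T A ∧ rightChild i ∉ cutSubtree T A)).card

/-- The prior probability of a cut, `P i` being the conditional probability that `i` is below the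
cut given that all proper ancestors of `i` are above. -/
noncomputable def cutProb (T : BinaryTree Unit) (P : Node → ℝ) (A : Finset Node) : ℝ :=
  (∏ i ∈ A, (1 - P i)) * ∏ j ∈ lowerBoundary T A, P j

/-- Expectation over a random cut that is distributed according to the prior. -/
noncomputable def priorExp (T : BinaryTree Unit) (P : Node → ℝ) (X : Finset Node → ℝ) : ℝ :=
  ∑ A ∈ cuts T, cutProb T P A * X A

/-- `P` parametrizes a prior over the cuts of `T` that gives positive probability to every cut. -/
def IsPositivePrior (T : BinaryTree Unit) (P : Node → ℝ) : Prop :=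
  (∀ i ∈ internalNodes T, 0 ≤ P i ∧ P i ≤ 1) ∧ (∀ i ∈ leafNodes T, P i = 1) ∧
    ∀ A ∈ cuts T, 0 < cutProb T P A

/-! ### Similarity matrices, distance and persistent noise -/

open Classical in
/-- The similarity matrix of a clustering: `1` for two leaves in a common cluster, `-1` otherwise. -/
noncomputable def simMatrix (K : Finset (Finset Node)) (x y : Node) : ℤ :=
  if ∃ c ∈ K, x ∈ c ∧ y ∈ c then 1 else -1

/-- The Hamming distance between a similarity matrix over the leaves of `T` and (the similarity
matrix of) a clustering: the number of ordered pairs of leaves with inconsistent sign. -/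
noncomputable def clusterDist (T : BinaryTree Unit) (M : Node → Node → ℤ) (K : Finset (Finset Node)) : ℕ :=
  ((leafNodes T ×ˢ leafNodes T).filter (fun p => M p.1 p.2 ≠ simMatrix K p.1 p.2)).card

/-- The unordered pairs of distinct leaves. -/
def leafPairs (T : BinaryTree Unit) : Finset (Sym2 Node) :=
  (leafNodes T).sym2.filter (fun e => ¬ e.IsDiag)

/-- The possible sets of flipped pairs at noise level `lam`: the sets of `⌊lam * (n choose 2)⌋`
unordered pairs of distinct leaves. -/
noncomputable def noiseSets (T : BinaryTree Unit) (lam : ℝ) : Finset (Finset (Sym2 Node)) :=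
  (leafPairs T).powersetCard ⌊lam * (T.numLeaves.choose 2 : ℝ)⌋₊

/-- The noisy matrix: the entries of `M` at the pairs in `flips` change their sign. -/
noncomputable def flipMatrix (M : Node → Node → ℤ) (flips : Finset (Sym2 Node)) (x y : Node) : ℤ :=
  if s(x, y) ∈ flips then - M x y else M x y

open Classical in
/-- The probability of the event `E` when an element of the finite set `s` is drawn uniformly at
random. -/
noncomputable def uniformProb {β : Type} (s : Finset β) (E : β → Prop) : ℝ :=
  ((s.filter E).card : ℝ) / (s.card : ℝ)

/-! ### The algorithm WDP on a tree `S` with prior `P` -/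

open Classical in
/-- The probability attached to a node of `S`; it is `1` at the leaves of `S`. -/
noncomputable def nodeProb (S : BinaryTree Unit) (P : Node → ℝ) (i : Node) : ℝ :=
  if i ∈ leafNodes S then 1 else P i

/-- `q(i)` for a node `i` of the subtree rooted at `r`, when all proper ancestors of `r` are known
to be above the cut and nothing is known about the nodes of the subtree: the posterior probability
that `i` is on the lower boundary. The product is over the proper ancestors of `i` in the subtree. -/
noncomputable def weight (S : BinaryTree Unit) (P : Node → ℝ) (r i : Node) : ℝ :=
  nodeProb S P i * ∏ k ∈ Finset.Ico r.length i.length, (1 - nodeProb S P (i.take k))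

/-- The bottom-up path from `l` to its ancestor `r`, listed from `l` up to `r`. -/
def pathUp (r l : Node) : List Node :=
  (List.range (l.length + 1 - r.length)).map (fun k => l.take (l.length - k))

/-- The sum of the weights `q` over a list of nodes of the subtree rooted at `r`. -/
noncomputable def mass (S : BinaryTree Unit) (P : Node → ℝ) (r : Node) (p : List Node) : ℝ :=
  (p.map (weight S P r)).sum

/-- The entropy of the bottom-up path from `l` to `r`. -/
noncomputable def pathEntropy (S : BinaryTree Unit) (P : Node → ℝ) (r l : Node) : ℝ :=
  ((pathUp r l).map (fun i => - (weight S P r i * Real.logb 2 (weight S P r i)))).sum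

/-- The state of WDP between two binary searches: the roots of the subtrees in the forest `F`, the
roots of the clusters found so far, and the log of the nodes queried so far. -/
structure WDPState where
  forest : Finset Node
  found : Finset Node
  asked : List Node

/-- The pairs (root of a subtree in the forest, leaf of that subtree). -/
def candidates (S : BinaryTree Unit) (F : Finset Node) : Finset (Node × Node) :=
  (F ×ˢ leafNodes S).filter (fun p => p.1 <+: p.2)

/-- A way to choose a path of maximal entropy, ties being broken arbitrarily. -/
structure PathRule (S : BinaryTree Unit) (P : Node → ℝ) where
  pick : WDPState → Node × Node
  pick_mem : ∀ st : WDPState, st.forest.Nonempty → st.forest ⊆ allNodes S →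
    pick st ∈ candidates S st.forest
  pick_max : ∀ st : WDPState, st.forest.Nonempty → st.forest ⊆ allNodes S →
    ∀ p ∈ candidates S st.forest,
      pathEntropy S P p.1 p.2 ≤ pathEntropy S P (pick st).1 (pick st).2

/-- A way to choose the middle point of a bottom-up path `p = [i_0, …, i_m]`, `m ≥ 1`, inside the
subtree rooted at `r`: an index `k < m` for which the mass of `i_0, …, i_k` is as close as possible
to one half of the mass of `p`, ties being broken arbitrarily. -/
structure MidRule (S : BinaryTree Unit) (P : Node → ℝ) where
  idx : Node → List Node → ℕ
  idx_lt : ∀ (r : Node) (p : List Node), 2 ≤ p.length → idx r p + 1 < p.length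
  idx_min : ∀ (r : Node) (p : List Node), 2 ≤ p.length → ∀ k : ℕ, k + 1 < p.length →
    |mass S P r p / 2 - mass S P r (p.take (idx r p + 1))|
      ≤ |mass S P r p / 2 - mass S P r (p.take (k + 1))|

/-- Binary search on a bottom-up path `p = [i_0, …, i_m]` with answers `y` (`true` is the label `1`).
If `m ≥ 1`, the parent `i_{k+1}` of the middle point `i_k` is queried; the search goes on in
`[i_0, …, i_k]` if the answer is `0` and in `[i_{k+1}, …, i_m]` if it is `1`. The result is the node
at which the search stops and the list of the queried nodes. -/
def search {S : BinaryTree Unit} {P : Node → ℝ} (mid : MidRule S P) (y : Node → Bool) (r : Node)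
    (p : List Node) : Node × List Node :=
  if h : 2 ≤ p.length then
    let k := mid.idx r p
    let i := p.getD (k + 1) []
    let res := if y i = true then search mid y r (p.drop (k + 1)) else search mid y r (p.take (k + 1))
    (res.1, i :: res.2)
  else (p.headD [], [])
termination_by p.length
decreasing_by
  · simp only [List.length_drop]; omega
  · have := mid.idx_lt r p h
    simp only [List.length_take]; omega

/-- The children of the proper ancestors of `u` inside the subtree rooted at `r` that are not
ancestors of `u`. -/
def hanging (r u : Node) : Finset Node :=
  (Finset.Ioc r.length u.length).image (fun k => sibling (u.take k))

/-- One round of WDP: select a path of maximal entropy, find by binary search the node `u` of the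
path that is on the lower boundary, and update the forest. -/
def wdpStep {S : BinaryTree Unit} {P : Node → ℝ} (rule : PathRule S P) (mid : MidRule S P)
    (y : Node → Bool) (st : WDPState) : WDPState :=
  if st.forest = ∅ then st
  else
    let r := (rule.pick st).1
    let l := (rule.pick st).2
    let res := search mid y r (pathUp r l)
    let u := res.1
    { forest := st.forest.erase r ∪ (hanging r u).filter (fun j => j ∉ leafNodes S)
      found := insert u st.found ∪ (hanging r u).filter (fun j => j ∈ leafNodes S)
      asked := st.asked ++ res.2 }

/-- WDP: repeat the round until the forest is empty. In each round the forest loses a node of `S`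
(the root of the selected subtree) that never returns, and further rounds leave a state with an
empty forest unchanged; so as many rounds as `S` has nodes suffice. -/
def wdp {S : BinaryTree Unit} {P : Node → ℝ} (rule : PathRule S P) (mid : MidRule S P)
    (y : Node → Bool) : WDPState :=
  (wdpStep rule mid y)^[(allNodes S).card] { forest := {[]}, found := ∅, asked := [] }

/-! ### The algorithm N-WDP -/

/-- The quantity `α log(n/δ) / (1 - 2 lam)²`. -/
noncomputable def voteBound (α lam δ : ℝ) (n : ℕ) : ℝ :=
  α * Real.log (n / δ) / (1 - 2 * lam) ^ 2

open Classical in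
/-- Label with `1` all internal nodes `i` with `|L(left(i))| * |L(right(i))| < f`, together with
their descendants, and keep the unlabeled nodes and their children (the root alone if the root is
labeled or is a leaf). Addresses of nodes do not change. -/
noncomputable def prune (f : ℝ) : BinaryTree Unit → BinaryTree Unit
  | .nil => .nil
  | .node _ l r =>
      if ((l.numLeaves * r.numLeaves : ℕ) : ℝ) < f then .nil else .node () (prune f l) (prune f r)

/-- The tree `T_λ` on which N-WDP operates. -/
noncomputable def nwdpTree (α lam δ : ℝ) (T : BinaryTree Unit) : BinaryTree Unit :=
  prune (voteBound α lam δ T.numLeaves) T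

/-- The number of pairs that are queried to determine one label. -/
noncomputable def voteSize (α lam δ : ℝ) (T : BinaryTree Unit) : ℕ := ⌈voteBound α lam δ T.numLeaves⌉₊

/-- The internal random draws of N-WDP: for each internal node `i` of `T_λ`, a set of `voteSize`
pairs from `L(left(i)) × L(right(i))`. -/
noncomputable def voteDraws (α lam δ : ℝ) (T : BinaryTree Unit) :
    Finset (internalNodes (nwdpTree α lam δ T) → Finset (Node × Node)) :=
  Fintype.piFinset (fun i => (crossPairs T i.1).powersetCard (voteSize α lam δ T))

/-- The pairs that are queried when the label of node `i` is requested. -/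
def votePairs {S : BinaryTree Unit} (draw : internalNodes S → Finset (Node × Node)) (i : Node) :
    Finset (Node × Node) :=
  if h : i ∈ internalNodes S then draw ⟨i, h⟩ else ∅

/-- The answer to the request of the label of node `i`: the majority vote of the entries of the
matrix `M` at the drawn pairs. -/
def majorityLabel {S : BinaryTree Unit} (draw : internalNodes S → Finset (Node × Node))
    (M : Node → Node → ℤ) (i : Node) : Bool :=
  decide ((votePairs draw i).card < 2 * ((votePairs draw i).filter (fun p => M p.1 p.2 = 1)).card)

/-- The final state of N-WDP when the ground-truth cut is `c`, the pairs in `flips` are corrupted by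
noise and the internal draws are `draw`. -/
noncomputable def nwdpRun (T : BinaryTree Unit) {S : BinaryTree Unit} {P : Node → ℝ} (rule : PathRule S P)
    (mid : MidRule S P) (draw : internalNodes S → Finset (Node × Node))
    (flips : Finset (Sym2 Node)) (c : Finset Node) : WDPState :=
  wdp rule mid (majorityLabel draw (flipMatrix (simMatrix (cutClustering T c)) flips))

/-- The clustering that N-WDP outputs. -/
noncomputable def nwdpOutput (T : BinaryTree Unit) {S : BinaryTree Unit} {P : Node → ℝ} (rule : PathRule S P)
    (mid : MidRule S P) (draw : internalNodes S → Finset (Node × Node))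
    (flips : Finset (Sym2 Node)) (c : Finset Node) : Finset (Finset Node) :=
  (nwdpRun T rule mid draw flips c).found.image (leavesBelow T)

/-- The number of queries to pairs of leaves that N-WDP makes. -/
noncomputable def nwdpQueries (T : BinaryTree Unit) {S : BinaryTree Unit} {P : Node → ℝ} (rule : PathRule S P)
    (mid : MidRule S P) (draw : internalNodes S → Finset (Node × Node))
    (flips : Finset (Sym2 Node)) (c : Finset Node) : ℕ :=
  ((nwdpRun T rule mid draw flips c).asked.map (fun i => (votePairs draw i).card)).sum

/-- The guarantee on N-WDP for given noise and given internal draws: for every ground-truth cut `c`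
the output is the clustering of a cut of `T` whose distance from the noiseless matrix is small, and
the expected number of queries, over `c` drawn from the prior, is small. -/
def NWDPGuarantee (C lam δ : ℝ) (T : BinaryTree Unit) {S : BinaryTree Unit} {P : Node → ℝ} (rule : PathRule S P)
    (mid : MidRule S P) (draw : internalNodes S → Finset (Node × Node))
    (flips : Finset (Sym2 Node)) : Prop :=
  (∀ c ∈ cuts T,
    (∃ c' ∈ cuts T, nwdpOutput T rule mid draw flips c = cutClustering T c') ∧
    (clusterDist T (simMatrix (cutClustering T c)) (nwdpOutput T rule mid draw flips c) : ℝ)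
        / (T.numLeaves : ℝ) ^ 2
      ≤ C * ((1 / (T.numLeaves : ℝ)) *
          ((Real.log (T.numLeaves / δ)) ^ (3 / 2 : ℝ) / (1 - 2 * lam) ^ 3))) ∧
  priorExp T P (fun c => (nwdpQueries T rule mid draw flips c : ℝ))
    ≤ C * (Real.log (T.numLeaves / δ) / (1 - 2 * lam) ^ 2 *
        priorExp T P (fun c => (Ktilde T c : ℝ)) * Real.log T.height)

/-! Fix the internal draws. Every internal node `i` of the pruned tree `S` has at least `f` cross
pairs, so its vote uses `⌈f⌉` distinct unordered pairs, and without noise all of them carry the same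
entry, the label of `i`. Hence a vote is right as soon as fewer than half of its pairs are flipped.
This event, `VotesCorrect`, does not mention the cut, which is why one noise event serves all ground
truths at once. A uniform `K`-subset of the pairs contains a given set `J` with probability at most
`lam ^ |J|`, as under independent flips, so a Chernoff argument (`card_majority_le`) bounds the
failure of one vote by `δ / n`, and a union bound over the fewer than `n` internal nodes of `S`
gives `1 - δ`. The rest is deterministic in the noise.

With correct votes, WDP on `S` sees exactly the labels of the restricted cut `c ∩ internalNodes S`
and returns its lower boundary (`wdp_found`). The output is a coarsening of the true clustering, and
the two differ only inside the leaf sets of leaves of `S`; these have at most `f + 1` elements, so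
at most `n (f + 1)` ordered pairs are wrong (`clusterDist_le`).

The query bound combines three facts. Cost of one search: each two steps halve the mass of the
segment or finish, so a search ending at `u` asks at most `2 log₂ (1 / q(u)) + 2` labels
(`search_length_le`). Given the history, `u` has posterior probability `q(u)`
(`sum_mem_lowerBoundary`), so the conditional mean is at most twice the path entropy plus `2`, and
the entropy is at most `log₂ (h + 1)`. Number of rounds: a path of maximal entropy ends at a leaf
whose sibling is also a leaf, and therefore each round removes from the forest at least one of the
`Ktilde` leaves of the subtree `T'_c` (`card_leavesUnder_nextForest`). Combination: the number of
labels asked so far plus `B` times the number of leaves of `T'_c` still under the forest does not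
increase in conditional mean, where `B = 2 log₂ (h + 1) + 2` (`sum_asked_iterate_le`). Conditioning
is expressed by the family `E` of cuts compatible with the history; it stays closed under changes
inside the forest, which keeps the posterior in product form. -/

/-! ### Nodes and ancestors -/

/-- All proper ancestors of `i` belong to `A`. -/
def AncestorsIn (A : Finset Node) (i : Node) : Prop := ∀ j b, j ++ [b] <+: i → j ∈ A

theorem ancestorsIn_iff_take (A : Finset Node) (i : Node) :
    (∀ k ∈ Finset.range i.length, i.take k ∈ A) ↔ AncestorsIn A i := by
  constructor
  · rintro h j b ⟨t, rfl⟩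
    have := h j.length (by simp)
    simpa using this
  · intro h k hk
    rw [Finset.mem_range] at hk
    apply h (i.take k) i[k]
    rw [List.take_append_getElem]
    exact List.take_prefix _ _

theorem ancestorsIn_nil (A : Finset Node) : AncestorsIn A [] := by
  intro j b h
  simp at h

theorem ancestorsIn_concat {A : Finset Node} {i : Node} {b : Bool} :
    AncestorsIn A (i ++ [b]) ↔ AncestorsIn A i ∧ i ∈ A := by
  constructor
  · intro h
    exact ⟨fun j b' hj => h j b' (hj.trans (List.prefix_append _ _)), h i b (List.prefix_refl _)⟩
  · rintro ⟨h, hi⟩ j b' hj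
    rcases List.prefix_concat_iff.1 hj with h' | h'
    · obtain ⟨rfl, -⟩ := List.append_inj' h' rfl
      exact hi
    · exact h j b' h'

theorem AncestorsIn.mono {A : Finset Node} {i j : Node} (h : AncestorsIn A i) (hj : j <+: i) :
    AncestorsIn A j := fun k b hk => h k b (hk.trans hj)

theorem AncestorsIn.subset {A B : Finset Node} {i : Node} (h : AncestorsIn A i) (hAB : A ⊆ B) :
    AncestorsIn B i := fun k b hk => hAB (h k b hk)

theorem exists_concat_prefix {i j : Node} (h : i <+: j) (hne : i ≠ j) : ∃ b, i ++ [b] <+: j := by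
  obtain ⟨t, rfl⟩ := h
  cases t with
  | nil => simp at hne
  | cons b t => exact ⟨b, t, by simp⟩

theorem not_concat_prefix (i : Node) (b : Bool) : ¬ i ++ [b] <+: i := by
  intro h
  have := h.length_le
  simp at this

theorem concat_prefix_unique {i j : Node} {b b' : Bool} (h : i ++ [b] <+: j) (h' : i ++ [b'] <+: j) :
    b = b' := by
  have := (List.prefix_of_prefix_length_le h h' (by simp)).eq_of_length (by simp)
  simpa using this

/-- Two incomparable nodes part at their lowest common ancestor `v`, and there they take opposite
turns. -/
theorem exists_divergence {x u : Node} (r : Node) (hx : r <+: x) (hu : r <+: u) (h₁ : ¬ x <+: u)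
    (h₂ : ¬ u <+: x) : ∃ v b, r <+: v ∧ v ++ [b] <+: u ∧ v ++ [!b] <+: x := by
  obtain ⟨s, rfl⟩ := hx
  obtain ⟨t, rfl⟩ := hu
  rw [List.prefix_append_right_inj] at h₁ h₂
  induction s generalizing r t with
  | nil => simp at h₁
  | cons a s ih =>
    cases t with
    | nil => simp at h₂
    | cons b t =>
      by_cases hab : a = b
      · subst hab
        rw [List.prefix_cons_inj] at h₁ h₂
        obtain ⟨v, c, hv, hc, hc'⟩ := ih (r ++ [a]) t h₁ h₂
        exact ⟨v, c, (List.prefix_append _ _).trans hv, by simpa using hc, by simpa using hc'⟩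
      · refine ⟨r, b, List.prefix_refl _, ⟨t, by simp⟩, ⟨s, ?_⟩⟩
        have : a = !b := by cases a <;> cases b <;> simp_all
        simp [this]

theorem prefix_iff_eq_or_child {i x : Node} :
    i <+: x ↔ x = i ∨ leftChild i <+: x ∨ rightChild i <+: x := by
  constructor
  · intro h
    by_cases hx : i = x
    · exact Or.inl hx.symm
    · obtain ⟨b, hb⟩ := exists_concat_prefix h hx
      cases b
      · exact Or.inr (Or.inl hb)
      · exact Or.inr (Or.inr hb)
  · rintro (rfl | h | h)
    · exact List.prefix_refl _
    · exact (List.prefix_append _ _).trans h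
    · exact (List.prefix_append _ _).trans h

/-! ### Structure of the node sets -/

theorem nil_mem_internalNodes_node (l r : BinaryTree Unit) :
    [] ∈ internalNodes (.node () l r) := by
  simp [internalNodes]

theorem cons_mem_internalNodes {l r : BinaryTree Unit} {b : Bool} {i : Node} :
    b :: i ∈ internalNodes (.node () l r) ↔ i ∈ internalNodes (if b then r else l) := by
  cases b <;> simp [internalNodes]

theorem cons_mem_leafNodes {l r : BinaryTree Unit} {b : Bool} {i : Node} :
    b :: i ∈ leafNodes (.node () l r) ↔ i ∈ leafNodes (if b then r else l) := by
  cases b <;> simp [leafNodes]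

theorem nil_notMem_leafNodes_node (l r : BinaryTree Unit) :
    [] ∉ leafNodes (.node () l r) := by
  simp [leafNodes]

theorem mem_allNodes {T : BinaryTree Unit} {i : Node} :
    i ∈ allNodes T ↔ i ∈ internalNodes T ∨ i ∈ leafNodes T := Finset.mem_union

theorem cons_mem_allNodes {l r : BinaryTree Unit} {b : Bool} {i : Node} :
    b :: i ∈ allNodes (.node () l r) ↔ i ∈ allNodes (if b then r else l) := by
  simp only [mem_allNodes, cons_mem_internalNodes, cons_mem_leafNodes]

theorem nil_mem_allNodes (T : BinaryTree Unit) : [] ∈ allNodes T := by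
  cases T with
  | nil => simp [allNodes, leafNodes]
  | node a l r => exact mem_allNodes.2 (Or.inl (nil_mem_internalNodes_node l r))

/-- Strong binarity in terms of addresses: the direction `b` does not matter. The prefix arguments
below reduce to this. -/
theorem concat_mem_allNodes {T : BinaryTree Unit} {i : Node} {b : Bool} :
    i ++ [b] ∈ allNodes T ↔ i ∈ internalNodes T := by
  induction i generalizing T with
  | nil =>
    cases T with
    | nil => simp [allNodes, internalNodes, leafNodes]
    | node a l r =>
      exact iff_of_true (cons_mem_allNodes.2 (nil_mem_allNodes _)) (nil_mem_internalNodes_node l r)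
  | cons c i ih =>
    cases T with
    | nil => simp [allNodes, internalNodes, leafNodes]
    | node a l r =>
      rw [List.cons_append, cons_mem_allNodes, ih, cons_mem_internalNodes]

theorem notMem_leafNodes_of_mem_internalNodes {T : BinaryTree Unit} {i : Node}
    (h : i ∈ internalNodes T) : i ∉ leafNodes T := by
  induction i generalizing T with
  | nil =>
    cases T with
    | nil => simp [internalNodes] at h
    | node a l r => exact nil_notMem_leafNodes_node l r
  | cons c i ih =>
    cases T with
    | nil => simp [internalNodes] at h
    | node a l r =>
      rw [cons_mem_leafNodes]
      exact ih (cons_mem_internalNodes.1 h)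

theorem mem_internalNodes_of_mem_allNodes {T : BinaryTree Unit} {i : Node} (h : i ∈ allNodes T)
    (hl : i ∉ leafNodes T) : i ∈ internalNodes T := (mem_allNodes.1 h).resolve_right hl

theorem mem_allNodes_of_prefix {T : BinaryTree Unit} {i j : Node} (h : j ∈ allNodes T)
    (hi : i <+: j) : i ∈ allNodes T := by
  obtain ⟨t, rfl⟩ := hi
  induction t using List.reverseRecOn with
  | nil => simpa using h
  | append_singleton t b ih =>
    rw [← List.append_assoc, concat_mem_allNodes] at h
    exact ih (mem_allNodes.2 (Or.inl h))

theorem mem_internalNodes_of_concat_prefix {T : BinaryTree Unit} {i j : Node} {b : Bool}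
    (h : j ∈ allNodes T) (hi : i ++ [b] <+: j) : i ∈ internalNodes T :=
  concat_mem_allNodes.1 (mem_allNodes_of_prefix h hi)

theorem mem_internalNodes_of_prefix {T : BinaryTree Unit} {i j : Node} (h : j ∈ internalNodes T)
    (hi : i <+: j) : i ∈ internalNodes T := by
  by_cases hij : i = j
  · rwa [hij]
  · obtain ⟨b, hb⟩ := exists_concat_prefix hi hij
    exact mem_internalNodes_of_concat_prefix (mem_allNodes.2 (Or.inl h)) hb

theorem eq_of_leaf_prefix {T : BinaryTree Unit} {i j : Node} (hi : i ∈ leafNodes T)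
    (hj : j ∈ allNodes T) (h : i <+: j) : i = j := by
  by_contra hne
  obtain ⟨b, hb⟩ := exists_concat_prefix h hne
  exact notMem_leafNodes_of_mem_internalNodes (mem_internalNodes_of_concat_prefix hj hb) hi

theorem leafNodes_subset_allNodes (T : BinaryTree Unit) : leafNodes T ⊆ allNodes T :=
  Finset.subset_union_right

theorem internalNodes_subset_allNodes (T : BinaryTree Unit) : internalNodes T ⊆ allNodes T :=
  Finset.subset_union_left

theorem length_le_height {T : BinaryTree Unit} {i : Node} (h : i ∈ allNodes T) :
    i.length ≤ T.height := by
  induction i generalizing T with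
  | nil => simp
  | cons c i ih =>
    cases T with
    | nil => simp [allNodes, internalNodes, leafNodes] at h
    | node a l r =>
      have := ih (cons_mem_allNodes.1 h)
      simp only [List.length_cons, BinaryTree.height]
      cases c <;> simp at this <;> omega

theorem exists_leaf_prefix {T : BinaryTree Unit} {i : Node} (h : i ∈ allNodes T) :
    ∃ l ∈ leafNodes T, i <+: l := by
  induction hd : T.height - i.length generalizing i with
  | zero =>
    refine ⟨i, ?_, List.prefix_refl _⟩
    by_contra hl
    have hi := concat_mem_allNodes (b := true).2 (mem_internalNodes_of_mem_allNodes h hl)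
    have := length_le_height hi
    simp at this
    omega
  | succ d ih =>
    by_cases hl : i ∈ leafNodes T
    · exact ⟨i, hl, List.prefix_refl _⟩
    have hi := concat_mem_allNodes (b := true).2 (mem_internalNodes_of_mem_allNodes h hl)
    obtain ⟨l, hl, hp⟩ := ih hi (by simp; omega)
    exact ⟨l, hl, (List.prefix_append _ _).trans hp⟩

/-- `S` is a truncation of `T` at the same root, so the way down to a leaf of `T` has to leave `S`
through a leaf of `S`. -/
theorem exists_leaf_of_ancestor {T : BinaryTree Unit} {x : Node} (S : BinaryTree Unit)
    (hS : allNodes S ⊆ allNodes T) (hx : x ∈ leafNodes T) : ∃ j ∈ leafNodes S, j <+: x := by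
  induction x generalizing S T with
  | nil =>
    have := hS (nil_mem_allNodes S)
    refine ⟨[], ?_, List.prefix_refl _⟩
    by_contra h
    have h1 := mem_internalNodes_of_mem_allNodes (nil_mem_allNodes S) h
    have h2 := concat_mem_allNodes.1 (hS (concat_mem_allNodes (b := true).2 h1))
    exact notMem_leafNodes_of_mem_internalNodes h2 hx
  | cons b x ih =>
    cases T with
    | nil => simp [leafNodes] at hx
    | node a l r =>
      cases S with
      | nil => exact ⟨[], by simp [leafNodes], List.nil_prefix⟩
      | node a' l' r' =>
        obtain ⟨j, hj, hjx⟩ := ih (T := if b then r else l) (if b then r' else l')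
          (fun i hi => cons_mem_allNodes.1 (hS (cons_mem_allNodes.2 hi))) (cons_mem_leafNodes.1 hx)
        exact ⟨b :: j, cons_mem_leafNodes.2 hj, List.prefix_cons_inj b |>.2 hjx⟩

theorem card_image_cons_union (b c : Bool) (hbc : b ≠ c) (s t : Finset Node) :
    (s.image (List.cons b) ∪ t.image (List.cons c)).card = s.card + t.card := by
  rw [Finset.card_union_of_disjoint, Finset.card_image_of_injective _ List.cons_injective,
    Finset.card_image_of_injective _ List.cons_injective]
  rw [Finset.disjoint_left]
  intro x hx hx'
  simp only [Finset.mem_image] at hx hx'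
  obtain ⟨y, -, rfl⟩ := hx
  obtain ⟨z, -, hz⟩ := hx'
  simp at hz
  exact hbc hz.1.symm

theorem card_leafNodes (T : BinaryTree Unit) : (leafNodes T).card = T.numLeaves := by
  induction T with
  | nil => simp [leafNodes, BinaryTree.numLeaves]
  | node a l r ihl ihr =>
    rw [leafNodes, card_image_cons_union _ _ (by simp), ihl, ihr, BinaryTree.numLeaves]

theorem card_internalNodes (T : BinaryTree Unit) : (internalNodes T).card + 1 = T.numLeaves := by
  induction T with
  | nil => simp [internalNodes, BinaryTree.numLeaves]
  | node a l r ihl ihr =>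
    rw [internalNodes, Finset.card_insert_of_notMem (by simp),
      card_image_cons_union _ _ (by simp), BinaryTree.numLeaves]
    omega

theorem leavesBelow_nil (T : BinaryTree Unit) : leavesBelow T [] = leafNodes T := by
  simp [leavesBelow]

theorem card_leavesBelow_cons (l r : BinaryTree Unit) (b : Bool) (i : Node) :
    (leavesBelow (.node () l r) (b :: i)).card = (leavesBelow (if b then r else l) i).card := by
  rw [← Finset.card_image_of_injective (leavesBelow (if b then r else l) i)
    (List.cons_injective (a := b))]
  congr 1
  ext x
  simp only [leavesBelow, Finset.mem_filter, Finset.mem_image]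
  constructor
  · rintro ⟨hx, t, rfl⟩
    exact ⟨i ++ t, ⟨cons_mem_leafNodes.1 hx, t, rfl⟩, rfl⟩
  · rintro ⟨y, ⟨hy, hi⟩, rfl⟩
    exact ⟨cons_mem_leafNodes.2 hy, (List.prefix_cons_inj b).2 hi⟩

theorem card_leavesBelow_internal {T : BinaryTree Unit} {i : Node} (h : i ∈ internalNodes T) :
    (leavesBelow T i).card =
      (leavesBelow T (leftChild i)).card + (leavesBelow T (rightChild i)).card := by
  rw [← Finset.card_union_of_disjoint]
  · congr 1
    ext x
    simp only [leavesBelow, Finset.mem_union, Finset.mem_filter]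
    rw [prefix_iff_eq_or_child]
    constructor
    · rintro ⟨hx, rfl | hl | hr⟩
      · exact absurd hx (notMem_leafNodes_of_mem_internalNodes h)
      · exact Or.inl ⟨hx, hl⟩
      · exact Or.inr ⟨hx, hr⟩
    · rintro (h | h)
      · exact ⟨h.1, Or.inr (Or.inl h.2)⟩
      · exact ⟨h.1, Or.inr (Or.inr h.2)⟩
  · rw [Finset.disjoint_left]
    intro x hx hx'
    simp only [leavesBelow, Finset.mem_filter] at hx hx'
    have := concat_prefix_unique hx.2 hx'.2
    simp at this

theorem leavesBelow_nonempty {T : BinaryTree Unit} {i : Node} (h : i ∈ allNodes T) :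
    (leavesBelow T i).Nonempty := by
  obtain ⟨l, hl, hp⟩ := exists_leaf_prefix h
  exact ⟨l, Finset.mem_filter.2 ⟨hl, hp⟩⟩

/-! ### Pruning -/

theorem internalNodes_prune_subset (f : ℝ) (T : BinaryTree Unit) :
    internalNodes (prune f T) ⊆ internalNodes T := by
  induction T with
  | nil => simp [prune]
  | node a l r ihl ihr =>
    intro i hi
    rw [prune] at hi
    split_ifs at hi with hf
    · simp [internalNodes] at hi
    · cases i with
      | nil => exact nil_mem_internalNodes_node l r
      | cons b i =>
        rw [cons_mem_internalNodes] at hi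
        refine cons_mem_internalNodes.2 ?_
        cases b
        · exact ihl hi
        · exact ihr hi

theorem allNodes_subset_of_internalNodes_subset {S T : BinaryTree Unit}
    (h : internalNodes S ⊆ internalNodes T) : allNodes S ⊆ allNodes T := by
  intro i hi
  induction i using List.reverseRecOn with
  | nil => exact nil_mem_allNodes T
  | append_singleton i b _ =>
    exact concat_mem_allNodes.2 (h (concat_mem_allNodes.1 hi))

/-- Guarantees that a vote has enough pairs to draw from, and that the root of a nontrivial `prune f
T` has more than one pair when `1 < f`. -/
theorem le_card_crossPairs_of_mem_prune {f : ℝ} {T : BinaryTree Unit} {i : Node}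
    (h : i ∈ internalNodes (prune f T)) : f ≤ ((crossPairs T i).card : ℝ) := by
  rw [crossPairs, Finset.card_product]
  induction T generalizing i with
  | nil => simp [prune, internalNodes] at h
  | node a l r ihl ihr =>
    rw [prune] at h
    split_ifs at h with hf
    · simp [internalNodes] at h
    · cases i with
      | nil =>
        have h1 := card_leavesBelow_cons l r false []
        have h2 := card_leavesBelow_cons l r true []
        simp only [Bool.false_eq_true, if_false, if_true, leavesBelow_nil, card_leafNodes] at h1 h2
        rw [leftChild, rightChild, List.nil_append, List.nil_append, h1, h2]
        exact not_lt.1 hf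
      | cons b i =>
        have hl : leftChild (b :: i) = b :: leftChild i := rfl
        have hr : rightChild (b :: i) = b :: rightChild i := rfl
        rw [hl, hr, card_leavesBelow_cons, card_leavesBelow_cons]
        rw [cons_mem_internalNodes] at h
        cases b
        · exact ihl h
        · exact ihr h

theorem card_crossPairs_lt_of_leaf_prune {f : ℝ} {T : BinaryTree Unit} {i : Node}
    (h : i ∈ leafNodes (prune f T)) (hi : i ∈ internalNodes T) :
    ((crossPairs T i).card : ℝ) < f := by
  rw [crossPairs, Finset.card_product]
  induction T generalizing i with
  | nil => simp [internalNodes] at hi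
  | node a l r ihl ihr =>
    rw [prune] at h
    split_ifs at h with hf
    · simp only [leafNodes, Finset.mem_singleton] at h
      subst h
      have h1 := card_leavesBelow_cons l r false []
      have h2 := card_leavesBelow_cons l r true []
      simp only [Bool.false_eq_true, if_false, if_true, leavesBelow_nil, card_leafNodes] at h1 h2
      rw [leftChild, rightChild, List.nil_append, List.nil_append, h1, h2]
      exact hf
    · cases i with
      | nil => exact absurd h (nil_notMem_leafNodes_node _ _)
      | cons b i =>
        have hl : leftChild (b :: i) = b :: leftChild i := rfl
        have hr : rightChild (b :: i) = b :: rightChild i := rfl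
        rw [hl, hr, card_leavesBelow_cons, card_leavesBelow_cons]
        rw [cons_mem_internalNodes] at hi
        rw [cons_mem_leafNodes] at h
        cases b
        · exact ihl h hi
        · exact ihr h hi

/-- If the children of `i` have `a, b ≥ 1` leaves, then `(a - 1) (b - 1) ≥ 0` gives `a + b ≤ a b +
1`, and `a b < f` at a node where the tree was pruned. -/
theorem card_leavesBelow_le_of_leaf_prune {f : ℝ} {T : BinaryTree Unit} {i : Node} (hf : 0 ≤ f)
    (h : i ∈ leafNodes (prune f T)) : ((leavesBelow T i).card : ℝ) ≤ f + 1 := by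
  have hS := allNodes_subset_of_internalNodes_subset (internalNodes_prune_subset f T)
  rcases mem_allNodes.1 (hS (leafNodes_subset_allNodes _ h)) with hi | hi
  · have h1 := card_crossPairs_lt_of_leaf_prune h hi
    rw [crossPairs, Finset.card_product] at h1
    rw [card_leavesBelow_internal hi]
    have h2 := (leavesBelow_nonempty (concat_mem_allNodes (b := false).2 hi)).card_pos
    have h3 := (leavesBelow_nonempty (concat_mem_allNodes (b := true).2 hi)).card_pos
    change 0 < (leavesBelow T (leftChild i)).card at h2
    change 0 < (leavesBelow T (rightChild i)).card at h3
    have : (leavesBelow T (leftChild i)).card + (leavesBelow T (rightChild i)).card ≤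
      (leavesBelow T (leftChild i)).card * (leavesBelow T (rightChild i)).card + 1 := by nlinarith
    have : (((leavesBelow T (leftChild i)).card + (leavesBelow T (rightChild i)).card : ℕ) : ℝ) ≤
      ((leavesBelow T (leftChild i)).card * (leavesBelow T (rightChild i)).card : ℕ) + 1 := by
      exact_mod_cast this
    linarith
  · have : leavesBelow T i ⊆ {i} := by
      intro x hx
      rw [leavesBelow, Finset.mem_filter] at hx
      rw [Finset.mem_singleton]
      exact (eq_of_leaf_prefix hi (leafNodes_subset_allNodes _ hx.1) hx.2).symm
    have := Finset.card_le_card this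
    rw [Finset.card_singleton] at this
    have : ((leavesBelow T i).card : ℝ) ≤ 1 := by exact_mod_cast this
    linarith

/-! ### Cuts -/

theorem mem_cuts {T : BinaryTree Unit} {A : Finset Node} :
    A ∈ cuts T ↔ A ⊆ internalNodes T ∧ ∀ i ∈ A, AncestorsIn A i := by
  simp only [cuts, Finset.mem_filter, Finset.mem_powerset, ancestorsIn_iff_take]

theorem mem_lowerBoundary {T : BinaryTree Unit} {A : Finset Node} {i : Node} :
    i ∈ lowerBoundary T A ↔ i ∈ allNodes T ∧ i ∉ A ∧ AncestorsIn A i := by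
  simp only [lowerBoundary, Finset.mem_filter, ancestorsIn_iff_take]

theorem mem_of_prefix_of_mem_cut {T : BinaryTree Unit} {A : Finset Node} (hA : A ∈ cuts T)
    {i j : Node} (hj : j ∈ A) (h : i <+: j) : i ∈ A := by
  by_cases hij : i = j
  · rwa [hij]
  · obtain ⟨b, hb⟩ := exists_concat_prefix h hij
    exact (mem_cuts.1 hA).2 j hj i b hb

theorem exists_mem_lowerBoundary {T : BinaryTree Unit} {A : Finset Node} {j : Node}
    (hj : j ∈ allNodes T) (hjA : j ∉ A) : ∃ i ∈ lowerBoundary T A, i <+: j := by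
  induction hn : j.length using Nat.strong_induction_on generalizing j with
  | _ n ih =>
    by_cases h : AncestorsIn A j
    · exact ⟨j, mem_lowerBoundary.2 ⟨hj, hjA, h⟩, List.prefix_refl _⟩
    · simp only [AncestorsIn, not_forall] at h
      obtain ⟨k, b, hk, hkA⟩ := h
      have hkj : k <+: j := (List.prefix_append _ _).trans hk
      have hlen := hk.length_le
      rw [List.length_append, List.length_singleton] at hlen
      obtain ⟨i, hi, hik⟩ := ih k.length (by omega) (mem_allNodes_of_prefix hj hkj) hkA rfl
      exact ⟨i, hi, hik.trans hkj⟩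

theorem eq_of_mem_lowerBoundary {T : BinaryTree Unit} {A : Finset Node} {i j : Node}
    (hi : i ∈ lowerBoundary T A) (hj : j ∈ lowerBoundary T A) (h : i <+: j) : i = j := by
  by_contra hne
  obtain ⟨b, hb⟩ := exists_concat_prefix h hne
  exact (mem_lowerBoundary.1 hi).2.1 ((mem_lowerBoundary.1 hj).2.2 i b hb)

theorem inter_mem_cuts {S T : BinaryTree Unit} (hS : internalNodes S ⊆ internalNodes T)
    {A : Finset Node} (hA : A ∈ cuts T) : A ∩ internalNodes S ∈ cuts T := by
  refine mem_cuts.2 ⟨fun i hi => hS (Finset.mem_inter.1 hi).2, fun i hi j b hj => ?_⟩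
  rw [Finset.mem_inter] at hi
  have : j <+: i := (List.prefix_append _ _).trans hj
  exact Finset.mem_inter.2 ⟨mem_of_prefix_of_mem_cut hA hi.1 this,
    mem_internalNodes_of_prefix hi.2 this⟩

/-- The right-hand side does not involve `T`: the restricted cut has the same lower boundary in `T`
as in `S`. This makes the output of a run on `S` a cut clustering of `T`. -/
theorem mem_lowerBoundary_inter {S T : BinaryTree Unit} (hS : internalNodes S ⊆ internalNodes T)
    {A : Finset Node} {i : Node} :
    i ∈ lowerBoundary T (A ∩ internalNodes S) ↔
      i ∈ allNodes S ∧ (i ∉ A ∨ i ∈ leafNodes S) ∧ AncestorsIn A i := by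
  rw [mem_lowerBoundary]
  constructor
  · rintro ⟨-, hiA, hanc⟩
    have hi : i ∈ allNodes S := by
      induction i using List.reverseRecOn with
      | nil => exact nil_mem_allNodes S
      | append_singleton i b _ =>
        exact concat_mem_allNodes.2 (Finset.mem_inter.1 (ancestorsIn_concat.1 hanc).2).2
    refine ⟨hi, ?_, hanc.subset Finset.inter_subset_left⟩
    by_contra hcon
    push Not at hcon
    exact hiA (Finset.mem_inter.2 ⟨hcon.1, mem_internalNodes_of_mem_allNodes hi hcon.2⟩)
  · rintro ⟨hi, hiA, hanc⟩
    refine ⟨allNodes_subset_of_internalNodes_subset hS hi, fun h => ?_, fun j b hj =>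
      Finset.mem_inter.2 ⟨hanc j b hj, mem_internalNodes_of_concat_prefix hi hj⟩⟩
    rw [Finset.mem_inter] at h
    rcases hiA with h' | h'
    · exact h' h.1
    · exact notMem_leafNodes_of_mem_internalNodes h.2 h'

/-! ### Weighted binary search -/

section Search

variable {S : BinaryTree Unit} {P : Node → ℝ}

theorem mass_take_add_drop (r : Node) (p : List Node) (k : ℕ) :
    mass S P r (p.take k) + mass S P r (p.drop k) = mass S P r p := by
  rw [mass, mass, mass, ← List.sum_append, ← List.map_append, List.take_append_drop]

theorem mass_nonneg {r : Node} {p : List Node} (h : ∀ x ∈ p, 0 < weight S P r x) :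
    0 ≤ mass S P r p := by
  apply List.sum_nonneg
  intro x hx
  obtain ⟨y, hy, rfl⟩ := List.mem_map.1 hx
  exact (h y hy).le

theorem weight_le_mass {r x : Node} {p : List Node} (h : ∀ x ∈ p, 0 < weight S P r x)
    (hx : x ∈ p) : weight S P r x ≤ mass S P r p := by
  refine List.single_le_sum ?_ _ (List.mem_map_of_mem hx)
  intro y hy
  obtain ⟨z, hz, rfl⟩ := List.mem_map.1 hy
  exact (h z hz).le

theorem mass_take_succ_lt {r : Node} {p : List Node} (h : ∀ x ∈ p, 0 < weight S P r x) {j k : ℕ}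
    (hjk : j < k) (hk : k ≤ p.length) : mass S P r (p.take j) < mass S P r (p.take k) := by
  have h1 := mass_take_add_drop (S := S) (P := P) r (p.take k) j
  rw [List.take_take, min_eq_left hjk.le] at h1
  have hne : (p.take k).drop j ≠ [] := by
    intro h
    have := congrArg List.length h
    simp at this
    omega
  obtain ⟨x, hx⟩ := List.exists_mem_of_ne_nil _ hne
  have hsub : ∀ x ∈ (p.take k).drop j, x ∈ p := fun x hx =>
    List.mem_of_mem_take (List.mem_of_mem_drop hx)
  have h2 := weight_le_mass (fun x hx => h x (hsub x hx)) hx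
  linarith [h x (hsub x hx)]

/-- Otherwise the prefixes of lengths `k + 1` and `k + 2` would both have mass below one half, and
the longer one would be strictly closer to it. So a right segment that is too heavy becomes light
without its first node. -/
theorem mid_drop_or (mid : MidRule S P) {r : Node} {p : List Node}
    (h : ∀ x ∈ p, 0 < weight S P r x) (hk : mid.idx r p + 2 < p.length) :
    mass S P r (p.drop (mid.idx r p + 1)) ≤ mass S P r p / 2 ∨
      mass S P r (p.drop (mid.idx r p + 2)) ≤ mass S P r p / 2 := by
  have h1 := mid.idx_min r p (by omega) (mid.idx r p + 1) (by omega)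
  have h2 := mass_take_succ_lt h (j := mid.idx r p + 1) (k := mid.idx r p + 2) (by omega) (by omega)
  have h3 := mass_take_add_drop (S := S) (P := P) r p (mid.idx r p + 1)
  have h4 := mass_take_add_drop (S := S) (P := P) r p (mid.idx r p + 2)
  by_contra! hcon
  rw [abs_of_pos (by linarith)] at h1
  rcases abs_cases (mass S P r p / 2 - mass S P r (p.take (mid.idx r p + 1 + 1))) with ⟨h5, h6⟩ | ⟨h5, h6⟩ <;>
    rw [h5] at h1 <;> linarith

/-- Mirror image of `mid_drop_or`: a left segment that is too heavy becomes light without its last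
node, since otherwise the previous index would be a better midpoint. -/
theorem mid_take_or (mid : MidRule S P) {r : Node} {p : List Node}
    (h : ∀ x ∈ p, 0 < weight S P r x) (hp : 2 ≤ p.length) (hk : 1 ≤ mid.idx r p) :
    mass S P r (p.take (mid.idx r p + 1)) ≤ mass S P r p / 2 ∨
      mass S P r (p.take (mid.idx r p)) ≤ mass S P r p / 2 := by
  have h0 := mid.idx_lt r p hp
  have h1 := mid.idx_min r p hp (mid.idx r p - 1) (by omega)
  rw [Nat.sub_add_cancel hk] at h1
  have h2 := mass_take_succ_lt h (j := mid.idx r p) (k := mid.idx r p + 1) (by omega) (by omega)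
  by_contra! hcon
  rw [abs_of_neg (by linarith), abs_of_neg (by linarith)] at h1
  linarith

/-- When all the weight in excess of `W` sits in the first node, the midpoint rule isolates this
node or leaves at most `W` on both sides: a longer prefix heavier than `W` would be farther from one
half than the prefix consisting of the first node. -/
theorem mid_of_tail_le (mid : MidRule S P) {r : Node} {p : List Node} {W : ℝ}
    (h : ∀ x ∈ p, 0 < weight S P r x) (hp : 2 ≤ p.length)
    (ht : mass S P r (p.drop 1) ≤ W) :
    mass S P r (p.drop (mid.idx r p + 1)) ≤ W ∧
      (mid.idx r p = 0 ∨ mass S P r (p.take (mid.idx r p + 1)) ≤ W) := by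
  have h0 := mid.idx_lt r p hp
  have h1 := mid.idx_min r p hp 0 (by omega)
  have h3 := mass_take_add_drop (S := S) (P := P) r p 1
  have h4 := mass_take_add_drop (S := S) (P := P) r p (mid.idx r p + 1)
  rcases Nat.eq_zero_or_pos (mid.idx r p) with hk | hk
  · rw [hk]
    exact ⟨ht, Or.inl rfl⟩
  · have h2 := mass_take_succ_lt h (j := 1) (k := mid.idx r p + 1) (by omega) (by omega)
    refine ⟨by linarith, Or.inr ?_⟩
    by_contra! hcon
    rw [abs_of_neg (a := mass S P r p / 2 - mass S P r (p.take (mid.idx r p + 1))) (by linarith)] at h1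
    rcases abs_cases (mass S P r p / 2 - mass S P r (p.take (0 + 1))) with ⟨h5, h6⟩ | ⟨h5, h6⟩ <;>
      rw [h5] at h1 <;> norm_num at h1 h6 <;> linarith

/-- Mirror image of `mid_of_tail_le`, comparing with the split just before the last node. -/
theorem mid_of_init_le (mid : MidRule S P) {r : Node} {p : List Node} {W : ℝ}
    (h : ∀ x ∈ p, 0 < weight S P r x) (hp : 2 ≤ p.length)
    (ht : mass S P r (p.take (p.length - 1)) ≤ W) :
    mass S P r (p.take (mid.idx r p + 1)) ≤ W ∧
      (mid.idx r p + 2 = p.length ∨ mass S P r (p.drop (mid.idx r p + 1)) ≤ W) := by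
  have h0 := mid.idx_lt r p hp
  have h1 := mid.idx_min r p hp (p.length - 2) (by omega)
  have h4 := mass_take_add_drop (S := S) (P := P) r p (mid.idx r p + 1)
  have he : p.length - 2 + 1 = p.length - 1 := by omega
  rw [he] at h1
  rcases Nat.lt_or_ge (mid.idx r p + 2) p.length with hk | hk
  · have h2 := mass_take_succ_lt h (j := mid.idx r p + 1) (k := p.length - 1) (by omega) (by omega)
    refine ⟨by linarith, Or.inr ?_⟩
    by_contra! hcon
    rw [abs_of_pos (by linarith)] at h1
    rcases abs_cases (mass S P r p / 2 - mass S P r (p.take (p.length - 1))) with ⟨h5, h6⟩ | ⟨h5, h6⟩ <;>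
      rw [h5] at h1 <;> linarith
  · have : mid.idx r p + 1 = p.length - 1 := by omega
    exact ⟨by rw [this]; exact ht, Or.inl (by omega)⟩

/-- A segment of mass at most `W` such that one step of the binary search is enough to find the
answer or to reduce the mass to at most `W / 2`. -/
def IsReducible (S : BinaryTree Unit) (P : Node → ℝ) (r : Node) (p : List Node) (W : ℝ) : Prop :=
  mass S P r p ≤ W ∧ (mass S P r p ≤ W / 2 ∨ mass S P r (p.drop 1) ≤ W / 2 ∨
    mass S P r (p.take (p.length - 1)) ≤ W / 2)

/-- A step fails to halve the mass only because of one heavy node next to the split, and this node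
is then an endpoint of the new segment. -/
theorem isReducible_child (mid : MidRule S P) {r : Node} {p q : List Node}
    (h : ∀ x ∈ p, 0 < weight S P r x) (hp : 2 ≤ p.length) (hq : 2 ≤ q.length)
    (hpq : q = p.take (mid.idx r p + 1) ∨ q = p.drop (mid.idx r p + 1)) :
    IsReducible S P r q (mass S P r p) := by
  have h4 := mass_take_add_drop (S := S) (P := P) r p (mid.idx r p + 1)
  have h5 := mass_nonneg (p := p.take (mid.idx r p + 1)) fun x hx => h x (List.mem_of_mem_take hx)
  have h6 := mass_nonneg (p := p.drop (mid.idx r p + 1)) fun x hx => h x (List.mem_of_mem_drop hx)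
  have h0 := mid.idx_lt r p hp
  rcases hpq with rfl | rfl
  · rw [List.length_take, min_eq_left h0.le] at hq
    refine ⟨by linarith, ?_⟩
    rcases mid_take_or mid h hp (by omega) with h' | h'
    · exact Or.inl h'
    · refine Or.inr (Or.inr ?_)
      rwa [List.length_take, min_eq_left h0.le, Nat.add_sub_cancel, List.take_take,
        min_eq_left (Nat.le_succ _)]
  · rw [List.length_drop] at hq
    refine ⟨by linarith, ?_⟩
    rcases mid_drop_or mid h (by omega) with h' | h'
    · exact Or.inl h'
    · refine Or.inr (Or.inl ?_)
      rwa [List.drop_drop]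

/-- The second of two consecutive steps: a heavy endpoint is either isolated, which ends the search,
or separated from enough other mass. -/
theorem IsReducible.child (mid : MidRule S P) {r : Node} {p q : List Node} {W : ℝ}
    (hr : IsReducible S P r p W)
    (h : ∀ x ∈ p, 0 < weight S P r x) (hp : 2 ≤ p.length)
    (hpq : q = p.take (mid.idx r p + 1) ∨ q = p.drop (mid.idx r p + 1)) :
    q.length ≤ 1 ∨ mass S P r q ≤ W / 2 := by
  have h4 := mass_take_add_drop (S := S) (P := P) r p (mid.idx r p + 1)
  have h5 := mass_nonneg (p := p.take (mid.idx r p + 1)) fun x hx => h x (List.mem_of_mem_take hx)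
  have h6 := mass_nonneg (p := p.drop (mid.idx r p + 1)) fun x hx => h x (List.mem_of_mem_drop hx)
  rcases hr.2 with h' | h' | h'
  · rcases hpq with rfl | rfl <;> exact Or.inr (by linarith)
  · obtain ⟨h7, h8⟩ := mid_of_tail_le mid h hp h'
    rcases hpq with rfl | rfl
    · rcases h8 with h8 | h8
      · left; rw [List.length_take]; omega
      · exact Or.inr h8
    · exact Or.inr h7
  · obtain ⟨h7, h8⟩ := mid_of_init_le mid h hp h'
    rcases hpq with rfl | rfl
    · exact Or.inr h7
    · rcases h8 with h8 | h8
      · left; rw [List.length_drop]; omega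
      · exact Or.inr h8

/-- The labels on the bottom-up path `p` are consistent with `u` being the last node of the path
that is below the cut; the label of the first node of `p` is irrelevant. -/
def Separates (y : Node → Bool) (p : List Node) (u : Node) : Prop :=
  ∃ a b, p = a ++ u :: b ∧ (∀ x ∈ b, y x = false) ∧ ∀ x ∈ (a ++ [u]).tail, y x = true

theorem Separates.mem {y : Node → Bool} {p : List Node} {u : Node} (h : Separates y p u) : u ∈ p := by
  obtain ⟨a, b, rfl, -, -⟩ := h
  simp

theorem Separates.take {y : Node → Bool} {p : List Node} {u : Node} (h : Separates y p u) {k : ℕ}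
    (hk : k + 1 < p.length) (hy : y (p.getD (k + 1) []) = false) :
    Separates y (p.take (k + 1)) u := by
  obtain ⟨a, b, rfl, hb, ha⟩ := h
  have hka : a.length ≤ k := by
    by_contra hcon
    rw [List.getD_eq_getElem _ _ hk] at hy
    have hk' : k + 1 < (a ++ [u]).length := by simp; omega
    have e : (a ++ u :: b)[k + 1] = (a ++ [u])[k + 1] := by
      have : a ++ u :: b = (a ++ [u]) ++ b := by simp
      simp only [this, List.getElem_append_left hk']
    rw [e] at hy
    have hm : (a ++ [u])[k + 1] ∈ (a ++ [u]).tail := by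
      rw [← List.drop_one, List.mem_drop_iff_getElem]
      exact ⟨k, by simpa using hk', by simp [Nat.add_comm]⟩
    rw [ha _ hm] at hy
    cases hy
  refine ⟨a, b.take (k - a.length), ?_, fun x hx => hb x (List.mem_of_mem_take hx), ha⟩
  rw [List.take_append, List.take_of_length_le (by omega),
    show k + 1 - a.length = (k - a.length) + 1 by omega, List.take_succ_cons]

theorem Separates.drop {y : Node → Bool} {p : List Node} {u : Node} (h : Separates y p u) {k : ℕ}
    (hk : k + 1 < p.length) (hy : y (p.getD (k + 1) []) = true) :
    Separates y (p.drop (k + 1)) u := by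
  obtain ⟨a, b, rfl, hb, ha⟩ := h
  have hka : k + 1 ≤ a.length := by
    by_contra hcon
    rw [List.getD_eq_getElem _ _ hk] at hy
    have hm : (a ++ u :: b)[k + 1] ∈ b := by
      rw [List.getElem_append_right (by omega)]
      obtain ⟨j, hj⟩ : ∃ j, k + 1 - a.length = j + 1 := ⟨k - a.length, by omega⟩
      simp only [hj, List.getElem_cons_succ]
      exact List.getElem_mem _
    rw [hb _ hm] at hy
    cases hy
  refine ⟨a.drop (k + 1), b, ?_, hb, fun x hx => ha x ?_⟩
  · rw [List.drop_append, show k + 1 - a.length = 0 by omega, List.drop_zero]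
  · have : a.drop (k + 1) ++ [u] = (a ++ [u]).drop (k + 1) := by
      rw [List.drop_append, show k + 1 - a.length = 0 by omega, List.drop_zero]
    rw [this, List.tail_drop] at hx
    rw [← List.drop_one]
    rw [show k + 1 + 1 = 1 + (k + 1) by omega, ← List.drop_drop] at hx
    exact List.mem_of_mem_drop hx

theorem search_of_length_le_one (mid : MidRule S P) (y : Node → Bool) (r : Node) {p : List Node}
    (hp : p.length ≤ 1) : search mid y r p = (p.headD [], []) := by
  rw [search, dif_neg (by omega)]

theorem exists_search_step (mid : MidRule S P) {y : Node → Bool} (r : Node) {p : List Node} {u : Node}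
    (h : Separates y p u) (hp : 2 ≤ p.length) :
    ∃ q i, (q = p.take (mid.idx r p + 1) ∨ q = p.drop (mid.idx r p + 1)) ∧ Separates y q u ∧
      q.length < p.length ∧
      search mid y r p = ((search mid y r q).1, i :: (search mid y r q).2) := by
  have h0 := mid.idx_lt r p hp
  rw [search, dif_pos hp]
  cases hy : y (p.getD (mid.idx r p + 1) [])
  · refine ⟨_, p.getD (mid.idx r p + 1) [], Or.inl rfl, h.take h0 hy,
      by rw [List.length_take]; omega, ?_⟩
    simp only [hy, Bool.false_eq_true, if_false]
  · refine ⟨_, p.getD (mid.idx r p + 1) [], Or.inr rfl, h.drop h0 hy,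
      by rw [List.length_drop]; omega, ?_⟩
    simp only [hy, if_true]

theorem search_fst (mid : MidRule S P) {y : Node → Bool} (r : Node) {p : List Node} {u : Node}
    (h : Separates y p u) : (search mid y r p).1 = u := by
  induction hn : p.length using Nat.strong_induction_on generalizing p with
  | _ n ih =>
    by_cases hp : 2 ≤ p.length
    · obtain ⟨q, i, -, hq, hlt, he⟩ := exists_search_step mid r h hp
      rw [he]
      exact ih _ (by omega) hq rfl
    · rw [search_of_length_le_one mid y r (by omega)]
      obtain ⟨a, b, rfl, -, -⟩ := h
      have : a.length = 0 := by simp at hp; omega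
      rw [List.length_eq_zero_iff] at this
      simp [this]

/-- Both bounds are proved in one induction because they feed each other: a step from an arbitrary
segment leads to a reducible one, and a step from a reducible segment leads to an arbitrary one of
at most half the mass. The mass never falls below the weight of `u`, hence the logarithm, with
factor `2` for two steps per halving. -/
theorem search_length_le (mid : MidRule S P) {y : Node → Bool} {r : Node} {p : List Node} {u : Node}
    (h : Separates y p u) (hpos : ∀ x ∈ p, 0 < weight S P r x) :
    ((search mid y r p).2.length : ℝ) ≤ 2 * Real.logb 2 (mass S P r p / weight S P r u) + 2 ∧
    ∀ W, IsReducible S P r p W →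
      ((search mid y r p).2.length : ℝ) ≤ 2 * Real.logb 2 (W / weight S P r u) + 1 := by
  have hu := hpos u h.mem
  have hlog : ∀ W, weight S P r u ≤ W → 0 ≤ Real.logb 2 (W / weight S P r u) := fun W hW =>
    Real.logb_nonneg (by norm_num) ((one_le_div hu).2 hW)
  have hhalf : ∀ W V, weight S P r u ≤ W → W ≤ V / 2 →
      Real.logb 2 (W / weight S P r u) ≤ Real.logb 2 (V / weight S P r u) - 1 := by
    intro W V hW hV
    have h1 : Real.logb 2 (V / weight S P r u) - 1 = Real.logb 2 (V / weight S P r u / 2) := by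
      rw [Real.logb_div (x := V / weight S P r u) (by apply ne_of_gt; apply div_pos <;> linarith)
        (by norm_num), Real.logb_self_eq_one (by norm_num)]
    rw [h1]
    apply Real.logb_le_logb_of_le (by norm_num) (div_pos (by linarith) hu)
    rw [div_right_comm]
    gcongr
  induction hn : p.length using Nat.strong_induction_on generalizing p with
  | _ n ih =>
    have hle := weight_le_mass hpos h.mem
    by_cases hp : 2 ≤ p.length
    · obtain ⟨q, i, hqp, hq, hlt, he⟩ := exists_search_step mid r h hp
      have hqpos : ∀ x ∈ q, 0 < weight S P r x := by
        rcases hqp with rfl | rfl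
        · exact fun x hx => hpos x (List.mem_of_mem_take hx)
        · exact fun x hx => hpos x (List.mem_of_mem_drop hx)
      have hqle := weight_le_mass hqpos hq.mem
      obtain ⟨ih1, ih2⟩ := ih _ (by omega) hq hqpos rfl
      rw [he]
      push_cast [List.length_cons]
      constructor
      · by_cases hq2 : 2 ≤ q.length
        -- One query, then the reducible bound with `W` equal to the mass of `p`: `1 + (2 log + 1)`.
        · linarith [ih2 _ (isReducible_child mid hpos hp hq2 hqp)]
        · rw [search_of_length_le_one mid y r (by omega : q.length ≤ 1)]
          have := hlog _ hle
          simp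
          linarith
      · intro W hW
        have := hlog W (hle.trans hW.1)
        rcases hW.child mid hpos hp hqp with hq1 | hqW
        · rw [search_of_length_le_one mid y r hq1]
          simp
          linarith
        -- One query, then the general bound at mass `W / 2`: `1 + (2 (log - 1) + 2) = 2 log + 1`.
        · linarith [hhalf _ _ hqle hqW]
    · rw [search_of_length_le_one mid y r (by omega)]
      refine ⟨?_, fun W hW => ?_⟩
      · have := hlog _ hle
        simp
        linarith
      · have := hlog W (hle.trans hW.1)
        simp
        linarith

/-- The queried index is always at least `1`, so the head of the path, a leaf in the applications,
is never asked for. -/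
theorem search_congr (mid : MidRule S P) {y y' : Node → Bool} (r : Node) {p : List Node}
    (h : ∀ x ∈ p.tail, y x = y' x) : search mid y r p = search mid y' r p := by
  induction hn : p.length using Nat.strong_induction_on generalizing p with
  | _ n ih =>
    by_cases hp : 2 ≤ p.length
    · have h0 := mid.idx_lt r p hp
      have hy : y (p.getD (mid.idx r p + 1) []) = y' (p.getD (mid.idx r p + 1) []) := by
        apply h
        rw [List.getD_eq_getElem _ _ h0, ← List.drop_one, List.mem_drop_iff_getElem]
        exact ⟨mid.idx r p, by omega, by simp [Nat.add_comm]⟩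
      have h1 : search mid y r (p.drop (mid.idx r p + 1)) =
          search mid y' r (p.drop (mid.idx r p + 1)) := by
        refine ih _ ?_ (fun x hx => h x ?_) rfl
        · rw [List.length_drop]; omega
        · rw [List.tail_drop, show mid.idx r p + 1 + 1 = 1 + (mid.idx r p + 1) by omega,
            ← List.drop_drop, List.drop_one] at hx
          exact List.mem_of_mem_drop hx
      have h2 : search mid y r (p.take (mid.idx r p + 1)) =
          search mid y' r (p.take (mid.idx r p + 1)) := by
        refine ih _ ?_ (fun x hx => h x ?_) rfl
        · rw [List.length_take]; omega
        · exact ((List.take_sublist _ _).tail).subset hx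
      rw [search, search, dif_pos hp, dif_pos hp]
      simp only [hy, h1, h2]
    · rw [search_of_length_le_one mid y r (by omega), search_of_length_le_one mid y' r (by omega)]

end Search

/-! ### Bottom-up paths and hanging nodes -/

theorem pathUp_self (r : Node) : pathUp r r = [r] := by
  simp [pathUp]

theorem pathUp_concat {r l : Node} (b : Bool) (h : r <+: l) :
    pathUp r (l ++ [b]) = (l ++ [b]) :: pathUp r l := by
  have hlen := h.length_le
  rw [pathUp, pathUp, List.length_append, List.length_singleton,
    show l.length + 1 + 1 - r.length = (l.length + 1 - r.length) + 1 by omega,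
    List.range_succ_eq_map, List.map_cons, List.map_map]
  congr 1
  · rw [Nat.sub_zero, List.take_of_length_le (by simp)]
  · apply List.map_congr_left
    intro k hk
    simp only [Function.comp, Nat.succ_eq_add_one]
    rw [List.take_append_of_le_length (by omega)]
    congr 1
    omega

theorem pathUp_induction {r : Node} {motive : (l : Node) → r <+: l → Prop}
    (self : motive r (List.prefix_refl r))
    (concat : ∀ l b (h : r <+: l), motive l h → motive (l ++ [b]) (h.trans (List.prefix_append _ _)))
    {l : Node} (h : r <+: l) : motive l h := by
  obtain ⟨t, rfl⟩ := id h
  induction t using List.reverseRecOn with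
  | nil => simpa using self
  | append_singleton t b ih =>
    have := concat (r ++ t) b (List.prefix_append _ _) (ih _)
    simpa using this

theorem mem_pathUp {r l x : Node} (h : r <+: l) : x ∈ pathUp r l ↔ r <+: x ∧ x <+: l := by
  induction h using pathUp_induction with
  | self =>
    rw [pathUp_self, List.mem_singleton]
    constructor
    · rintro rfl; simp
    · exact fun h => (h.1.eq_of_length_le h.2.length_le).symm
  | concat l b h ih =>
    rw [pathUp_concat b h, List.mem_cons, ih, List.prefix_concat_iff]
    constructor
    · rintro (rfl | h')
      · exact ⟨h.trans (List.prefix_append _ _), Or.inl rfl⟩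
      · exact ⟨h'.1, Or.inr h'.2⟩
    · rintro ⟨h1, h2 | h2⟩
      · exact Or.inl h2
      · exact Or.inr ⟨h1, h2⟩

theorem length_pathUp (r l : Node) : (pathUp r l).length = l.length + 1 - r.length := by
  simp [pathUp]

theorem nodup_pathUp {r l : Node} (h : r <+: l) : (pathUp r l).Nodup := by
  induction h using pathUp_induction with
  | self => simp [pathUp_self]
  | concat l b h ih =>
    rw [pathUp_concat b h, List.nodup_cons]
    exact ⟨fun hm => not_concat_prefix l b ((mem_pathUp h).1 hm).2, ih⟩

theorem exists_pathUp_cons {r u : Node} (h : r <+: u) :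
    ∃ b, pathUp r u = u :: b ∧ ∀ x ∈ b, ∃ c, x ++ [c] <+: u := by
  induction h using pathUp_induction with
  | self => exact ⟨[], pathUp_self r, by simp⟩
  | concat l b h _ =>
    refine ⟨_, pathUp_concat b h, fun x hx => ?_⟩
    obtain ⟨-, t, rfl⟩ := (mem_pathUp h).1 hx
    cases t with
    | nil => exact ⟨b, by simp⟩
    | cons c t => exact ⟨c, t ++ [b], by simp⟩

/-- The last clause omits the head `l` of the path: the remaining nodes have a child on the way to
`l`, hence are internal and have meaningful labels. -/
theorem exists_pathUp_split {r u l : Node} (hr : r <+: u) (hu : u <+: l) :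
    ∃ a b, pathUp r l = a ++ u :: b ∧ (∀ x ∈ b, ∃ c, x ++ [c] <+: u) ∧
      (∀ x ∈ a ++ [u], u <+: x ∧ x <+: l) ∧
      ∀ x ∈ (a ++ [u]).tail, u <+: x ∧ ∃ c, x ++ [c] <+: l := by
  induction hu using pathUp_induction with
  | self =>
    obtain ⟨b, hb, hb'⟩ := exists_pathUp_cons hr
    exact ⟨[], b, hb, hb', by simp, by simp⟩
  | concat l c h ih =>
    obtain ⟨a, b, he, hb, ha, -⟩ := ih
    refine ⟨(l ++ [c]) :: a, b, by rw [pathUp_concat c (hr.trans h), he]; rfl, hb, ?_, ?_⟩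
    · intro x hx
      rw [List.cons_append, List.mem_cons] at hx
      rcases hx with rfl | hx
      · exact ⟨h.trans (List.prefix_append _ _), List.prefix_refl _⟩
      · exact ⟨(ha x hx).1, (ha x hx).2.trans (List.prefix_append _ _)⟩
    · intro x hx
      obtain ⟨h1, t, rfl⟩ := ha x hx
      refine ⟨h1, ?_⟩
      cases t with
      | nil => exact ⟨c, by simp⟩
      | cons d t => exact ⟨d, t ++ [c], by simp⟩

theorem sibling_concat (v : Node) (b : Bool) : sibling (v ++ [b]) = v ++ [!b] := by
  simp [sibling]

theorem mem_hanging {r u j : Node} (h : r <+: u) :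
    j ∈ hanging r u ↔ ∃ v b, r <+: v ∧ v ++ [b] <+: u ∧ j = v ++ [!b] := by
  simp only [hanging, Finset.mem_image, Finset.mem_Ioc]
  constructor
  · rintro ⟨k, ⟨h1, h2⟩, rfl⟩
    obtain ⟨k, rfl⟩ : ∃ m, k = m + 1 := ⟨k - 1, by omega⟩
    refine ⟨u.take k, u[k], ?_, ?_, ?_⟩
    · rw [List.prefix_take_iff]
      exact ⟨h, by omega⟩
    · rw [List.take_append_getElem]
      exact List.take_prefix _ _
    · rw [← List.take_append_getElem (show k < u.length by omega), sibling_concat]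
  · rintro ⟨v, b, hv, ⟨t, rfl⟩, rfl⟩
    refine ⟨v.length + 1, ⟨by have := hv.length_le; omega, by simp⟩, ?_⟩
    rw [List.take_left' (by simp), sibling_concat]

/-! ### Correctness of WDP -/

section Correctness

variable {S : BinaryTree Unit} {P : Node → ℝ}

/-- The answers `y` are the labels of the cut `A` of `S`. -/
def Consistent (S : BinaryTree Unit) (A : Finset Node) (y : Node → Bool) : Prop :=
  ∀ i ∈ internalNodes S, y i = decide (i ∉ A)

/-- Along a bottom-up path the labels switch once from below to above the cut, and the last node
below is the boundary node `u`. -/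
theorem Consistent.separates {A : Finset Node} {y : Node → Bool} (hy : Consistent S A y)
    (hA : A ∈ cuts S) {r u l : Node} (hu : u ∈ lowerBoundary S A) (hl : l ∈ leafNodes S)
    (hru : r <+: u) (hul : u <+: l) : Separates y (pathUp r l) u := by
  obtain ⟨huS, huA, hanc⟩ := mem_lowerBoundary.1 hu
  obtain ⟨a, b, he, hb, -, ha⟩ := exists_pathUp_split hru hul
  refine ⟨a, b, he, fun x hx => ?_, fun x hx => ?_⟩
  · obtain ⟨c, hc⟩ := hb x hx
    rw [hy x (mem_internalNodes_of_concat_prefix huS hc)]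
    simpa using hanc x c hc
  · obtain ⟨h1, c, hc⟩ := ha x hx
    rw [hy x (mem_internalNodes_of_concat_prefix (leafNodes_subset_allNodes S hl) hc)]
    simpa using fun hxA => huA (mem_of_prefix_of_mem_cut hA hxA h1)

/-- The leaf `l` is below the cut, so some boundary node is an ancestor of it; it cannot lie
strictly above `r`, whose proper ancestors are all above the cut. -/
theorem exists_lowerBoundary_between {A : Finset Node} (hA : A ∈ cuts S) {r l : Node}
    (hl : l ∈ leafNodes S) (hrl : r <+: l) (hr : AncestorsIn A r) :
    ∃ u ∈ lowerBoundary S A, r <+: u ∧ u <+: l := by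
  obtain ⟨u, hu, hul⟩ := exists_mem_lowerBoundary (A := A) (leafNodes_subset_allNodes S hl)
    (fun h => notMem_leafNodes_of_mem_internalNodes ((mem_cuts.1 hA).1 h) hl)
  refine ⟨u, hu, ?_, hul⟩
  rcases List.prefix_or_prefix_of_prefix hrl hul with h | h
  · exact h
  · by_cases hur : u = r
    · rw [hur]
    · obtain ⟨b, hb⟩ := exists_concat_prefix h hur
      exact absurd (hr u b hb) (mem_lowerBoundary.1 hu).2.1

/-- The invariant of the forest of WDP for the ground-truth cut `A` of `S`. -/
structure IsForest (S : BinaryTree Unit) (A : Finset Node) (F : Finset Node) : Prop where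
  subset : F ⊆ allNodes S
  antichain : ∀ f ∈ F, ∀ g ∈ F, f <+: g → f = g
  ancestors : ∀ f ∈ F, AncestorsIn A f

/-- The forest after a round in the tree with root `r` that ends at `u`. -/
def nextForest (S : BinaryTree Unit) (F : Finset Node) (r u : Node) : Finset Node :=
  F.erase r ∪ (hanging r u).filter (fun j => j ∉ leafNodes S)

theorem mem_nextForest {F : Finset Node} {r u f : Node} (h : r <+: u) :
    f ∈ nextForest S F r u ↔ (f ≠ r ∧ f ∈ F) ∨
      (∃ v b, r <+: v ∧ v ++ [b] <+: u ∧ f = v ++ [!b]) ∧ f ∉ leafNodes S := by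
  rw [nextForest, Finset.mem_union, Finset.mem_erase, Finset.mem_filter, mem_hanging h]

theorem exists_prefix_of_mem_nextForest {F : Finset Node} {r u f : Node} (hr : r ∈ F) (h : r <+: u)
    (hf : f ∈ nextForest S F r u) : ∃ g ∈ F, g <+: f := by
  rcases (mem_nextForest h).1 hf with h' | ⟨⟨v, b, hv, -, rfl⟩, -⟩
  · exact ⟨f, h'.2, List.prefix_refl _⟩
  · exact ⟨r, hr, hv.trans (List.prefix_append _ _)⟩

/-- New roots hang off the path from `r` to `u`, and old ones are incomparable with `r`; so the new
forest contains nothing on the path or below `u`. This yields termination, the loss of a leaf of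
`T'_c`, and the independence of the answers from the part of the cut that is still unknown. -/
theorem not_prefix_of_mem_nextForest {A F : Finset Node} (hF : IsForest S A F) {r u f x : Node}
    (hr : r ∈ F) (h : r <+: u) (hf : f ∈ nextForest S F r u) (hrx : r <+: x)
    (hx : x <+: u ∨ u <+: x) : ¬ f <+: x := by
  intro hfx
  rcases (mem_nextForest h).1 hf with ⟨hne, hfF⟩ | ⟨⟨v, b, hv, hvu, rfl⟩, -⟩
  · rcases List.prefix_or_prefix_of_prefix hfx hrx with h' | h'
    · exact hne (hF.antichain _ hfF _ hr h')
    · exact hne (hF.antichain _ hr _ hfF h').symm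
  · have hvx : ∃ w, v ++ [!b] <+: w ∧ v ++ [b] <+: w := by
      rcases hx with hx | hx
      · exact ⟨u, hfx.trans hx, hvu⟩
      · exact ⟨x, hfx, hvu.trans hx⟩
    obtain ⟨w, h1, h2⟩ := hvx
    have := concat_prefix_unique h1 h2
    cases b <;> simp at this

theorem IsForest.next {A F : Finset Node} (hF : IsForest S A F) {r u : Node} (hr : r ∈ F)
    (h : r <+: u) (hu : u ∈ lowerBoundary S A) : IsForest S A (nextForest S F r u) := by
  obtain ⟨huS, huA, hanc⟩ := mem_lowerBoundary.1 hu
  refine ⟨fun f hf => ?_, fun f hf g hg hfg => ?_, fun f hf => ?_⟩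
  · rcases (mem_nextForest h).1 hf with h' | ⟨⟨v, b, hv, hvu, rfl⟩, -⟩
    · exact hF.subset h'.2
    · exact concat_mem_allNodes.2 (mem_internalNodes_of_concat_prefix huS hvu)
  · rcases (mem_nextForest h).1 hg with hg' | ⟨⟨v', b', hv', hvu', rfl⟩, -⟩
    · rcases (mem_nextForest h).1 hf with hf' | ⟨⟨v, b, hv, hvu, rfl⟩, -⟩
      · exact hF.antichain _ hf'.2 _ hg'.2 hfg
      · exact absurd (hF.antichain _ hr _ hg'.2 ((hv.trans (List.prefix_append _ _)).trans hfg)).symm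
          hg'.1
    · rcases List.prefix_concat_iff.1 hfg with h' | h'
      · exact h'
      · exact absurd h' (not_prefix_of_mem_nextForest hF hr h hf hv'
          (Or.inl ((List.prefix_append _ _).trans hvu')))
  · rcases (mem_nextForest h).1 hf with h' | ⟨⟨v, b, hv, hvu, rfl⟩, -⟩
    · exact hF.ancestors _ h'.2
    · exact ancestorsIn_concat.2 ⟨hanc.mono ((List.prefix_append _ _).trans hvu), hanc v b hvu⟩

/-! ### Invariants and termination of a run of WDP. -/

theorem wdpStep_eq (rule : PathRule S P) (mid : MidRule S P) {y : Node → Bool} {st : WDPState}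
    {A : Finset Node} (hA : A ∈ cuts S) (hy : Consistent S A y) (hF : IsForest S A st.forest)
    (hne : st.forest.Nonempty) :
    ∃ r ∈ st.forest, ∃ l ∈ leafNodes S, rule.pick st = (r, l) ∧
      ∃ u ∈ lowerBoundary S A, r <+: u ∧ u <+: l ∧ Separates y (pathUp r l) u ∧
        wdpStep rule mid y st = ⟨nextForest S st.forest r u,
          insert u st.found ∪ (hanging r u).filter (fun j => j ∈ leafNodes S),
          st.asked ++ (search mid y r (pathUp r l)).2⟩ := by
  have hpick := rule.pick_mem st hne hF.subset
  rw [candidates, Finset.mem_filter, Finset.mem_product] at hpick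
  obtain ⟨⟨hr, hl⟩, hrl⟩ := hpick
  obtain ⟨u, hu, hru, hul⟩ := exists_lowerBoundary_between hA hl hrl (hF.ancestors _ hr)
  have hsep := hy.separates hA hu hl hru hul
  refine ⟨_, hr, _, hl, rfl, u, hu, hru, hul, hsep, ?_⟩
  rw [wdpStep, if_neg hne.ne_empty]
  simp only [search_fst mid _ hsep]
  rfl

/-- The invariant of the states of WDP for the ground-truth cut `A` of `S`. -/
structure IsRunning (S : BinaryTree Unit) (A : Finset Node) (st : WDPState) : Prop where
  forest : IsForest S A st.forest
  found : st.found ⊆ lowerBoundary S A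
  cover : ∀ x ∈ lowerBoundary S A, x ∈ st.found ∨ ∃ f ∈ st.forest, f <+: x

theorem isRunning_init {S : BinaryTree Unit} (A : Finset Node) :
    IsRunning S A ⟨{[]}, ∅, []⟩ where
  forest := ⟨by simpa using nil_mem_allNodes S, by simp, by simpa using ancestorsIn_nil A⟩
  found := by simp
  cover := by simp

/-- A boundary node under `r` other than `u` is incomparable with `u`, hence lies under a hanging
node. If that node is a leaf of `S` it is the boundary node itself and is recorded at once;
otherwise it becomes a root of the forest. -/
theorem IsRunning.step (rule : PathRule S P) (mid : MidRule S P) {y : Node → Bool} {st : WDPState}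
    {A : Finset Node} (hA : A ∈ cuts S) (hy : Consistent S A y) (h : IsRunning S A st) :
    IsRunning S A (wdpStep rule mid y st) := by
  rcases st.forest.eq_empty_or_nonempty with hne | hne
  · rwa [wdpStep, if_pos hne]
  obtain ⟨r, hr, l, hl, -, u, hu, hru, hul, -, he⟩ := wdpStep_eq rule mid hA hy h.forest hne
  obtain ⟨huS, huA, hanc⟩ := mem_lowerBoundary.1 hu
  rw [he]
  refine ⟨h.forest.next hr hru hu, ?_, ?_⟩
  · intro x hx
    simp only [Finset.mem_union, Finset.mem_insert, Finset.mem_filter, mem_hanging hru] at hx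
    rcases hx with (rfl | hx) | ⟨⟨v, b, hv, hvu, rfl⟩, hx⟩
    · exact hu
    · exact h.found hx
    · exact mem_lowerBoundary.2 ⟨leafNodes_subset_allNodes S hx,
        fun hxA => notMem_leafNodes_of_mem_internalNodes ((mem_cuts.1 hA).1 hxA) hx,
        ancestorsIn_concat.2 ⟨hanc.mono ((List.prefix_append _ _).trans hvu), hanc v b hvu⟩⟩
  · intro x hx
    simp only [Finset.mem_union, Finset.mem_insert, Finset.mem_filter, mem_hanging hru]
    rcases h.cover x hx with hx' | ⟨f, hf, hfx⟩
    · exact Or.inl (Or.inl (Or.inr hx'))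
    by_cases hfr : f = r
    · subst hfr
      by_cases h1 : x <+: u
      · exact Or.inl (Or.inl (Or.inl (eq_of_mem_lowerBoundary hx hu h1)))
      by_cases h2 : u <+: x
      · exact Or.inl (Or.inl (Or.inl (eq_of_mem_lowerBoundary hu hx h2).symm))
      obtain ⟨v, b, hv, hvu, hvx⟩ := exists_divergence f hfx hru h1 h2
      by_cases hj : v ++ [!b] ∈ leafNodes S
      · have hjx := eq_of_leaf_prefix hj (mem_lowerBoundary.1 hx).1 hvx
        exact Or.inl (Or.inr ⟨⟨v, b, hv, hvu, hjx.symm⟩, hjx ▸ hj⟩)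
      · exact Or.inr ⟨_, (mem_nextForest hru).2 (Or.inr ⟨⟨v, b, hv, hvu, rfl⟩, hj⟩), hvx⟩
    · exact Or.inr ⟨f, (mem_nextForest hru).2 (Or.inl ⟨hfr, hf⟩), hfx⟩

/-- The nodes of `S` in the subtrees of a forest. -/
def covered (S : BinaryTree Unit) (F : Finset Node) : Finset Node :=
  (allNodes S).filter (fun x => ∃ f ∈ F, f <+: x)

theorem card_covered_nextForest_lt {A F : Finset Node} (hF : IsForest S A F) {r u : Node} (hr : r ∈ F)
    (h : r <+: u) : (covered S (nextForest S F r u)).card < (covered S F).card := by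
  apply Finset.card_lt_card
  rw [Finset.ssubset_iff_of_subset]
  · refine ⟨r, Finset.mem_filter.2 ⟨hF.subset hr, r, hr, List.prefix_refl _⟩, fun hm => ?_⟩
    obtain ⟨-, f, hf, hfr⟩ := Finset.mem_filter.1 hm
    exact not_prefix_of_mem_nextForest hF hr h hf (List.prefix_refl _) (Or.inl h) hfr
  · intro x hx
    obtain ⟨hx, f, hf, hfx⟩ := Finset.mem_filter.1 hx
    obtain ⟨g, hg, hgf⟩ := exists_prefix_of_mem_nextForest hr h hf
    exact Finset.mem_filter.2 ⟨hx, g, hg, hgf.trans hfx⟩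

/-- The number of nodes covered by the forest starts at no more than the size of `S` and drops in
every round, because the root `r` is lost. -/
theorem isRunning_iterate (rule : PathRule S P) (mid : MidRule S P) {y : Node → Bool}
    {A : Finset Node} (hA : A ∈ cuts S) (hy : Consistent S A y) (k : ℕ) :
    IsRunning S A ((wdpStep rule mid y)^[k] ⟨{[]}, ∅, []⟩) ∧
      (((wdpStep rule mid y)^[k] ⟨{[]}, ∅, []⟩).forest = ∅ ∨
        (covered S ((wdpStep rule mid y)^[k] ⟨{[]}, ∅, []⟩).forest).card + k ≤
          (allNodes S).card) := by
  induction k with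
  | zero => exact ⟨isRunning_init A, Or.inr (Finset.card_filter_le _ _)⟩
  | succ k ih =>
    rw [Function.iterate_succ_apply']
    refine ⟨ih.1.step rule mid hA hy, ?_⟩
    rcases Finset.eq_empty_or_nonempty ((wdpStep rule mid y)^[k] ⟨{[]}, ∅, []⟩).forest with hne | hne
    · left
      rwa [wdpStep, if_pos hne]
    · obtain ⟨r, hr, l, hl, -, u, hu, hru, hul, -, he⟩ := wdpStep_eq rule mid hA hy ih.1.forest hne
      right
      rw [he]
      have := card_covered_nextForest_lt ih.1.forest hr hru
      have := ih.2.resolve_left hne.ne_empty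
      simp only
      omega

theorem wdp_found (rule : PathRule S P) (mid : MidRule S P) {y : Node → Bool}
    {A : Finset Node} (hA : A ∈ cuts S) (hy : Consistent S A y) :
    (wdp rule mid y).found = lowerBoundary S A := by
  obtain ⟨h1, h2⟩ := isRunning_iterate rule mid hA hy (allNodes S).card
  have hempty : (wdp rule mid y).forest = ∅ := by
    rcases h2 with h2 | h2
    · exact h2
    · by_contra hne
      obtain ⟨f, hf⟩ := Finset.nonempty_iff_ne_empty.2 hne
      have : 0 < (covered S (wdp rule mid y).forest).card :=
        Finset.card_pos.2 ⟨f, Finset.mem_filter.2 ⟨h1.forest.subset hf, f, hf, List.prefix_refl _⟩⟩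
      rw [wdp] at this
      omega
  refine Finset.Subset.antisymm h1.found fun x hx => ?_
  rcases h1.cover x hx with h | ⟨f, hf, -⟩
  · exact h
  · change f ∈ (wdp rule mid y).forest at hf
    simp [hempty] at hf

end Correctness

/-! ### The posterior of a random cut -/

/-- The cut made of the proper ancestors of `i` has the factor `P i`, and the cut made of all
ancestors of `i`, itself included, has the factor `1 - P i`; both cuts have positive probability. -/
theorem IsPositivePrior.pos_and_lt_one {T : BinaryTree Unit} {P : Node → ℝ} (h : IsPositivePrior T P)
    {i : Node} (hi : i ∈ internalNodes T) : 0 < P i ∧ P i < 1 := by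
  obtain ⟨h1, -, h3⟩ := h
  have key : ∀ A ⊆ internalNodes T, (∀ k ∈ A, ∀ j b, j ++ [b] <+: k → j ∈ A) →
      0 < cutProb T P A := fun A hA hc => h3 A (mem_cuts.2 ⟨hA, hc⟩)
  have hp : ∀ j b k, j ++ [b] <+: k → k <+: i → j ∈ internalNodes T ∧ j <+: i := fun j b k hj hk =>
    have : j <+: i := ((List.prefix_append _ _).trans hj).trans hk
    ⟨mem_internalNodes_of_prefix hi this, this⟩
  constructor
  · refine lt_of_le_of_ne (h1 i hi).1 fun h0 => ?_
    have hA := key ((internalNodes T).filter (fun j => j <+: i ∧ j ≠ i)) (Finset.filter_subset _ _)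
      (by
        intro k hk j b hj
        obtain ⟨-, hk, -⟩ := Finset.mem_filter.1 hk
        refine Finset.mem_filter.2 ⟨(hp j b k hj hk).1, (hp j b k hj hk).2, ?_⟩
        rintro rfl
        exact not_concat_prefix j b (hj.trans hk))
    have hz : ∏ j ∈ lowerBoundary T ((internalNodes T).filter (fun j => j <+: i ∧ j ≠ i)), P j = 0 :=
      Finset.prod_eq_zero (mem_lowerBoundary.2 ⟨internalNodes_subset_allNodes T hi, by simp, by
        intro j b hj
        refine Finset.mem_filter.2 ⟨(hp j b i hj (List.prefix_refl _)).1,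
          (hp j b i hj (List.prefix_refl _)).2, ?_⟩
        rintro rfl
        exact not_concat_prefix j b hj⟩) h0.symm
    rw [cutProb, hz, mul_zero] at hA
    exact lt_irrefl _ hA
  · refine lt_of_le_of_ne (h1 i hi).2 fun h0 => ?_
    have hA := key ((internalNodes T).filter (fun j => j <+: i)) (Finset.filter_subset _ _)
      (by
        intro k hk j b hj
        obtain ⟨-, hk⟩ := Finset.mem_filter.1 hk
        exact Finset.mem_filter.2 (hp j b k hj hk))
    have hz : ∏ j ∈ (internalNodes T).filter (fun j => j <+: i), (1 - P j) = 0 :=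
      Finset.prod_eq_zero (Finset.mem_filter.2 ⟨hi, List.prefix_refl _⟩) (by rw [h0, sub_self])
    rw [cutProb, hz, zero_mul] at hA
    exact lt_irrefl _ hA

theorem IsPositivePrior.pos {T : BinaryTree Unit} {P : Node → ℝ} (h : IsPositivePrior T P)
    {i : Node} (hi : i ∈ allNodes T) : 0 < P i := by
  rcases mem_allNodes.1 hi with h' | h'
  · exact (h.pos_and_lt_one h').1
  · rw [h.2.1 i h']
    exact one_pos

theorem lowerBoundary_insert {T : BinaryTree Unit} {A : Finset Node} (hA : A ∈ cuts T) {i : Node}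
    (hi : i ∈ lowerBoundary T A) (hiT : i ∈ internalNodes T) :
    lowerBoundary T (insert i A) =
      insert (leftChild i) (insert (rightChild i) ((lowerBoundary T A).erase i)) := by
  obtain ⟨-, hiA, hanc⟩ := mem_lowerBoundary.1 hi
  have hchild : ∀ b, i ++ [b] ∈ lowerBoundary T (insert i A) := fun b =>
    mem_lowerBoundary.2 ⟨concat_mem_allNodes.2 hiT, by
      intro h
      rcases Finset.mem_insert.1 h with h | h
      · simp at h
      · exact hiA (mem_of_prefix_of_mem_cut hA h (List.prefix_append _ _)),
      ancestorsIn_concat.2 ⟨hanc.subset (Finset.subset_insert _ _), Finset.mem_insert_self _ _⟩⟩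
  ext x
  rw [Finset.mem_insert, Finset.mem_insert, Finset.mem_erase]
  constructor
  · intro hx
    obtain ⟨hxT, hxA, hxanc⟩ := mem_lowerBoundary.1 hx
    rw [Finset.mem_insert, not_or] at hxA
    by_cases hix : i <+: x
    · obtain ⟨b, hb⟩ := exists_concat_prefix hix (Ne.symm hxA.1)
      have := eq_of_mem_lowerBoundary (hchild b) hx hb
      cases b
      · exact Or.inl this.symm
      · exact Or.inr (Or.inl this.symm)
    · refine Or.inr (Or.inr ⟨hxA.1, mem_lowerBoundary.2 ⟨hxT, hxA.2, fun j b hj => ?_⟩⟩)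
      rcases Finset.mem_insert.1 (hxanc j b hj) with rfl | h
      · exact absurd ((List.prefix_append _ _).trans hj) hix
      · exact h
  · rintro (rfl | rfl | ⟨hxi, hx⟩)
    · exact hchild false
    · exact hchild true
    · obtain ⟨hxT, hxA, hxanc⟩ := mem_lowerBoundary.1 hx
      exact mem_lowerBoundary.2 ⟨hxT, by simp [hxi, hxA], hxanc.subset (Finset.subset_insert _ _)⟩

theorem insert_mem_cuts {T : BinaryTree Unit} {A : Finset Node} (hA : A ∈ cuts T) {i : Node}
    (hi : i ∈ lowerBoundary T A) (hiT : i ∈ internalNodes T) : insert i A ∈ cuts T := by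
  refine mem_cuts.2 ⟨Finset.insert_subset hiT (mem_cuts.1 hA).1, fun x hx => ?_⟩
  rcases Finset.mem_insert.1 hx with rfl | hx
  · exact (mem_lowerBoundary.1 hi).2.2.subset (Finset.subset_insert _ _)
  · exact ((mem_cuts.1 hA).2 x hx).subset (Finset.subset_insert _ _)

/-- Moving `i` above the cut replaces it on the boundary by its two children. The identity is
multiplied out so that no division is needed. -/
theorem cutProb_insert {T : BinaryTree Unit} (P : Node → ℝ) {A : Finset Node} (hA : A ∈ cuts T)
    {i : Node} (hi : i ∈ lowerBoundary T A) (hiT : i ∈ internalNodes T) :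
    cutProb T P (insert i A) * P i =
      cutProb T P A * ((1 - P i) * (P (leftChild i) * P (rightChild i))) := by
  obtain ⟨-, hiA, hanc⟩ := mem_lowerBoundary.1 hi
  have hnot : ∀ b, i ++ [b] ∉ lowerBoundary T A := fun b h => hiA (ancestorsIn_concat.1
    (mem_lowerBoundary.1 h).2.2).2
  have hr : rightChild i ∉ (lowerBoundary T A).erase i := fun h => hnot true (Finset.mem_erase.1 h).2
  have hl : leftChild i ∉ insert (rightChild i) ((lowerBoundary T A).erase i) := by
    intro h
    rcases Finset.mem_insert.1 h with h | h
    · simp [leftChild, rightChild] at h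
    · exact hnot false (Finset.mem_erase.1 h).2
  rw [cutProb, cutProb, Finset.prod_insert hiA, lowerBoundary_insert hA hi hiT,
    Finset.prod_insert hl, Finset.prod_insert hr, ← Finset.mul_prod_erase _ _ hi]
  ring

/-- The part of a cut outside the subtree rooted at `i`. -/
def outside (i : Node) (A : Finset Node) : Finset Node := A.filter (fun x => ¬ i <+: x)

theorem mem_outside {i x : Node} {A : Finset Node} : x ∈ outside i A ↔ x ∈ A ∧ ¬ i <+: x :=
  Finset.mem_filter

theorem outside_mem_cuts {T : BinaryTree Unit} {A : Finset Node} (hA : A ∈ cuts T) (i : Node) :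
    outside i A ∈ cuts T := by
  refine mem_cuts.2 ⟨(Finset.filter_subset _ _).trans (mem_cuts.1 hA).1, fun x hx j b hj => ?_⟩
  rw [mem_outside] at hx ⊢
  exact ⟨(mem_cuts.1 hA).2 x hx.1 j b hj, fun h => hx.2 (h.trans ((List.prefix_append _ _).trans hj))⟩

theorem outside_eq_self {T : BinaryTree Unit} {A : Finset Node} (hA : A ∈ cuts T) {i : Node}
    (hi : i ∉ A) : outside i A = A :=
  Finset.filter_true_of_mem fun _ hx h => hi (mem_of_prefix_of_mem_cut hA hx h)

theorem notMem_outside_self (i : Node) (A : Finset Node) : i ∉ outside i A := fun h =>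
  (mem_outside.1 h).2 (List.prefix_refl _)

/-- With the part of the cut outside the subtree of `i` fixed, `A` is the only cut that has `i`
below it; the claim is that its conditional probability is `P i`. The induction runs from the leaves
up to `i`. -/
theorem sum_fiber_outside {T : BinaryTree Unit} {P : Node → ℝ} (hP : IsPositivePrior T P) {i : Node}
    {A : Finset Node} (hA : A ∈ cuts T) (hi : i ∈ lowerBoundary T A) :
    (∑ c ∈ (cuts T).filter (fun c => outside i c = A), cutProb T P c) * P i = cutProb T P A := by
  induction hd : T.height + 1 - i.length generalizing i A with
  | zero =>
    have := length_le_height (mem_lowerBoundary.1 hi).1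
    omega
  | succ d ih =>
    obtain ⟨hiT, hiA, hanc⟩ := mem_lowerBoundary.1 hi
    by_cases hint : i ∈ internalNodes T
    · set B := insert i A with hB
      have hBc : B ∈ cuts T := insert_mem_cuts hA hi hint
      have hlB : leftChild i ∈ lowerBoundary T B := by
        rw [hB, lowerBoundary_insert hA hi hint]
        exact Finset.mem_insert_self _ _
      -- The cuts of the fiber that have `i` above them. They are summed one child subtree at a
      -- time, first over the changes below the right child and then below the left one.
      set G := (cuts T).filter (fun c => outside (leftChild i) (outside (rightChild i) c) = B) with hG
      have hsplit : (cuts T).filter (fun c => outside i c = A) = insert A G := by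
        ext c
        simp only [Finset.mem_insert, Finset.mem_filter, hG]
        constructor
        · rintro ⟨hc, hcA⟩
          by_cases hic : i ∈ c
          · refine Or.inr ⟨hc, ?_⟩
            ext x
            rw [hB, ← hcA]
            simp only [mem_outside, Finset.mem_insert, prefix_iff_eq_or_child (i := i) (x := x)]
            by_cases hxi : x = i
            · subst hxi
              simp [hic, leftChild, rightChild, not_concat_prefix]
            · simp only [hxi, false_or]
              tauto
          · left
            rw [← hcA, outside_eq_self hc hic]
        · rintro (rfl | ⟨hc, hcB⟩)
          · exact ⟨hA, outside_eq_self hA hiA⟩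
          · refine ⟨hc, ?_⟩
            ext x
            have hx : x ∈ outside (leftChild i) (outside (rightChild i) c) ↔ x ∈ B := by rw [hcB]
            simp only [mem_outside, hB, Finset.mem_insert] at hx
            rw [mem_outside, prefix_iff_eq_or_child]
            by_cases hxi : x = i
            · subst hxi
              simp [hiA]
            · simp only [hxi, false_or] at hx ⊢
              tauto
      have hAG : A ∉ G := by
        intro h
        have h2 := (Finset.mem_filter.1 h).2
        have : i ∈ B := Finset.mem_insert_self _ _
        rw [← h2] at this
        exact hiA (mem_outside.1 (mem_outside.1 this).1).1
      have hmaps : ∀ c ∈ G, outside (rightChild i) c ∈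
          (cuts T).filter (fun c => outside (leftChild i) c = B) := fun c hc =>
        Finset.mem_filter.2 ⟨outside_mem_cuts (Finset.mem_filter.1 hc).1 _,
          (Finset.mem_filter.1 hc).2⟩
      have hlen : ∀ b, T.height + 1 - (i ++ [b]).length = d := by intro b; simp; omega
      have hGsum : (∑ c ∈ G, cutProb T P c) * (P (leftChild i) * P (rightChild i)) =
          cutProb T P B := by
        rw [← ih hBc hlB (hlen false), ← Finset.sum_fiberwise_of_maps_to hmaps, mul_comm (P _),
          ← mul_assoc, Finset.sum_mul _ _ (P (rightChild i))]
        congr 1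
        apply Finset.sum_congr rfl
        intro c2 hc2
        obtain ⟨hc2T, hc2B⟩ := Finset.mem_filter.1 hc2
        have hBc2 : B ⊆ c2 := by rw [← hc2B]; exact Finset.filter_subset _ _
        have hr2 : rightChild i ∈ lowerBoundary T c2 := by
          refine mem_lowerBoundary.2 ⟨concat_mem_allNodes.2 hint, fun h => ?_, ?_⟩
          · have : rightChild i ∈ outside (leftChild i) c2 := mem_outside.2 ⟨h, fun h' => by
              have := concat_prefix_unique h' (List.prefix_refl (rightChild i))
              cases this⟩
            rw [hc2B, hB] at this
            rcases Finset.mem_insert.1 this with h' | h'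
            · simp [rightChild] at h'
            · exact hiA (mem_of_prefix_of_mem_cut hA h' (List.prefix_append _ _))
          · exact ancestorsIn_concat.2 ⟨hanc.subset ((Finset.subset_insert _ _).trans hBc2),
              hBc2 (Finset.mem_insert_self _ _)⟩
        rw [← ih hc2T hr2 (hlen true)]
        congr 2
        ext c
        simp only [hG, Finset.mem_filter]
        constructor
        · rintro ⟨⟨h1, -⟩, h3⟩
          exact ⟨h1, h3⟩
        · rintro ⟨h1, h3⟩
          exact ⟨⟨h1, by rw [h3, hc2B]⟩, h3⟩
      have hins := cutProb_insert P hA hi hint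
      rw [← hB, ← hGsum] at hins
      have hpos : 0 < P (leftChild i) * P (rightChild i) :=
        mul_pos (hP.pos (concat_mem_allNodes.2 hint)) (hP.pos (concat_mem_allNodes.2 hint))
      rw [hsplit, Finset.sum_insert hAG]
      have : (∑ c ∈ G, cutProb T P c) * P i = cutProb T P A * (1 - P i) := by
        apply mul_right_cancel₀ hpos.ne'
        linarith
      linarith
    · have hleaf : i ∈ leafNodes T := (mem_allNodes.1 hiT).resolve_left hint
      have : (cuts T).filter (fun c => outside i c = A) = {A} := by
        ext c
        rw [Finset.mem_filter, Finset.mem_singleton]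
        constructor
        · rintro ⟨hc, rfl⟩
          exact (outside_eq_self hc fun h => hint ((mem_cuts.1 hc).1 h)).symm
        · rintro rfl
          exact ⟨hA, outside_eq_self hA hiA⟩
      rw [this, Finset.sum_singleton, hP.2.1 i hleaf, mul_one]

/-- The family `E` of cuts is closed under changes inside the subtrees of the forest `F`. -/
def ClosedBelow (T : BinaryTree Unit) (F : Finset Node) (E : Finset (Finset Node)) : Prop :=
  ∀ c ∈ E, ∀ c' ∈ cuts T, (∀ x, (∀ f ∈ F, ¬ f <+: x) → (x ∈ c ↔ x ∈ c')) → c' ∈ E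

/-- Group `E` by the part outside the subtree of `i`. Closedness makes each group a full fiber of
`outside i`, to which `sum_fiber_outside` applies. -/
theorem sum_filter_notMem {T : BinaryTree Unit} {P : Node → ℝ} (hP : IsPositivePrior T P) {i : Node}
    (hi : i ∈ allNodes T) {E : Finset (Finset Node)} (hE : E ⊆ cuts T)
    (hanc : ∀ c ∈ E, AncestorsIn c i) (hcl : ClosedBelow T {i} E) :
    ∑ c ∈ E.filter (fun c => i ∉ c), cutProb T P c = P i * ∑ c ∈ E, cutProb T P c := by
  have hout : ∀ c c', c ∈ E → c' ∈ cuts T → outside i c = outside i c' → c' ∈ E := by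
    intro c c' hc hc' h
    refine hcl c hc c' hc' fun x hx => ?_
    have hx' : ¬ i <+: x := hx i (Finset.mem_singleton_self i)
    have : x ∈ outside i c ↔ x ∈ outside i c' := by rw [h]
    simpa [mem_outside, hx'] using this
  have hidem : ∀ c, outside i (outside i c) = outside i c := by
    intro c
    ext x
    simp [mem_outside]
  have hmaps : ∀ c ∈ E, outside i c ∈ E.filter (fun c => i ∉ c) := fun c hc =>
    Finset.mem_filter.2 ⟨hout c _ hc (outside_mem_cuts (hE hc) i) (hidem c).symm,
      notMem_outside_self i c⟩
  rw [← Finset.sum_fiberwise_of_maps_to hmaps, mul_comm, Finset.sum_mul]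
  apply Finset.sum_congr rfl
  intro c hc
  obtain ⟨hcE, hic⟩ := Finset.mem_filter.1 hc
  rw [← sum_fiber_outside hP (hE hcE) (mem_lowerBoundary.2 ⟨hi, hic, hanc c hcE⟩)]
  congr 2
  ext c'
  simp only [Finset.mem_filter]
  constructor
  · rintro ⟨h1, h2⟩
    refine ⟨hout c c' hcE h1 ?_, h2⟩
    rw [h2, outside_eq_self (hE hcE) hic]
  · rintro ⟨h1, h2⟩
    exact ⟨hE h1, h2⟩

/-! ### Weights and entropy along a path -/

section Weights

variable {S T : BinaryTree Unit} {P : Node → ℝ}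

/-- The posterior probability that all proper ancestors of `i` are above the cut. -/
noncomputable def reach (S : BinaryTree Unit) (P : Node → ℝ) (r i : Node) : ℝ :=
  ∏ k ∈ Finset.Ico r.length i.length, (1 - nodeProb S P (i.take k))

theorem weight_eq (r i : Node) : weight S P r i = nodeProb S P i * reach S P r i := rfl

theorem reach_self (r : Node) : reach S P r r = 1 := by
  simp [reach]

theorem reach_concat {r i : Node} (b : Bool) (h : r <+: i) :
    reach S P r (i ++ [b]) = reach S P r i * (1 - nodeProb S P i) := by
  rw [reach, List.length_append, List.length_singleton, Finset.prod_Ico_succ_top h.length_le, reach]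
  congr 1
  · apply Finset.prod_congr rfl
    intro k hk
    rw [List.take_append_of_le_length (Finset.mem_Ico.1 hk).2.le]
  · simp

theorem nodeProb_of_internal {i : Node} (h : i ∈ internalNodes S) : nodeProb S P i = P i :=
  if_neg (notMem_leafNodes_of_mem_internalNodes h)

theorem nodeProb_of_leaf {i : Node} (h : i ∈ leafNodes S) : nodeProb S P i = 1 := if_pos h

theorem reach_pos (hP : IsPositivePrior T P) (hS : internalNodes S ⊆ internalNodes T) {r i : Node}
    (h : r <+: i) (hi : i ∈ allNodes S) : 0 < reach S P r i := by
  induction h using pathUp_induction with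
  | self => rw [reach_self]; exact one_pos
  | concat l b h ih =>
    have hl := concat_mem_allNodes.1 hi
    rw [reach_concat b h, nodeProb_of_internal hl]
    exact mul_pos (ih (internalNodes_subset_allNodes S hl))
      (sub_pos.2 (hP.pos_and_lt_one (hS hl)).2)

theorem weight_pos (hP : IsPositivePrior T P) (hS : internalNodes S ⊆ internalNodes T) {r i : Node}
    (h : r <+: i) (hi : i ∈ allNodes S) : 0 < weight S P r i := by
  rw [weight_eq]
  refine mul_pos ?_ (reach_pos hP hS h hi)
  rcases mem_allNodes.1 hi with h' | h'
  · rw [nodeProb_of_internal h']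
    exact (hP.pos_and_lt_one (hS h')).1
  · rw [nodeProb_of_leaf h']
    exact one_pos

/-- Telescoping: the boundary is met on the path down to `i`, or all of that path is above the cut.
-/
theorem mass_pathUp_add {r i : Node} (h : r <+: i) :
    mass S P r (pathUp r i) + reach S P r i * (1 - nodeProb S P i) = 1 := by
  induction h using pathUp_induction with
  | self => simp [pathUp_self, mass, weight_eq, reach_self]
  | concat l b h ih =>
    rw [pathUp_concat b h, mass, List.map_cons, List.sum_cons, ← mass, weight_eq,
      reach_concat b h]
    linarith

theorem mass_pathUp_leaf {r l : Node} (h : r <+: l) (hl : l ∈ leafNodes S) :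
    mass S P r (pathUp r l) = 1 := by
  have := mass_pathUp_add (S := S) (P := P) h
  rw [nodeProb_of_leaf hl] at this
  linarith

/-- The entropy of the path from `i` up to `r` when `i` is treated as a leaf. -/
noncomputable def truncEntropy (S : BinaryTree Unit) (P : Node → ℝ) (r i : Node) : ℝ :=
  - (reach S P r i * Real.logb 2 (reach S P r i)) +
    ((pathUp r i).tail.map (fun x => - (weight S P r x * Real.logb 2 (weight S P r x)))).sum

theorem pathEntropy_leaf {r l : Node} (h : r <+: l) (hl : l ∈ leafNodes S) :
    pathEntropy S P r l = truncEntropy S P r l := by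
  obtain ⟨b, hb, -⟩ := exists_pathUp_cons h
  rw [pathEntropy, truncEntropy, hb, List.map_cons, List.sum_cons, List.tail_cons, weight_eq,
    nodeProb_of_leaf hl, one_mul]

/-- Extending the path splits the residual mass `R` into `R p` and `R (1 - p)` with `0 < p < 1`; by
the chain rule the entropy grows by `R` times the positive entropy of the split. -/
theorem truncEntropy_concat_lt (hP : IsPositivePrior T P) (hS : internalNodes S ⊆ internalNodes T)
    {r i : Node} (b : Bool) (h : r <+: i) (hi : i ∈ internalNodes S) :
    truncEntropy S P r i < truncEntropy S P r (i ++ [b]) := by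
  obtain ⟨t, ht, -⟩ := exists_pathUp_cons h
  rw [truncEntropy, truncEntropy, pathUp_concat b h, List.tail_cons, ht, List.tail_cons,
    List.map_cons, List.sum_cons, weight_eq, reach_concat b h, nodeProb_of_internal hi]
  have hR := reach_pos hP hS h (internalNodes_subset_allNodes S hi)
  obtain ⟨hp0, hp1⟩ := hP.pos_and_lt_one (hS hi)
  have hq : 0 < 1 - P i := sub_pos.2 hp1
  rw [Real.logb_mul hR.ne' hq.ne', Real.logb_mul hp0.ne' hR.ne']
  have h1 : Real.logb 2 (P i) < 0 := Real.logb_neg (by norm_num) hp0 hp1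
  have h2 : Real.logb 2 (1 - P i) < 0 := Real.logb_neg (by norm_num) hq (by linarith)
  have h3 : reach S P r i * P i * Real.logb 2 (P i) < 0 := mul_neg_of_pos_of_neg (mul_pos hR hp0) h1
  have h4 : reach S P r i * (1 - P i) * Real.logb 2 (1 - P i) < 0 :=
    mul_neg_of_pos_of_neg (mul_pos hR hq) h2
  nlinarith

theorem truncEntropy_le (hP : IsPositivePrior T P) (hS : internalNodes S ⊆ internalNodes T)
    {r i j : Node} (h : r <+: i) (hij : i <+: j) (hj : j ∈ allNodes S) :
    truncEntropy S P r i ≤ truncEntropy S P r j := by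
  induction hij using pathUp_induction with
  | self => exact le_rfl
  | concat l b hl ih =>
    have hlS := concat_mem_allNodes.1 hj
    exact (ih (internalNodes_subset_allNodes S hlS)).trans
      (truncEntropy_concat_lt hP hS b (h.trans hl) hlS).le

/-- The lower end of a path of maximal entropy is a leaf whose sibling is a leaf. -/
theorem sibling_leaf_of_max (hP : IsPositivePrior T P) (hS : internalNodes S ⊆ internalNodes T)
    {r v : Node} {b : Bool} (h : r <+: v) (hl : v ++ [b] ∈ leafNodes S)
    (hmax : ∀ l ∈ leafNodes S, r <+: l → pathEntropy S P r l ≤ pathEntropy S P r (v ++ [b])) :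
    v ++ [!b] ∈ leafNodes S := by
  by_contra hcon
  have hv := concat_mem_allNodes.1 (leafNodes_subset_allNodes S hl)
  have hint := mem_internalNodes_of_mem_allNodes (concat_mem_allNodes (b := !b).2 hv) hcon
  obtain ⟨l, hlS, hp⟩ := exists_leaf_prefix (concat_mem_allNodes (b := true).2 hint)
  have hr : r <+: v ++ [!b] := h.trans (List.prefix_append _ _)
  have hrt : r <+: v ++ [!b] ++ [true] := hr.trans (List.prefix_append _ _)
  have h1 := hmax l hlS (hrt.trans hp)
  rw [pathEntropy_leaf (hrt.trans hp) hlS, pathEntropy_leaf (h.trans (List.prefix_append _ _)) hl] at h1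
  have h2 := truncEntropy_concat_lt hP hS true hr hint
  have h3 := truncEntropy_le hP hS hrt hp (leafNodes_subset_allNodes S hlS)
  -- Truncated entropy depends only on the proper ancestors, so siblings share it; an internal
  -- sibling could then be extended to a path of larger entropy.
  have h4 : truncEntropy S P r (v ++ [b]) = truncEntropy S P r (v ++ [!b]) := by
    rw [truncEntropy, truncEntropy, pathUp_concat _ h, pathUp_concat _ h, reach_concat _ h,
      reach_concat _ h]
    rfl
  linarith

/-- Entropy is maximal for the uniform distribution: apply `log x ≤ x - 1` to `x = 1 / (w N)` and
average. -/
theorem sum_mul_logb_inv_le {ι : Type*} (s : Finset ι) (w : ι → ℝ) (hw : ∀ i ∈ s, 0 < w i)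
    (h1 : ∑ i ∈ s, w i = 1) :
    ∑ i ∈ s, w i * Real.logb 2 (1 / w i) ≤ Real.logb 2 s.card := by
  have hne : s.Nonempty := by
    rw [Finset.nonempty_iff_ne_empty]
    rintro rfl
    simp at h1
  have hN : (0 : ℝ) < s.card := by exact_mod_cast hne.card_pos
  have hlog2 : 0 < Real.log 2 := Real.log_pos (by norm_num)
  have key : ∀ i ∈ s, w i * Real.log (1 / w i) ≤ 1 / s.card - w i + w i * Real.log s.card := by
    intro i hi
    have hwi := hw i hi
    have h2 := Real.log_le_sub_one_of_pos (x := 1 / (w i * s.card)) (by positivity)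
    have h3 : Real.log (1 / (w i * s.card)) = Real.log (1 / w i) - Real.log s.card := by
      rw [← Real.log_div (by positivity) hN.ne', div_div]
    rw [h3] at h2
    have h4 := mul_le_mul_of_nonneg_left h2 hwi.le
    have h5 : w i * (1 / (w i * s.card) - 1) = 1 / s.card - w i := by
      field_simp
    linarith
  have hsum := Finset.sum_le_sum key
  rw [Finset.sum_add_distrib, Finset.sum_sub_distrib, ← Finset.sum_mul, h1, Finset.sum_const,
    nsmul_eq_mul, mul_one_div_cancel hN.ne'] at hsum
  simp only [Real.logb, ← mul_div_assoc, ← Finset.sum_div]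
  gcongr
  linarith

end Weights

/-! ### The expected cost of a round -/

section Cost

variable {S T : BinaryTree Unit} {P : Node → ℝ}

theorem restrict_mem_cuts (S : BinaryTree Unit) {A : Finset Node} (hA : A ∈ cuts T) :
    A ∩ internalNodes S ∈ cuts S := by
  refine mem_cuts.2 ⟨Finset.inter_subset_right, fun i hi j b hj => ?_⟩
  rw [Finset.mem_inter] at hi
  have : j <+: i := (List.prefix_append _ _).trans hj
  exact Finset.mem_inter.2 ⟨mem_of_prefix_of_mem_cut hA hi.1 this,
    mem_internalNodes_of_prefix hi.2 this⟩

theorem mem_lowerBoundary_restrict {A : Finset Node} {i : Node} :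
    i ∈ lowerBoundary S (A ∩ internalNodes S) ↔
      i ∈ allNodes S ∧ (i ∉ A ∨ i ∈ leafNodes S) ∧ AncestorsIn A i :=
  mem_lowerBoundary_inter (Finset.Subset.refl _)

theorem cutProb_pos (hP : IsPositivePrior T P) {A : Finset Node} (hA : A ∈ cuts T) :
    0 < cutProb T P A := hP.2.2 A hA

open Classical in
-- Walk down from `r`: at each internal node the conditional probability of being above is `1 - P`,
-- by `sum_filter_notMem`. The second conclusion supplies the closedness that this needs one level
-- further down.
theorem sum_ancestorsIn (hP : IsPositivePrior T P) (hS : internalNodes S ⊆ internalNodes T)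
    {E : Finset (Finset Node)} (hE : E ⊆ cuts T) {r i : Node} (hr : ∀ c ∈ E, AncestorsIn c r)
    (hcl : ClosedBelow T {r} E) (h : r <+: i) (hi : i ∈ allNodes S) :
    ∑ c ∈ E.filter (fun c => AncestorsIn c i), cutProb T P c =
      reach S P r i * ∑ c ∈ E, cutProb T P c ∧
    ClosedBelow T {i} (E.filter (fun c => AncestorsIn c i)) := by
  have hclosed : ∀ i, r <+: i → ClosedBelow T {i} (E.filter (fun c => AncestorsIn c i)) := by
    intro i h c hc c' hc' hx
    obtain ⟨hcE, hanc⟩ := Finset.mem_filter.1 hc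
    simp only [Finset.mem_singleton, forall_eq] at hx
    refine Finset.mem_filter.2 ⟨hcl c hcE c' hc' fun x hxr => hx x fun hix => ?_, fun j b hj => ?_⟩
    · exact hxr r (Finset.mem_singleton_self r) (h.trans hix)
    · exact (hx j fun hij => not_concat_prefix j b (hj.trans hij)).1 (hanc j b hj)
  refine ⟨?_, hclosed i h⟩
  induction h using pathUp_induction with
  | self => rw [reach_self, one_mul, Finset.filter_true_of_mem hr]
  | concat l b h ih =>
    have hl := concat_mem_allNodes.1 hi
    have ih' := ih (internalNodes_subset_allNodes S hl)
    have h1 := sum_filter_notMem hP (internalNodes_subset_allNodes T (hS hl))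
      ((Finset.filter_subset (fun c => AncestorsIn c l) E).trans hE)
      (fun c hc => (Finset.mem_filter.1 hc).2) (hclosed l h)
    have h2 := Finset.sum_filter_add_sum_filter_not (E.filter (fun c => AncestorsIn c l))
      (fun c => l ∈ c) (cutProb T P)
    rw [h1, ih', Finset.filter_filter] at h2
    simp only [ancestorsIn_concat]
    rw [reach_concat b h, nodeProb_of_internal hl]
    linarith

open Classical in
-- Identifies the weight `q(i)` with a true posterior probability. A leaf of `S` is on the boundary
-- of the restricted cut whatever its label in `T`, matching the reset of its probability to `1`.
theorem sum_mem_lowerBoundary (hP : IsPositivePrior T P) (hS : internalNodes S ⊆ internalNodes T)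
    {E : Finset (Finset Node)} (hE : E ⊆ cuts T) {r i : Node} (hr : ∀ c ∈ E, AncestorsIn c r)
    (hcl : ClosedBelow T {r} E) (h : r <+: i) (hi : i ∈ allNodes S) :
    ∑ c ∈ E.filter (fun c => i ∈ lowerBoundary S (c ∩ internalNodes S)), cutProb T P c =
      weight S P r i * ∑ c ∈ E, cutProb T P c := by
  obtain ⟨h1, h2⟩ := sum_ancestorsIn hP hS hE hr hcl h hi
  simp only [mem_lowerBoundary_restrict]
  by_cases hl : i ∈ leafNodes S
  · simp only [hi, hl, or_true, true_and]
    rw [h1, weight_eq, nodeProb_of_leaf hl, one_mul]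
  · have hint := mem_internalNodes_of_mem_allNodes hi hl
    simp only [hi, hl, or_false, true_and]
    have h3 := sum_filter_notMem hP (internalNodes_subset_allNodes T (hS hint))
      ((Finset.filter_subset (fun c => AncestorsIn c i) E).trans hE)
      (fun c hc => (Finset.mem_filter.1 hc).2) h2
    rw [Finset.filter_filter, h1] at h3
    rw [weight_eq, nodeProb_of_internal hint, mul_assoc, ← h3]
    congr 1
    ext c
    simp only [Finset.mem_filter]
    tauto

/-- Averaging `2 log₂ (1 / q(u)) + 2` over the end node `u`, which has law `q`, gives twice the
entropy of the path plus `2`; a path of at most `m` nodes has entropy at most `log₂ m`. -/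
theorem sum_search_length_le (hP : IsPositivePrior T P) (hS : internalNodes S ⊆ internalNodes T)
    (mid : MidRule S P) {y : Finset Node → Node → Bool}
    (hy : ∀ c ∈ cuts T, Consistent S (c ∩ internalNodes S) (y c))
    {E : Finset (Finset Node)} (hE : E ⊆ cuts T) {r l : Node} (hr : ∀ c ∈ E, AncestorsIn c r)
    (hcl : ClosedBelow T {r} E) (hl : l ∈ leafNodes S) (hrl : r <+: l) {m : ℕ}
    (hm : (pathUp r l).length ≤ m) :
    ∑ c ∈ E, cutProb T P c * ((search mid (y c) r (pathUp r l)).2.length : ℝ) ≤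
      (2 * Real.logb 2 m + 2) * ∑ c ∈ E, cutProb T P c := by
  classical
  have hmem : ∀ x ∈ (pathUp r l).toFinset, r <+: x ∧ x ∈ allNodes S := fun x hx =>
    have h := (mem_pathUp hrl).1 (List.mem_toFinset.1 hx)
    ⟨h.1, mem_allNodes_of_prefix (leafNodes_subset_allNodes S hl) h.2⟩
  have hpos : ∀ x ∈ pathUp r l, 0 < weight S P r x := fun x hx =>
    have h := hmem x (List.mem_toFinset.2 hx)
    weight_pos hP hS h.1 h.2
  have hmass := mass_pathUp_leaf (P := P) hrl hl
  have hsum1 : ∑ x ∈ (pathUp r l).toFinset, weight S P r x = 1 := by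
    rw [List.sum_toFinset _ (nodup_pathUp hrl)]
    exact hmass
  have hcard : (pathUp r l).toFinset.card = (pathUp r l).length :=
    List.toFinset_card_of_nodup (nodup_pathUp hrl)
  have hm0 : 0 < (pathUp r l).length := by
    rw [length_pathUp]; have := hrl.length_le; omega
  set W := ∑ c ∈ E, cutProb T P c with hW
  have hW0 : 0 ≤ W := Finset.sum_nonneg fun c hc => (cutProb_pos hP (hE hc)).le
  have hstep : ∀ c ∈ E, cutProb T P c * ((search mid (y c) r (pathUp r l)).2.length : ℝ) ≤
      ∑ u ∈ (pathUp r l).toFinset, if u ∈ lowerBoundary S (c ∩ internalNodes S) then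
        cutProb T P c * (2 * Real.logb 2 (1 / weight S P r u) + 2) else 0 := by
    intro c hc
    have hcut := restrict_mem_cuts S (hE hc)
    have hpc := cutProb_pos hP (hE hc)
    obtain ⟨u, hu, hru, hul⟩ := exists_lowerBoundary_between hcut hl hrl (fun j b hj =>
      Finset.mem_inter.2 ⟨hr c hc j b hj, mem_internalNodes_of_concat_prefix
        (leafNodes_subset_allNodes S hl) (hj.trans hrl)⟩)
    have hup : u ∈ (pathUp r l).toFinset := List.mem_toFinset.2 ((mem_pathUp hrl).2 ⟨hru, hul⟩)
    have hsep := (hy c (hE hc)).separates hcut hu hl hru hul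
    have hlen := (search_length_le mid hsep hpos).1
    rw [hmass] at hlen
    -- All terms are nonnegative, so the end node of the search may be replaced by the sum over all
    -- boundary nodes of the path.
    refine le_trans ?_ (Finset.single_le_sum (f := fun u =>
      if u ∈ lowerBoundary S (c ∩ internalNodes S) then
        cutProb T P c * (2 * Real.logb 2 (1 / weight S P r u) + 2) else 0) (fun x hx => ?_) hup)
    · simp only [if_pos hu]
      exact mul_le_mul_of_nonneg_left hlen hpc.le
    · split_ifs
      · have hwx : weight S P r x ≤ 1 := hmass ▸ weight_le_mass hpos (List.mem_toFinset.1 hx)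
        have := Real.logb_nonneg (b := 2) (by norm_num)
          ((one_le_div (hpos x (List.mem_toFinset.1 hx))).2 hwx)
        positivity
      · exact le_rfl
  calc ∑ c ∈ E, cutProb T P c * ((search mid (y c) r (pathUp r l)).2.length : ℝ)
      ≤ ∑ c ∈ E, ∑ u ∈ (pathUp r l).toFinset,
          if u ∈ lowerBoundary S (c ∩ internalNodes S) then
          cutProb T P c * (2 * Real.logb 2 (1 / weight S P r u) + 2) else 0 := Finset.sum_le_sum hstep
    _ = ∑ u ∈ (pathUp r l).toFinset, (weight S P r u * W) *
          (2 * Real.logb 2 (1 / weight S P r u) + 2) := by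
        rw [Finset.sum_comm]
        apply Finset.sum_congr rfl
        intro u hu
        rw [← Finset.sum_filter, ← Finset.sum_mul,
          sum_mem_lowerBoundary hP hS hE hr hcl (hmem u hu).1 (hmem u hu).2]
    _ = W * (2 * ∑ u ∈ (pathUp r l).toFinset, weight S P r u * Real.logb 2 (1 / weight S P r u) +
          2 * ∑ u ∈ (pathUp r l).toFinset, weight S P r u) := by
        rw [Finset.mul_sum, Finset.mul_sum, ← Finset.sum_add_distrib, Finset.mul_sum]
        apply Finset.sum_congr rfl
        intro u _
        ring
    _ ≤ W * (2 * Real.logb 2 m + 2 * 1) := by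
        rw [hsum1]
        have h1 := sum_mul_logb_inv_le _ _ (fun x hx => hpos x (List.mem_toFinset.1 hx)) hsum1
        have h2 : Real.logb 2 ((pathUp r l).toFinset.card : ℝ) ≤ Real.logb 2 m := by
          apply Real.logb_le_logb_of_le (by norm_num)
          · rw [hcard]; exact_mod_cast hm0
          · rw [hcard]; exact_mod_cast hm
        gcongr
        linarith
    _ = (2 * Real.logb 2 m + 2) * W := by ring

/-! ### Counting the rounds -/

/-- The leaves of the tree `T'_c` that lie in the subtrees of the forest `F`. -/
def leavesUnder (T : BinaryTree Unit) (F A : Finset Node) : Finset Node :=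
  (cutSubtree T A).filter (fun i => (leftChild i ∉ cutSubtree T A ∧ rightChild i ∉ cutSubtree T A) ∧
    ∃ f ∈ F, f <+: i)

theorem mem_cutSubtree {A : Finset Node} {i : Node} :
    i ∈ cutSubtree T A ↔ (i ∈ A ∨ i ∈ lowerBoundary T A) ∧ i ∉ leafNodes T := by
  rw [cutSubtree, Finset.mem_sdiff, Finset.mem_union]

theorem card_leavesUnder_root (T : BinaryTree Unit) (A : Finset Node) :
    (leavesUnder T {[]} A).card = Ktilde T A := by
  simp [leavesUnder, Ktilde]

theorem exists_leaf_cutSubtree {A : Finset Node} (hA : A ∈ cuts T) {i : Node}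
    (hi : i ∈ cutSubtree T A) :
    ∃ j ∈ cutSubtree T A, (leftChild j ∉ cutSubtree T A ∧ rightChild j ∉ cutSubtree T A) ∧
      i <+: j := by
  induction hd : T.height + 1 - i.length generalizing i with
  | zero =>
    have hT : i ∈ allNodes T := by
      rcases (mem_cutSubtree.1 hi).1 with h | h
      · exact internalNodes_subset_allNodes T ((mem_cuts.1 hA).1 h)
      · exact (mem_lowerBoundary.1 h).1
    have := length_le_height hT
    omega
  | succ d ih =>
    by_cases hl : leftChild i ∈ cutSubtree T A
    · obtain ⟨j, h1, h2, h3⟩ := ih hl (by simp [leftChild]; omega)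
      exact ⟨j, h1, h2, (List.prefix_append _ _).trans h3⟩
    by_cases hr : rightChild i ∈ cutSubtree T A
    · obtain ⟨j, h1, h2, h3⟩ := ih hr (by simp [rightChild]; omega)
      exact ⟨j, h1, h2, (List.prefix_append _ _).trans h3⟩
    exact ⟨i, hi, ⟨hl, hr⟩, List.prefix_refl _⟩

/-- The forest only shrinks, so it suffices to exhibit one leaf of `T'_c` that was under it and no
longer is. -/
theorem card_leavesUnder_nextForest (hP : IsPositivePrior T P)
    (hS : internalNodes S ⊆ internalNodes T) {c F : Finset Node} (hc : c ∈ cuts T)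
    (hF : IsForest S (c ∩ internalNodes S) F) (hFi : F ⊆ internalNodes S) {r l u : Node} (hr : r ∈ F)
    (hl : l ∈ leafNodes S) (hmax : ∀ l' ∈ leafNodes S, r <+: l' →
      pathEntropy S P r l' ≤ pathEntropy S P r l)
    (hu : u ∈ lowerBoundary S (c ∩ internalNodes S)) (hru : r <+: u) (hul : u <+: l) :
    (leavesUnder T (nextForest S F r u) c).card + 1 ≤ (leavesUnder T F c).card := by
  suffices h : ∃ v ∈ leavesUnder T F c, v ∉ leavesUnder T (nextForest S F r u) c by
    obtain ⟨v, hv, hv'⟩ := h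
    rw [← Finset.card_insert_of_notMem hv']
    refine Finset.card_le_card (Finset.insert_subset hv fun x hx => ?_)
    obtain ⟨hx1, hx2, f, hf, hfx⟩ := Finset.mem_filter.1 hx
    obtain ⟨g, hg, hgf⟩ := exists_prefix_of_mem_nextForest hr hru hf
    exact Finset.mem_filter.2 ⟨hx1, hx2, g, hg, hgf.trans hfx⟩
  obtain ⟨huS, huc, hanc⟩ := mem_lowerBoundary_restrict.1 hu
  by_cases hleaf : u ∈ leafNodes S
  · have hul' := eq_of_leaf_prefix hleaf (leafNodes_subset_allNodes S hl) hul
    subst hul'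
    have hne : r ≠ u := by
      rintro rfl
      exact notMem_leafNodes_of_mem_internalNodes (hFi hr) hleaf
    obtain ⟨p, b, rfl, hrp⟩ : ∃ p b, u = p ++ [b] ∧ r <+: p := by
      obtain ⟨t, rfl⟩ := hru
      induction t using List.reverseRecOn with
      | nil => simp at hne
      | append_singleton t b _ => exact ⟨r ++ t, b, by simp, List.prefix_append _ _⟩
    have hsib := sibling_leaf_of_max hP hS hrp hleaf hmax
    have hpc : p ∈ c := hanc p b (List.prefix_refl _)
    -- The search ended at the leaf `l` of `S`, so its parent `p` is above the cut. Both children of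
    -- `p` are leaves of `S`, hence neither returns to the forest, and every leaf of `T'_c` under
    -- `p` is lost.
    obtain ⟨w, hw1, hw2, hpw⟩ := exists_leaf_cutSubtree hc (i := p) (mem_cutSubtree.2 ⟨Or.inl hpc,
      notMem_leafNodes_of_mem_internalNodes ((mem_cuts.1 hc).1 hpc)⟩)
    refine ⟨w, Finset.mem_filter.2 ⟨hw1, hw2, r, hr, hrp.trans hpw⟩, fun hw => ?_⟩
    obtain ⟨-, -, f, hf, hfw⟩ := Finset.mem_filter.1 hw
    rcases (mem_nextForest hru).1 hf with ⟨hfr, hfF⟩ | ⟨⟨v, d, hv, hvu, rfl⟩, hfl⟩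
    · rcases List.prefix_or_prefix_of_prefix hfw (hrp.trans hpw) with h' | h'
      · exact hfr (hF.antichain _ hfF _ hr h')
      · exact hfr (hF.antichain _ hr _ hfF h').symm
    · rcases List.prefix_concat_iff.1 hvu with h' | h'
      · obtain ⟨rfl, hdb⟩ := List.append_inj' h' rfl
        simp only [List.cons.injEq, and_true] at hdb
        exact hfl (hdb ▸ hsib)
      · have := concat_prefix_unique (h'.trans hpw) hfw
        cases d <;> simp at this
  -- Here `u` is internal in `S` and on the boundary of `c` in `T` itself, so `u` is a leaf of
  -- `T'_c`, and it is the lost one.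
  · have hint := mem_internalNodes_of_mem_allNodes huS hleaf
    have huc' : u ∉ c := huc.resolve_right hleaf
    have huT := hS hint
    have hchild : ∀ b, u ++ [b] ∉ cutSubtree T c := by
      intro b h
      rcases (mem_cutSubtree.1 h).1 with h' | h'
      · exact huc' (mem_of_prefix_of_mem_cut hc h' (List.prefix_append _ _))
      · exact huc' ((mem_lowerBoundary.1 h').2.2 u b (List.prefix_refl _))
    refine ⟨u, Finset.mem_filter.2 ⟨mem_cutSubtree.2 ⟨Or.inr (mem_lowerBoundary.2
      ⟨internalNodes_subset_allNodes T huT, huc', hanc⟩), notMem_leafNodes_of_mem_internalNodes huT⟩,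
      ⟨hchild false, hchild true⟩, r, hr, hru⟩, fun hw => ?_⟩
    obtain ⟨-, -, f, hf, hfu⟩ := Finset.mem_filter.1 hw
    exact not_prefix_of_mem_nextForest hF hr hru hf hru (Or.inl (List.prefix_refl _)) hfu

/-- Amortization with the potential `B * card (leavesUnder ..)`: a round costs at most `B` on
average over `E` and lowers the potential by at least `B` for each cut. After the round `E` splits
by the resulting state, and the induction hypothesis applies to each piece. -/
theorem sum_asked_iterate_le (hP : IsPositivePrior T P) (hS : internalNodes S ⊆ internalNodes T)
    (rule : PathRule S P) (mid : MidRule S P) {y : Finset Node → Node → Bool}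
    (hy : ∀ c ∈ cuts T, Consistent S (c ∩ internalNodes S) (y c)) (k : ℕ) (st : WDPState)
    (E : Finset (Finset Node)) (hE : E ⊆ cuts T) (hint : st.forest ⊆ internalNodes S)
    (hF : ∀ c ∈ E, IsForest S (c ∩ internalNodes S) st.forest)
    (hcl : ClosedBelow T st.forest E) :
    ∑ c ∈ E, cutProb T P c * (((wdpStep rule mid (y c))^[k] st).asked.length : ℝ) ≤
      ∑ c ∈ E, cutProb T P c * (st.asked.length + (2 * Real.logb 2 (T.height + 1 : ℕ) + 2) *
        (leavesUnder T st.forest c).card) := by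
  classical
  have hB : 0 ≤ 2 * Real.logb 2 (T.height + 1 : ℕ) + 2 := by
    have : 0 ≤ Real.logb 2 (T.height + 1 : ℕ) := Real.logb_nonneg (by norm_num) (by simp)
    linarith
  set B := 2 * Real.logb 2 (T.height + 1 : ℕ) + 2 with hBdef
  induction k generalizing st E with
  | zero =>
    refine Finset.sum_le_sum fun c hc => ?_
    have := (cutProb_pos hP (hE hc)).le
    simp only [Function.iterate_zero, id_eq]
    gcongr
    have : 0 ≤ B * ((leavesUnder T st.forest c).card : ℝ) := by positivity
    linarith
  | succ k ih =>
    simp only [Function.iterate_succ_apply]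
    rcases st.forest.eq_empty_or_nonempty with hne | hne
    · have hst : ∀ c, wdpStep rule mid (y c) st = st := fun c => by rw [wdpStep, if_pos hne]
      simp only [hst]
      exact ih st E hE hint hF hcl
    have hsubA : st.forest ⊆ allNodes S := hint.trans (internalNodes_subset_allNodes S)
    have hpick := rule.pick_mem st hne hsubA
    rw [candidates, Finset.mem_filter, Finset.mem_product] at hpick
    have hpmax := rule.pick_max st hne hsubA
    obtain ⟨⟨hr, hl⟩, hrl⟩ := hpick
    set r := (rule.pick st).1 with hrdef
    set l := (rule.pick st).2 with hldef
    have hmax : ∀ l' ∈ leafNodes S, r <+: l' → pathEntropy S P r l' ≤ pathEntropy S P r l :=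
      fun l' hl' hrl' => hpmax (r, l') (Finset.mem_filter.2 ⟨Finset.mem_product.2 ⟨hr, hl'⟩, hrl'⟩)
    have hstep : ∀ c ∈ E, ∃ u ∈ lowerBoundary S (c ∩ internalNodes S), r <+: u ∧ u <+: l ∧
        (wdpStep rule mid (y c) st).forest = nextForest S st.forest r u ∧
        (wdpStep rule mid (y c) st).asked =
          st.asked ++ (search mid (y c) r (pathUp r l)).2 := by
      intro c hc
      obtain ⟨r', -, l', -, hp, u, hu, hru, hul, -, he⟩ := wdpStep_eq rule mid
        (restrict_mem_cuts S (hE hc)) (hy c (hE hc)) (hF c hc) hne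
      obtain rfl : r = r' := by rw [hrdef, hp]
      obtain rfl : l = l' := by rw [hldef, hp]
      exact ⟨u, hu, hru, hul, by rw [he], by rw [he]⟩
    have hpathS : ∀ x ∈ (pathUp r l).tail, x ∈ internalNodes S := by
      intro x hx
      obtain ⟨b, hb, hb'⟩ := exists_pathUp_cons hrl
      rw [hb, List.tail_cons] at hx
      obtain ⟨d, hd⟩ := hb' x hx
      exact mem_internalNodes_of_concat_prefix (leafNodes_subset_allNodes S hl) hd
    have hcongr : ∀ c c' : Finset Node, search mid (y c) r (pathUp r l) =
        search mid (y c') r (pathUp r l) → wdpStep rule mid (y c) st = wdpStep rule mid (y c') st := by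
      intro c c' h
      simp only [wdpStep, ← hrdef, ← hldef, h]
    have hih : ∀ s ∈ E.image (fun c => wdpStep rule mid (y c) st),
        ∑ c ∈ E.filter (fun c => wdpStep rule mid (y c) st = s),
          cutProb T P c * (((wdpStep rule mid (y c))^[k] s).asked.length : ℝ) ≤
        ∑ c ∈ E.filter (fun c => wdpStep rule mid (y c) st = s), cutProb T P c *
          (s.asked.length + B * (leavesUnder T s.forest c).card) := by
      intro s hs
      obtain ⟨c₀, hc₀, rfl⟩ := Finset.mem_image.1 hs
      refine ih _ _ ((Finset.filter_subset _ _).trans hE) ?_ ?_ ?_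
      · obtain ⟨u, hu, hru, hul, he, -⟩ := hstep c₀ hc₀
        intro f hf
        rw [he] at hf
        rcases (mem_nextForest hru).1 hf with h' | ⟨h', hfl⟩
        · exact hint h'.2
        · exact mem_internalNodes_of_mem_allNodes (((hF c₀ hc₀).next hr hru hu).subset
            ((mem_nextForest hru).2 (Or.inr ⟨h', hfl⟩))) hfl
      · intro c hc
        obtain ⟨hcE, hcs⟩ := Finset.mem_filter.1 hc
        obtain ⟨u, hu, hru, hul, he, -⟩ := hstep c hcE
        rw [← hcs, he]
        exact (hF c hcE).next hr hru hu
      -- A cut that agrees with `c` off the new forest agrees with it on the searched path, so it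
      -- receives the same answers and leads to the same state.
      · intro c hc c' hc' hagree
        obtain ⟨hcE, hcs⟩ := Finset.mem_filter.1 hc
        obtain ⟨u, hu, hru, hul, he, -⟩ := hstep c hcE
        rw [← hcs, he] at hagree
        refine Finset.mem_filter.2 ⟨hcl c hcE c' hc' fun x hx => hagree x fun f hf hfx => ?_, ?_⟩
        · obtain ⟨g, hg, hgf⟩ := exists_prefix_of_mem_nextForest hr hru hf
          exact hx g hg (hgf.trans hfx)
        · rw [← hcs]
          apply hcongr
          apply search_congr
          intro x hx
          have hxS := hpathS x hx
          obtain ⟨hrx, hxl⟩ := (mem_pathUp hrl).1 (List.mem_of_mem_tail hx)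
          have hxc : x ∈ c ↔ x ∈ c' := hagree x fun f hf hfx =>
            not_prefix_of_mem_nextForest (hF c hcE) hr hru hf hrx
              (List.prefix_or_prefix_of_prefix hxl hul) hfx
          rw [hy c (hE hcE) x hxS, hy c' hc' x hxS]
          simp [hxc]
    have hr1 : ∀ c ∈ E, AncestorsIn c r := fun c hc =>
      ((hF c hc).ancestors r hr).subset Finset.inter_subset_left
    have hclr : ClosedBelow T {r} E := fun c hc c' hc' hx => hcl c hc c' hc' fun x hxF =>
      hx x (by simpa using hxF r hr)
    have hlen : (pathUp r l).length ≤ T.height + 1 := by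
      rw [length_pathUp]
      have := length_le_height (allNodes_subset_of_internalNodes_subset hS
        (leafNodes_subset_allNodes S hl))
      omega
    have hround := sum_search_length_le hP hS mid hy hE hr1 hclr hl hrl hlen
    have hmaps : ∀ c ∈ E, wdpStep rule mid (y c) st ∈
        E.image (fun c => wdpStep rule mid (y c) st) := fun c hc => Finset.mem_image_of_mem _ hc
    calc ∑ c ∈ E, cutProb T P c *
          (((wdpStep rule mid (y c))^[k] (wdpStep rule mid (y c) st)).asked.length : ℝ)
        = ∑ s ∈ E.image (fun c => wdpStep rule mid (y c) st),
          ∑ c ∈ E.filter (fun c => wdpStep rule mid (y c) st = s),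
          cutProb T P c * (((wdpStep rule mid (y c))^[k] s).asked.length : ℝ) := by
          rw [← Finset.sum_fiberwise_of_maps_to hmaps]
          refine Finset.sum_congr rfl fun s _ => Finset.sum_congr rfl fun c hc => ?_
          rw [(Finset.mem_filter.1 hc).2]
      _ ≤ _ := Finset.sum_le_sum hih
      _ = ∑ c ∈ E, cutProb T P c * ((wdpStep rule mid (y c) st).asked.length +
            B * (leavesUnder T (wdpStep rule mid (y c) st).forest c).card) := by
          rw [← Finset.sum_fiberwise_of_maps_to hmaps]
          refine Finset.sum_congr rfl fun s _ => Finset.sum_congr rfl fun c hc => ?_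
          rw [(Finset.mem_filter.1 hc).2]
      -- For each cut the drop in potential pays `B`; the cost of the search is bounded by `B` only
      -- after summation over `E`.
      _ ≤ ∑ c ∈ E, (cutProb T P c * (st.asked.length + B * (leavesUnder T st.forest c).card) +
            cutProb T P c * ((search mid (y c) r (pathUp r l)).2.length : ℝ) -
            B * cutProb T P c) := by
          refine Finset.sum_le_sum fun c hc => ?_
          obtain ⟨u, hu, hru, hul, he, ha⟩ := hstep c hc
          have h1 := card_leavesUnder_nextForest hP hS (hE hc) (hF c hc) hint hr hl hmax hu hru hul
          have h2 : ((leavesUnder T (nextForest S st.forest r u) c).card : ℝ) + 1 ≤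
            (leavesUnder T st.forest c).card := by exact_mod_cast h1
          rw [he, ha, List.length_append]
          push_cast
          have h3 := mul_le_mul_of_nonneg_left h2 hB
          have h4 := mul_le_mul_of_nonneg_left h3 (cutProb_pos hP (hE hc)).le
          linarith
      _ ≤ ∑ c ∈ E, cutProb T P c * (st.asked.length + B * (leavesUnder T st.forest c).card) := by
          rw [Finset.sum_sub_distrib, Finset.sum_add_distrib, ← Finset.mul_sum]
          linarith

theorem sum_asked_wdp_le (hP : IsPositivePrior T P) (hS : internalNodes S ⊆ internalNodes T)
    (hroot : [] ∈ internalNodes S) (rule : PathRule S P) (mid : MidRule S P)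
    {y : Finset Node → Node → Bool}
    (hy : ∀ c ∈ cuts T, Consistent S (c ∩ internalNodes S) (y c)) :
    ∑ c ∈ cuts T, cutProb T P c * ((wdp rule mid (y c)).asked.length : ℝ) ≤
      (2 * Real.logb 2 (T.height + 1 : ℕ) + 2) * priorExp T P (fun c => (Ktilde T c : ℝ)) := by
  have h := sum_asked_iterate_le hP hS rule mid hy (allNodes S).card ⟨{[]}, ∅, []⟩ (cuts T)
    (Finset.Subset.refl _) (by simpa using hroot)
    (fun c _ => (isRunning_init (c ∩ internalNodes S)).forest) (fun _ _ _ h _ => h)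
  refine h.trans (le_of_eq ?_)
  rw [priorExp, Finset.mul_sum]
  refine Finset.sum_congr rfl fun c _ => ?_
  simp only [card_leavesUnder_root, List.length_nil, Nat.cast_zero, zero_add]
  ring

end Cost

/-! ### Tail bound for sampling without replacement -/

/-- The ratio of the two binomials is a product of `j` factors `(k + i) / (n + i)`. The largest, at
`i = j`, is at most `lam`, and lowering numerator and denominator equally preserves this since `lam
≤ 1`. -/
theorem choose_le_pow_mul_choose {lam : ℝ} (h0 : 0 ≤ lam) (h1 : lam ≤ 1) (j : ℕ) :
    ∀ n k : ℕ, ((k + j : ℕ) : ℝ) ≤ lam * (n + j : ℕ) →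
      ((n.choose k : ℕ) : ℝ) ≤ lam ^ j * ((n + j).choose (k + j) : ℕ) := by
  induction j with
  | zero => intro n k _; simp
  | succ j ih =>
    intro n k h
    have ih' := ih (n + 1) (k + 1) (by
      rwa [show k + 1 + j = k + (j + 1) by omega, show n + 1 + j = n + (j + 1) by omega])
    have hk : ((k + 1 : ℕ) : ℝ) ≤ lam * (n + 1 : ℕ) := by
      push_cast at h ⊢
      nlinarith [(Nat.cast_nonneg j : (0 : ℝ) ≤ j)]
    have he : ((n + 1 : ℕ) : ℝ) * n.choose k = (n + 1).choose (k + 1) * (k + 1 : ℕ) := by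
      exact_mod_cast Nat.add_one_mul_choose_eq n k
    have hstep : (n.choose k : ℝ) ≤ lam * (n + 1).choose (k + 1) := by
      have hn : (0 : ℝ) < (n + 1 : ℕ) := by positivity
      refine le_of_mul_le_mul_left ?_ hn
      rw [he]
      calc ((n + 1).choose (k + 1) : ℝ) * (k + 1 : ℕ)
          ≤ (n + 1).choose (k + 1) * (lam * (n + 1 : ℕ)) := by gcongr
        _ = (n + 1 : ℕ) * (lam * (n + 1).choose (k + 1)) := by ring
    calc (n.choose k : ℝ) ≤ lam * (n + 1).choose (k + 1) := hstep
      _ ≤ lam * (lam ^ j * (n + 1 + j).choose (k + 1 + j)) := by gcongr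
      _ = lam ^ (j + 1) * (n + (j + 1)).choose (k + (j + 1)) := by
        rw [show k + 1 + j = k + (j + 1) by omega, show n + 1 + j = n + (j + 1) by omega]
        ring

section Tail

variable {β : Type*} [DecidableEq β]

/-- Sampling without replacement is negatively correlated: `J` is covered with probability at most
`lam ^ |J|`. -/
theorem card_supersets_le {U J : Finset β} (hJ : J ⊆ U) {K : ℕ} {lam : ℝ} (h0 : 0 ≤ lam)
    (h1 : lam ≤ 1) (hK : (K : ℝ) ≤ lam * U.card) :
    (((U.powersetCard K).filter (fun s => J ⊆ s)).card : ℝ) ≤ lam ^ J.card * U.card.choose K := by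
  by_cases hJK : J.card ≤ K
  · have hle : ((U.powersetCard K).filter (fun s => J ⊆ s)).card ≤
        ((U \ J).powersetCard (K - J.card)).card := by
      refine Finset.card_le_card_of_injOn (fun s => s \ J) ?_ ?_
      · intro s hs
        obtain ⟨hs1, hs2⟩ := Finset.mem_filter.1 (Finset.mem_coe.1 hs)
        obtain ⟨hs3, hs4⟩ := Finset.mem_powersetCard.1 hs1
        refine Finset.mem_coe.2 (Finset.mem_powersetCard.2 ⟨Finset.sdiff_subset_sdiff hs3 le_rfl, ?_⟩)
        rw [Finset.card_sdiff_of_subset hs2, hs4]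
      · intro s hs s' hs' h
        have hs2 := (Finset.mem_filter.1 (Finset.mem_coe.1 hs)).2
        have hs2' := (Finset.mem_filter.1 (Finset.mem_coe.1 hs')).2
        simp only at h
        rw [← Finset.sdiff_union_of_subset hs2, h, Finset.sdiff_union_of_subset hs2']
    have hcard := Finset.card_le_card hJ
    rw [Finset.card_powersetCard, Finset.card_sdiff_of_subset hJ] at hle
    have hch := choose_le_pow_mul_choose h0 h1 J.card (U.card - J.card) (K - J.card) (by
      rwa [Nat.sub_add_cancel hJK, Nat.sub_add_cancel hcard])
    rw [Nat.sub_add_cancel hJK, Nat.sub_add_cancel hcard] at hch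
    exact le_trans (by exact_mod_cast hle) hch
  · rw [Finset.filter_eq_empty_iff.2]
    · simp only [Finset.card_empty, Nat.cast_zero]
      positivity
    · intro s hs hJs
      have := Finset.card_le_card hJs
      rw [(Finset.mem_powersetCard.1 hs).2] at this
      omega

/-- Expanding `(t + 1) ^ |s ∩ D|` over the subsets `J` of `s ∩ D` reduces the moment bound to
covering probabilities, so that it is dominated by the binomial one. -/
theorem sum_pow_card_inter_le {U D : Finset β} (hD : D ⊆ U) {K : ℕ} {lam t : ℝ} (h0 : 0 ≤ lam)
    (h1 : lam ≤ 1) (ht : 0 ≤ t) (hK : (K : ℝ) ≤ lam * U.card) :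
    ∑ s ∈ U.powersetCard K, (t + 1) ^ (s ∩ D).card ≤ (lam * t + 1) ^ D.card * U.card.choose K := by
  have hexp : ∀ s : Finset β, (t + 1) ^ (s ∩ D).card =
      ∑ J ∈ D.powerset, if J ⊆ s then t ^ J.card else 0 := by
    intro s
    rw [← Finset.sum_pow_mul_eq_add_pow, ← Finset.sum_filter]
    refine Finset.sum_congr ?_ fun J _ => by rw [one_pow, mul_one]
    ext J
    rw [Finset.mem_filter, Finset.mem_powerset, Finset.mem_powerset, Finset.subset_inter_iff]
    tauto
  simp only [hexp]
  rw [Finset.sum_comm, ← Finset.sum_pow_mul_eq_add_pow, Finset.sum_mul]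
  refine Finset.sum_le_sum fun J hJ => ?_
  rw [← Finset.sum_filter, Finset.sum_const, nsmul_eq_mul, one_pow, mul_one, mul_pow]
  have := card_supersets_le ((Finset.mem_powerset.1 hJ).trans hD) h0 h1 hK
  calc _ ≤ lam ^ J.card * U.card.choose K * t ^ J.card := by gcongr
    _ = _ := by ring

/-- A uniformly random `K`-subset of `U`, where `K ≤ lam * |U|` and `lam < 1 / 2`, contains at least
one half of a given subset `D` with exponentially small probability. -/
theorem card_majority_le {U D : Finset β} (hD : D ⊆ U) (hne : D.Nonempty) {K : ℕ} {lam : ℝ}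
    (h0 : 0 ≤ lam) (h1 : lam < 1 / 2) (hK : (K : ℝ) ≤ lam * U.card) :
    (((U.powersetCard K).filter (fun s => D.card ≤ 2 * (s ∩ D).card)).card : ℝ) ≤
      Real.exp (-((1 - 2 * lam) ^ 2 * D.card / 2)) * U.card.choose K := by
  rcases h0.eq_or_lt with rfl | hpos
  -- Without noise no pair is flipped; this case is separate because `τ` divides by `lam`.
  · have hK0 : K = 0 := by
      rw [zero_mul] at hK
      exact_mod_cast le_antisymm hK (Nat.cast_nonneg K)
    rw [Finset.filter_eq_empty_iff.2]
    · simp only [Finset.card_empty, Nat.cast_zero]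
      positivity
    · intro s hs
      rw [hK0, Finset.powersetCard_zero, Finset.mem_singleton] at hs
      subst hs
      simpa using hne.ne_empty
  -- The optimal Chernoff parameter: Markov's inequality for `(τ ^ 2) ^ |s ∩ D|` at the threshold `τ
  -- ^ |D|`.
  · set τ := Real.sqrt ((1 - lam) / lam) with hτ
    have hratio : 1 ≤ (1 - lam) / lam := (one_le_div hpos).2 (by linarith)
    have hτ2 : τ ^ 2 = (1 - lam) / lam := Real.sq_sqrt (by linarith)
    have hτ1 : 1 ≤ τ := Real.one_le_sqrt.2 hratio
    have hτ0 : 0 < τ := by linarith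
    have hsum := sum_pow_card_inter_le hD h0 (by linarith : lam ≤ 1)
      (sub_nonneg.2 hratio) hK
    rw [sub_add_cancel, ← hτ2] at hsum
    have hbase : lam * (τ ^ 2 - 1) + 1 = 2 * (1 - lam) := by
      rw [hτ2]
      field_simp
      ring
    rw [hbase] at hsum
    have hmarkov : (((U.powersetCard K).filter (fun s => D.card ≤ 2 * (s ∩ D).card)).card : ℝ) *
        τ ^ D.card ≤ ∑ s ∈ U.powersetCard K, (τ ^ 2) ^ (s ∩ D).card := by
      rw [← nsmul_eq_mul, ← Finset.sum_const]
      refine le_trans (Finset.sum_le_sum fun s hs => ?_)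
        (Finset.sum_le_sum_of_subset_of_nonneg (Finset.filter_subset _ _) fun s _ _ => by positivity)
      rw [← pow_mul]
      exact pow_le_pow_right₀ hτ1 (Finset.mem_filter.1 hs).2
    -- The square of the left side is `4 lam (1 - lam) = 1 - (1 - 2 lam) ^ 2`, to which `1 + x ≤ exp
    -- x` applies.
    have hq : 2 * (1 - lam) / τ ≤ Real.exp (-((1 - 2 * lam) ^ 2 / 2)) := by
      refine (sq_le_sq₀ (div_nonneg (by linarith) hτ0.le) (Real.exp_pos _).le).1 ?_
      rw [div_pow, hτ2, ← Real.exp_nat_mul]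
      have he : (2 * (1 - lam)) ^ 2 / ((1 - lam) / lam) = -(1 - 2 * lam) ^ 2 + 1 := by
        have : 1 - lam ≠ 0 := by linarith
        field_simp
        ring
      rw [he]
      refine (Real.add_one_le_exp (-(1 - 2 * lam) ^ 2)).trans (le_of_eq ?_)
      congr 1
      push_cast
      ring
    have hexp : Real.exp (-((1 - 2 * lam) ^ 2 * D.card / 2)) =
        Real.exp (-((1 - 2 * lam) ^ 2 / 2)) ^ D.card := by
      rw [← Real.exp_nat_mul]
      congr 1
      ring
    rw [hexp]
    have hle := hmarkov.trans hsum
    calc (((U.powersetCard K).filter (fun s => D.card ≤ 2 * (s ∩ D).card)).card : ℝ)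
        ≤ (2 * (1 - lam) / τ) ^ D.card * U.card.choose K := by
          rw [div_pow, div_mul_eq_mul_div, le_div_iff₀ (by positivity)]
          exact hle
      _ ≤ _ := by
          have : 0 ≤ 2 * (1 - lam) / τ := div_nonneg (by linarith) hτ0.le
          gcongr

end Tail

/-! ### Uniform probabilities -/

theorem uniformProb_eq {β : Type} (s : Finset β) (E : β → Prop) [DecidablePred E] :
    uniformProb s E = ((s.filter E).card : ℝ) / s.card := by
  rw [uniformProb]
  congr!

theorem uniformProb_mono {β : Type} {s : Finset β} {E E' : β → Prop} (h : ∀ x ∈ s, E x → E' x) :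
    uniformProb s E ≤ uniformProb s E' := by
  rw [uniformProb, uniformProb]
  gcongr with x hx
  exact h x hx

theorem one_sub_le_uniformProb_forall {β ι : Type} {s : Finset β} (hs : s.Nonempty) {I : Finset ι}
    {E : ι → β → Prop} {ε : ℝ} (h : ∀ i ∈ I, uniformProb s (fun x => ¬ E i x) ≤ ε) :
    1 - I.card * ε ≤ uniformProb s (fun x => ∀ i ∈ I, E i x) := by
  classical
  have hpos : (0 : ℝ) < s.card := by exact_mod_cast hs.card_pos
  have h1 : (s.filter (fun x => ¬ ∀ i ∈ I, E i x)).card ≤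
      ∑ i ∈ I, (s.filter (fun x => ¬ E i x)).card := by
    refine le_trans (Finset.card_le_card fun x hx => ?_) Finset.card_biUnion_le
    obtain ⟨hx, hx'⟩ := Finset.mem_filter.1 hx
    push Not at hx'
    obtain ⟨i, hi, hxi⟩ := hx'
    exact Finset.mem_biUnion.2 ⟨i, hi, Finset.mem_filter.2 ⟨hx, hxi⟩⟩
  have h2 : ((∑ i ∈ I, (s.filter (fun x => ¬ E i x)).card : ℕ) : ℝ) ≤ I.card * ε * s.card := by
    push_cast
    rw [mul_assoc, ← nsmul_eq_mul, ← Finset.sum_const]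
    refine Finset.sum_le_sum fun i hi => ?_
    have := h i hi
    rwa [uniformProb_eq, div_le_iff₀ hpos] at this
  have h3 := Finset.card_filter_add_card_filter_not (s := s) (fun x => ∀ i ∈ I, E i x)
  have h4 : ((s.filter (fun x => ∀ i ∈ I, E i x)).card : ℝ) +
      ((s.filter (fun x => ¬ ∀ i ∈ I, E i x)).card : ℝ) = s.card := by exact_mod_cast h3
  have h5 : ((s.filter (fun x => ¬ ∀ i ∈ I, E i x)).card : ℝ) ≤ I.card * ε * s.card :=
    le_trans (by exact_mod_cast h1) h2
  rw [uniformProb_eq, le_div_iff₀ hpos]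
  linarith

theorem le_uniformProb_product {β γ : Type} {s : Finset β} {t : Finset γ} (hs : s.Nonempty) {p : ℝ}
    (ht : t.Nonempty) {E : β → γ → Prop} (h : ∀ x ∈ s, p ≤ uniformProb t (E x)) :
    p ≤ uniformProb (s ×ˢ t) (fun ω => E ω.1 ω.2) := by
  classical
  have hs0 : (0 : ℝ) < s.card := by exact_mod_cast hs.card_pos
  have ht0 : (0 : ℝ) < t.card := by exact_mod_cast ht.card_pos
  have h1 : (((s ×ˢ t).filter (fun ω => E ω.1 ω.2)).card : ℝ) =
      ∑ x ∈ s, ((t.filter (E x)).card : ℝ) := by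
    simp only [Finset.card_filter, Finset.sum_product]
    push_cast
    rfl
  have h2 : s.card * (p * t.card) ≤ ∑ x ∈ s, ((t.filter (E x)).card : ℝ) := by
    rw [← nsmul_eq_mul, ← Finset.sum_const]
    refine Finset.sum_le_sum fun x hx => ?_
    have := h x hx
    rwa [uniformProb_eq, le_div_iff₀ ht0] at this
  rw [uniformProb_eq, Finset.card_product, Nat.cast_mul, le_div_iff₀ (by positivity), h1]
  linarith

/-! ### Noise and majority votes -/

theorem card_leafPairs (T : BinaryTree Unit) : (leafPairs T).card = T.numLeaves.choose 2 := by
  rw [← card_leafNodes, ← Sym2.card_image_offDiag]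
  congr 1
  ext e
  induction e using Sym2.ind with
  | _ x y =>
    simp only [leafPairs, Finset.mem_filter, Finset.mk_mem_sym2_iff, Sym2.mk_isDiag_iff,
      Finset.mem_image, Finset.mem_offDiag, Prod.exists, Function.uncurry_apply_pair, Sym2.eq_iff]
    constructor
    · rintro ⟨⟨hx, hy⟩, hne⟩
      exact ⟨x, y, ⟨hx, hy, hne⟩, Or.inl ⟨rfl, rfl⟩⟩
    · rintro ⟨a, b, ⟨ha, hb, hne⟩, ⟨rfl, rfl⟩ | ⟨rfl, rfl⟩⟩
      · exact ⟨⟨ha, hb⟩, hne⟩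
      · exact ⟨⟨hb, ha⟩, Ne.symm hne⟩

theorem mem_crossPairs {T : BinaryTree Unit} {i x y : Node} :
    (x, y) ∈ crossPairs T i ↔ (x ∈ leafNodes T ∧ i ++ [false] <+: x) ∧
      (y ∈ leafNodes T ∧ i ++ [true] <+: y) := by
  rw [crossPairs, Finset.mem_product, leavesBelow, leavesBelow, Finset.mem_filter, Finset.mem_filter]
  rfl

/-- The two sides of a cross pair lie under different children, so forgetting the order loses
nothing; votes count ordered pairs, noise unordered ones. -/
theorem injOn_crossPairs (T : BinaryTree Unit) (i : Node) :
    Set.InjOn (fun p : Node × Node => s(p.1, p.2)) (crossPairs T i) := by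
  rintro ⟨x, y⟩ hp ⟨x', y'⟩ hp' h
  rw [Finset.mem_coe, mem_crossPairs] at hp hp'
  rcases Sym2.eq_iff.1 h with ⟨h1, h2⟩ | ⟨h1, h2⟩
  · exact Prod.ext h1 h2
  · simp only at h1 h2
    have := concat_prefix_unique hp.1.2 (h1 ▸ hp'.2.2)
    cases this

/-- The unordered pairs of a set of ordered pairs. -/
def unordered (D : Finset (Node × Node)) : Finset (Sym2 Node) := D.image (fun p => s(p.1, p.2))

theorem unordered_subset_leafPairs {T : BinaryTree Unit} {i : Node} {D : Finset (Node × Node)}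
    (hD : D ⊆ crossPairs T i) : unordered D ⊆ leafPairs T := by
  intro e he
  obtain ⟨⟨x, y⟩, hp, rfl⟩ := Finset.mem_image.1 he
  obtain ⟨⟨hx, hx'⟩, hy, hy'⟩ := mem_crossPairs.1 (hD hp)
  refine Finset.mem_filter.2 ⟨Finset.mk_mem_sym2_iff.2 ⟨hx, hy⟩, fun h => ?_⟩
  rw [Sym2.mk_isDiag_iff] at h
  simp only at h
  subst h
  have := concat_prefix_unique hx' hy'
  cases this

theorem card_unordered {T : BinaryTree Unit} {i : Node} {D : Finset (Node × Node)}
    (hD : D ⊆ crossPairs T i) : (unordered D).card = D.card :=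
  Finset.card_image_of_injOn ((injOn_crossPairs T i).mono hD)

theorem card_inter_unordered {T : BinaryTree Unit} {i : Node} {D : Finset (Node × Node)}
    (hD : D ⊆ crossPairs T i) (flips : Finset (Sym2 Node)) :
    (flips ∩ unordered D).card = (D.filter (fun p => s(p.1, p.2) ∈ flips)).card := by
  rw [← Finset.card_image_of_injOn (((injOn_crossPairs T i).mono hD).mono
    (Finset.coe_subset.2 (Finset.filter_subset (fun p => s(p.1, p.2) ∈ flips) D)))]
  congr 1
  ext e
  simp only [unordered, Finset.mem_inter, Finset.mem_image, Finset.mem_filter]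
  constructor
  · rintro ⟨he, p, hp, rfl⟩
    exact ⟨p, ⟨hp, he⟩, rfl⟩
  · rintro ⟨p, ⟨hp, he⟩, rfl⟩
    exact ⟨he, p, hp, rfl⟩

open Classical in
theorem simMatrix_cutClustering {T : BinaryTree Unit} {c : Finset Node} {x y : Node}
    (hx : x ∈ leafNodes T) (hy : y ∈ leafNodes T) :
    simMatrix (cutClustering T c) x y =
      if ∃ j ∈ lowerBoundary T c, j <+: x ∧ j <+: y then 1 else -1 := by
  rw [simMatrix]
  congr 1
  simp [cutClustering, leavesBelow, hx, hy]

/-- The lowest common ancestor of a cross pair of `i` is `i`, so the two leaves share a cluster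
exactly when `i` is below the cut. -/
theorem simMatrix_crossPairs {T : BinaryTree Unit} {c : Finset Node} (hc : c ∈ cuts T) {i x y : Node}
    (hi : i ∈ internalNodes T) (h : (x, y) ∈ crossPairs T i) :
    simMatrix (cutClustering T c) x y = if i ∉ c then 1 else -1 := by
  classical
  obtain ⟨⟨hx, hix⟩, hy, hiy⟩ := mem_crossPairs.1 h
  rw [simMatrix_cutClustering hx hy]
  refine if_congr ⟨?_, fun hic => ?_⟩ rfl rfl
  · rintro ⟨j, hj, hjx, hjy⟩ hic
    refine (mem_lowerBoundary.1 hj).2.1 (mem_of_prefix_of_mem_cut hc hic ?_)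
    rcases List.prefix_or_prefix_of_prefix hjx hix with h' | h'
    · rcases List.prefix_concat_iff.1 h' with rfl | h'
      · have := concat_prefix_unique hjy hiy
        cases this
      · exact h'
    · have := concat_prefix_unique (h'.trans hjy) hiy
      cases this
  · obtain ⟨j, hj, hji⟩ := exists_mem_lowerBoundary (internalNodes_subset_allNodes T hi) hic
    exact ⟨j, hj, (hji.trans (List.prefix_append _ _)).trans hix,
      (hji.trans (List.prefix_append _ _)).trans hiy⟩

/-! ### From correct votes to the output, its error and the number of queries. -/

section Run

variable {T S : BinaryTree Unit} {P : Node → ℝ}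

/-- In every vote fewer than one half of the answers are corrupted by the noise. -/
def VotesCorrect (draw : internalNodes S → Finset (Node × Node)) (flips : Finset (Sym2 Node)) : Prop :=
  ∀ i ∈ internalNodes S, 2 * (flips ∩ unordered (votePairs draw i)).card <
    (unordered (votePairs draw i)).card

/-- The noiseless entries of a vote coincide, so the noisy entries equal to `1` are the flipped
pairs if `i` is above the cut and the others if it is below. -/
theorem VotesCorrect.consistent {draw : internalNodes S → Finset (Node × Node)}
    {flips : Finset (Sym2 Node)} (h : VotesCorrect draw flips)
    (hS : internalNodes S ⊆ internalNodes T)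
    (hdraw : ∀ i ∈ internalNodes S, votePairs draw i ⊆ crossPairs T i) {c : Finset Node}
    (hc : c ∈ cuts T) :
    Consistent S (c ∩ internalNodes S)
      (majorityLabel draw (flipMatrix (simMatrix (cutClustering T c)) flips)) := by
  intro i hi
  have hD := hdraw i hi
  have hv := h i hi
  rw [card_inter_unordered hD, card_unordered hD] at hv
  have hic : i ∈ c ∩ internalNodes S ↔ i ∈ c := by simp [hi]
  rw [majorityLabel, decide_eq_decide, hic]
  have hsplit := Finset.card_filter_add_card_filter_not (s := votePairs draw i)
    (fun p => s(p.1, p.2) ∈ flips)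
  by_cases hcut : i ∈ c
  · have he : (votePairs draw i).filter
        (fun p => flipMatrix (simMatrix (cutClustering T c)) flips p.1 p.2 = 1) =
        (votePairs draw i).filter (fun p => s(p.1, p.2) ∈ flips) := by
      refine Finset.filter_congr fun p hp => ?_
      rw [flipMatrix, simMatrix_crossPairs hc (hS hi) (hD hp), if_neg (not_not.2 hcut)]
      split_ifs with hf <;> simp [hf]
    rw [he]
    simp only [hcut, not_true, iff_false]
    omega
  · have he : (votePairs draw i).filter
        (fun p => flipMatrix (simMatrix (cutClustering T c)) flips p.1 p.2 = 1) =
        (votePairs draw i).filter (fun p => ¬ s(p.1, p.2) ∈ flips) := by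
      refine Finset.filter_congr fun p hp => ?_
      rw [flipMatrix, simMatrix_crossPairs hc (hS hi) (hD hp), if_pos hcut]
      split_ifs with hf <;> simp [hf]
    rw [he]
    simp only [hcut, not_false_iff, iff_true]
    omega

theorem nwdpOutput_eq (hS : internalNodes S ⊆ internalNodes T) (rule : PathRule S P)
    (mid : MidRule S P) {draw : internalNodes S → Finset (Node × Node)} {flips : Finset (Sym2 Node)}
    {c : Finset Node} (hc : c ∈ cuts T) (hy : Consistent S (c ∩ internalNodes S)
      (majorityLabel draw (flipMatrix (simMatrix (cutClustering T c)) flips))) :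
    nwdpOutput T rule mid draw flips c = cutClustering T (c ∩ internalNodes S) := by
  rw [nwdpOutput, nwdpRun, wdp_found rule mid (restrict_mem_cuts S hc) hy, cutClustering]
  congr 1
  ext i
  rw [mem_lowerBoundary_restrict, mem_lowerBoundary_inter hS]

/-- The restricted cut has fewer nodes above it, so its clustering is coarser. It merges leaves that
`c` separates only under a leaf of the pruned tree, so a fixed `x` is wrongly paired only with
leaves under the pruned leaf `g x`. -/
theorem clusterDist_le {f : ℝ} (hf : 0 ≤ f) (c : Finset Node) :
    (clusterDist T (simMatrix (cutClustering T c))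
      (cutClustering T (c ∩ internalNodes (prune f T))) : ℝ) ≤ T.numLeaves * (f + 1) := by
  classical
  have hS := internalNodes_prune_subset f T
  have hSall := allNodes_subset_of_internalNodes_subset hS
  choose! g hg hgx using fun x (hx : x ∈ leafNodes T) =>
    exists_leaf_of_ancestor (prune f T) hSall hx
  have hsub : (leafNodes T ×ˢ leafNodes T).filter (fun p => simMatrix (cutClustering T c) p.1 p.2 ≠
      simMatrix (cutClustering T (c ∩ internalNodes (prune f T))) p.1 p.2) ⊆
      (leafNodes T).biUnion (fun x => (leavesBelow T (g x)).image (Prod.mk x)) := by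
    rintro ⟨x, y⟩ hp
    obtain ⟨hxy, hne⟩ := Finset.mem_filter.1 hp
    obtain ⟨hx, hy⟩ := Finset.mem_product.1 hxy
    simp only at hx hy hne
    rw [simMatrix_cutClustering hx hy, simMatrix_cutClustering hx hy] at hne
    refine Finset.mem_biUnion.2 ⟨x, hx, Finset.mem_image.2 ⟨y, Finset.mem_filter.2 ⟨hy, ?_⟩, rfl⟩⟩
    by_cases h1 : ∃ j ∈ lowerBoundary T c, j <+: x ∧ j <+: y
    · obtain ⟨j, hj, hjx, hjy⟩ := id h1
      obtain ⟨hjT, hjc, -⟩ := mem_lowerBoundary.1 hj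
      obtain ⟨k, hk, hkj⟩ := exists_mem_lowerBoundary (A := c ∩ internalNodes (prune f T)) hjT
        (fun h => hjc (Finset.mem_inter.1 h).1)
      rw [if_pos h1, if_pos ⟨k, hk, hkj.trans hjx, hkj.trans hjy⟩] at hne
      exact absurd rfl hne
    · rw [if_neg h1] at hne
      by_cases h2 : ∃ j ∈ lowerBoundary T (c ∩ internalNodes (prune f T)), j <+: x ∧ j <+: y
      · obtain ⟨j, hj, hjx, hjy⟩ := h2
        obtain ⟨hjS, hjc, hanc⟩ := (mem_lowerBoundary_inter hS).1 hj
        have hjl : j ∈ leafNodes (prune f T) := by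
          by_contra hjl
          exact h1 ⟨j, mem_lowerBoundary.2 ⟨hSall hjS, hjc.resolve_right hjl, hanc⟩, hjx, hjy⟩
        rcases List.prefix_or_prefix_of_prefix hjx (hgx x hx) with h | h
        · rw [← eq_of_leaf_prefix hjl (leafNodes_subset_allNodes _ (hg x hx)) h]
          exact hjy
        · exact h.trans hjy
      · rw [if_neg h2] at hne
        exact absurd rfl hne
  have hcard : clusterDist T (simMatrix (cutClustering T c))
      (cutClustering T (c ∩ internalNodes (prune f T))) ≤
      ∑ x ∈ leafNodes T, (leavesBelow T (g x)).card :=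
    (Finset.card_le_card hsub).trans (Finset.card_biUnion_le.trans
      (Finset.sum_le_sum fun x _ => Finset.card_image_le))
  calc (clusterDist T (simMatrix (cutClustering T c))
        (cutClustering T (c ∩ internalNodes (prune f T))) : ℝ)
      ≤ ∑ x ∈ leafNodes T, ((leavesBelow T (g x)).card : ℝ) := by exact_mod_cast hcard
    _ ≤ ∑ x ∈ leafNodes T, (f + 1) :=
        Finset.sum_le_sum fun x hx => card_leavesBelow_le_of_leaf_prune hf (hg x hx)
    _ = T.numLeaves * (f + 1) := by rw [Finset.sum_const, nsmul_eq_mul, card_leafNodes]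

theorem nwdpQueries_le (rule : PathRule S P) (mid : MidRule S P)
    {draw : internalNodes S → Finset (Node × Node)} {m : ℕ}
    (hm : ∀ i ∈ internalNodes S, (votePairs draw i).card ≤ m) (flips : Finset (Sym2 Node))
    (c : Finset Node) :
    nwdpQueries T rule mid draw flips c ≤ (nwdpRun T rule mid draw flips c).asked.length * m := by
  rw [nwdpQueries, ← smul_eq_mul, ← List.length_map (fun i => (votePairs draw i).card)]
  apply List.sum_le_card_nsmul
  intro k hk
  obtain ⟨i, -, rfl⟩ := List.mem_map.1 hk
  by_cases hi : i ∈ internalNodes S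
  · exact hm i hi
  · simp [votePairs, hi]

/-- A tree of height at most `1` has at most one cross pair at the root, fewer than `f`. This
matters because the claimed query bound vanishes for `h ≤ 1`. -/
theorem two_le_height {f : ℝ} (hf : 1 < f) (h : [] ∈ internalNodes (prune f T)) : 2 ≤ T.height := by
  have h1 := le_card_crossPairs_of_mem_prune h
  have h2 := internalNodes_prune_subset f T h
  by_contra hlt
  have hle : T.height ≤ 1 := by omega
  have hsub : crossPairs T [] ⊆ {([false], [true])} := by
    rintro ⟨x, y⟩ hxy
    obtain ⟨⟨hx, hx'⟩, hy, hy'⟩ := mem_crossPairs.1 hxy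
    have hxl := (length_le_height (leafNodes_subset_allNodes T hx)).trans hle
    have hyl := (length_le_height (leafNodes_subset_allNodes T hy)).trans hle
    rw [Finset.mem_singleton, ← hx'.eq_of_length_le (by simpa using hxl),
      ← hy'.eq_of_length_le (by simpa using hyl)]
    rfl
  have := Finset.card_le_card hsub
  rw [Finset.card_singleton] at this
  have : ((crossPairs T []).card : ℝ) ≤ 1 := by exact_mod_cast this
  linarith

theorem mem_internalNodes_nil_of_nonempty (h : (internalNodes S).Nonempty) : [] ∈ internalNodes S := by
  obtain ⟨i, hi⟩ := h
  exact mem_internalNodes_of_prefix hi List.nil_prefix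

theorem priorExp_Ktilde_nonneg (hP : IsPositivePrior T P) :
    0 ≤ priorExp T P (fun c => (Ktilde T c : ℝ)) :=
  Finset.sum_nonneg fun _ hc => mul_nonneg (cutProb_pos hP hc).le (Nat.cast_nonneg _)

end Run

/-! ### The guarantee on N-WDP -/

section Guarantee

variable {α lam δ : ℝ} {T : BinaryTree Unit} {P : Node → ℝ}

theorem log_two_le_log_div {n : ℕ} (hn : 1 ≤ n) (h0 : 0 < δ) (h1 : δ < 1 / 2) :
    Real.log 2 ≤ Real.log (n / δ) := by
  apply Real.log_le_log (by norm_num)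
  rw [le_div_iff₀ h0]
  have : (1 : ℝ) ≤ n := by exact_mod_cast hn
  linarith

theorem one_lt_voteBound (hα : 2 ≤ α) (hl0 : 0 ≤ lam) (hl1 : lam < 1 / 2) (h0 : 0 < δ)
    (h1 : δ < 1 / 2) {n : ℕ} (hn : 1 ≤ n) : 1 < voteBound α lam δ n := by
  have hL := log_two_le_log_div hn h0 h1
  have hlog := Real.log_two_gt_d9
  have hsq : 0 < (1 - 2 * lam) ^ 2 := by apply pow_pos; linarith
  rw [voteBound, lt_div_iff₀ hsq]
  have : (1 - 2 * lam) ^ 2 ≤ 1 := pow_le_one₀ (by linarith) (by linarith)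
  nlinarith

/-- The distance estimate is of order `f`, which the stated rate dominates: `1 - 2 lam ≤ 1`, and
`log (n / δ) ≥ log 2 > 1 / 2` gives `√log ≥ 1 / 2`. -/
theorem voteBound_le_rpow (hα : 2 ≤ α) (hl0 : 0 ≤ lam) (hl1 : lam < 1 / 2) (h0 : 0 < δ)
    (h1 : δ < 1 / 2) {n : ℕ} (hn : 1 ≤ n) :
    voteBound α lam δ n ≤
      2 * α * ((Real.log (n / δ)) ^ (3 / 2 : ℝ) / (1 - 2 * lam) ^ 3) := by
  set L := Real.log (n / δ) with hLdef
  have hL : 1 / 2 < L := by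
    have := log_two_le_log_div hn h0 h1
    have := Real.log_two_gt_d9
    linarith
  have hu : 0 < 1 - 2 * lam := by linarith
  have hpow : L ^ (3 / 2 : ℝ) = L * Real.sqrt L := by
    rw [Real.sqrt_eq_rpow, show (3 / 2 : ℝ) = 1 + 1 / 2 by norm_num,
      Real.rpow_add (by linarith), Real.rpow_one]
  have hsqrt : 1 / 2 ≤ Real.sqrt L := by
    apply Real.le_sqrt_of_sq_le
    linarith
  have hkey : L * (1 - 2 * lam) ≤ 2 * (L * Real.sqrt L) := by nlinarith
  calc voteBound α lam δ n = α * (L * (1 - 2 * lam)) / (1 - 2 * lam) ^ 3 := by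
        rw [voteBound, ← hLdef]
        field_simp
    _ ≤ α * (2 * (L * Real.sqrt L)) / (1 - 2 * lam) ^ 3 := by gcongr
    _ = 2 * α * (L ^ (3 / 2 : ℝ) / (1 - 2 * lam) ^ 3) := by
        rw [hpow]
        ring

/-- Uses `h + 1 ≤ h ^ 2`, `log 2 ≤ log h` and `1 / log 2 ≤ 2`. -/
theorem logb_height_le {h : ℕ} (hh : 2 ≤ h) :
    2 * Real.logb 2 (h + 1 : ℕ) + 2 ≤ 12 * Real.log h := by
  have h2 : (2 : ℝ) ≤ h := by exact_mod_cast hh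
  have hlog2 := Real.log_two_gt_d9
  have h3 : Real.log (h + 1 : ℕ) ≤ 2 * Real.log h := by
    rw [← Nat.cast_two, ← Real.log_pow]
    apply Real.log_le_log (by positivity)
    push_cast
    nlinarith
  have h4 : Real.log 2 ≤ Real.log h := Real.log_le_log (by norm_num) h2
  rw [Real.logb, ← mul_div_assoc, div_add' _ _ _ (by positivity), div_le_iff₀ (by positivity)]
  nlinarith

theorem votePairs_of_mem_voteDraws {draw : internalNodes (nwdpTree α lam δ T) → Finset (Node × Node)}
    (h : draw ∈ voteDraws α lam δ T) {i : Node} (hi : i ∈ internalNodes (nwdpTree α lam δ T)) :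
    votePairs draw i ⊆ crossPairs T i ∧ (votePairs draw i).card = voteSize α lam δ T := by
  rw [votePairs, dif_pos hi]
  exact Finset.mem_powersetCard.1 (Fintype.mem_piFinset.1 h ⟨i, hi⟩)

theorem nwdpGuarantee_of_votesCorrect (hα : 2 ≤ α) (hP : IsPositivePrior T P) (hl0 : 0 ≤ lam)
    (hl1 : lam < 1 / 2) (h0 : 0 < δ) (h1 : δ < 1 / 2) (rule : PathRule (nwdpTree α lam δ T) P)
    (mid : MidRule (nwdpTree α lam δ T) P)
    {draw : internalNodes (nwdpTree α lam δ T) → Finset (Node × Node)}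
    (hdraw : draw ∈ voteDraws α lam δ T) {flips : Finset (Sym2 Node)}
    (hgood : VotesCorrect draw flips) :
    NWDPGuarantee (24 * α) lam δ T rule mid draw flips := by
  have hn : 1 ≤ T.numLeaves := T.numLeaves_pos
  have hf1 := one_lt_voteBound hα hl0 hl1 h0 h1 hn
  have hS : internalNodes (nwdpTree α lam δ T) ⊆ internalNodes T := internalNodes_prune_subset _ T
  have hpairs := fun i (hi : i ∈ internalNodes (nwdpTree α lam δ T)) =>
    votePairs_of_mem_voteDraws hdraw hi
  have hy := fun c (hc : c ∈ cuts T) => hgood.consistent hS (fun i hi => (hpairs i hi).1) hc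
  have hu : 0 < 1 - 2 * lam := by linarith
  have hL : 0 < Real.log (T.numLeaves / δ) := by
    have := log_two_le_log_div hn h0 h1
    have := Real.log_two_gt_d9
    linarith
  refine ⟨fun c hc => ?_, ?_⟩
  · rw [nwdpOutput_eq hS rule mid hc (hy c hc)]
    refine ⟨⟨_, inter_mem_cuts hS hc, rfl⟩, ?_⟩
    have hdist := clusterDist_le (T := T) (f := voteBound α lam δ T.numLeaves) (by linarith) c
    have hn0 : (0 : ℝ) < T.numLeaves := by exact_mod_cast hn
    have hb := voteBound_le_rpow hα hl0 hl1 h0 h1 hn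
    have hnn : 0 ≤ (Real.log (T.numLeaves / δ)) ^ (3 / 2 : ℝ) / (1 - 2 * lam) ^ 3 := by positivity
    rw [div_le_iff₀ (by positivity)]
    refine hdist.trans ?_
    have he : 24 * α * (1 / (T.numLeaves : ℝ) *
        ((Real.log (T.numLeaves / δ)) ^ (3 / 2 : ℝ) / (1 - 2 * lam) ^ 3)) * (T.numLeaves : ℝ) ^ 2 =
        T.numLeaves * (24 * (α *
          ((Real.log (T.numLeaves / δ)) ^ (3 / 2 : ℝ) / (1 - 2 * lam) ^ 3))) := by
      field_simp
    rw [he]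
    have : 0 ≤ α * ((Real.log (T.numLeaves / δ)) ^ (3 / 2 : ℝ) / (1 - 2 * lam) ^ 3) := by positivity
    gcongr
    linarith
  · have hK := priorExp_Ktilde_nonneg hP
    have hrhs : 0 ≤ Real.log (T.numLeaves / δ) / (1 - 2 * lam) ^ 2 *
        priorExp T P (fun c => (Ktilde T c : ℝ)) := by positivity
    -- If the root is pruned there are no queries. Otherwise the height is at least `2`, and the
    -- constant `24 α` is `12`, from `logb_height_le`, times `2`, from `⌈f⌉ ≤ 2 f`, times the `α` in
    -- `f`.
    rcases (internalNodes (nwdpTree α lam δ T)).eq_empty_or_nonempty with hne | hne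
    · have hz : ∀ c, nwdpQueries T rule mid draw flips c = 0 := by
        intro c
        have := nwdpQueries_le (T := T) rule mid (draw := draw) (m := 0) (by simp [hne]) flips c
        simpa using this
      simp only [hz, priorExp, Nat.cast_zero, mul_zero, Finset.sum_const_zero]
      have := Real.log_natCast_nonneg T.height
      have := mul_nonneg hrhs this
      simp only [priorExp] at this
      positivity
    · have hroot := mem_internalNodes_nil_of_nonempty hne
      have hh := two_le_height hf1 hroot
      have hasked := sum_asked_wdp_le hP hS hroot rule mid hy
      have hsize : (voteSize α lam δ T : ℝ) ≤ 2 * voteBound α lam δ T.numLeaves := by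
        have := Nat.ceil_lt_add_one (show 0 ≤ voteBound α lam δ T.numLeaves by linarith)
        rw [voteSize]
        linarith
      have hq : priorExp T P (fun c => (nwdpQueries T rule mid draw flips c : ℝ)) ≤
          (∑ c ∈ cuts T, cutProb T P c * ((nwdpRun T rule mid draw flips c).asked.length : ℝ)) *
            voteSize α lam δ T := by
        rw [priorExp, Finset.sum_mul]
        refine Finset.sum_le_sum fun c hc => ?_
        rw [mul_assoc]
        have := nwdpQueries_le (T := T) rule mid (fun i hi => (hpairs i hi).2.le) flips c
        have := (cutProb_pos hP hc).le
        gcongr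
        exact_mod_cast nwdpQueries_le (T := T) rule mid (fun i hi => (hpairs i hi).2.le) flips c
      have hlog := logb_height_le hh
      calc priorExp T P (fun c => (nwdpQueries T rule mid draw flips c : ℝ))
          ≤ (12 * Real.log T.height * priorExp T P (fun c => (Ktilde T c : ℝ))) *
            (2 * voteBound α lam δ T.numLeaves) := by
            refine hq.trans ?_
            refine mul_le_mul (hasked.trans ?_) hsize (Nat.cast_nonneg _) ?_
            · gcongr
            · have := Real.log_natCast_nonneg T.height
              positivity
        _ = 24 * α * (Real.log (T.numLeaves / δ) / (1 - 2 * lam) ^ 2 *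
              priorExp T P (fun c => (Ktilde T c : ℝ)) * Real.log T.height) := by
            rw [voteBound]
            ring

theorem le_uniformProb_votesCorrect (hα : 2 ≤ α) (hl0 : 0 ≤ lam)
    (hl1 : lam < 1 / 2) (h0 : 0 < δ) (h1 : δ < 1 / 2)
    {draw : internalNodes (nwdpTree α lam δ T) → Finset (Node × Node)}
    (hdraw : draw ∈ voteDraws α lam δ T) (hne : (noiseSets T lam).Nonempty) :
    1 - δ ≤ uniformProb (noiseSets T lam) (fun flips => VotesCorrect draw flips) := by
  have hn : 1 ≤ T.numLeaves := T.numLeaves_pos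
  have hn0 : (0 : ℝ) < T.numLeaves := by exact_mod_cast hn
  have hf1 := one_lt_voteBound hα hl0 hl1 h0 h1 hn
  have hu : 0 < 1 - 2 * lam := by linarith
  have hL : 0 < Real.log (T.numLeaves / δ) := by
    have := log_two_le_log_div hn h0 h1
    have := Real.log_two_gt_d9
    linarith
  have hK : ((⌊lam * (T.numLeaves.choose 2 : ℝ)⌋₊ : ℕ) : ℝ) ≤ lam * (leafPairs T).card := by
    rw [card_leafPairs]
    exact Nat.floor_le (by positivity)
  have hvote : ∀ i ∈ internalNodes (nwdpTree α lam δ T),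
      uniformProb (noiseSets T lam) (fun flips =>
        ¬ 2 * (flips ∩ unordered (votePairs draw i)).card < (unordered (votePairs draw i)).card) ≤
      δ / T.numLeaves := by
    intro i hi
    obtain ⟨hD, hsize⟩ := votePairs_of_mem_voteDraws hdraw hi
    have hceil : voteBound α lam δ T.numLeaves ≤ ((unordered (votePairs draw i)).card : ℝ) := by
      rw [card_unordered hD, hsize, voteSize]
      exact Nat.le_ceil _
    have hDne : (unordered (votePairs draw i)).Nonempty := by
      rw [← Finset.card_pos]
      have : (0 : ℝ) < ((unordered (votePairs draw i)).card : ℝ) := by linarith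
      exact_mod_cast this
    have htail := card_majority_le (unordered_subset_leafPairs hD) hDne hl0 hl1 hK
    -- At least `f` votes make the exponent at most `-(α / 2) log (n / δ)`; this is where `2 ≤ α`
    -- enters.
    have hexp : Real.exp (-((1 - 2 * lam) ^ 2 * (unordered (votePairs draw i)).card / 2)) ≤
        δ / T.numLeaves := by
      rw [← Real.exp_log (show 0 < δ / (T.numLeaves : ℝ) by positivity), Real.exp_le_exp]
      have : Real.log (δ / T.numLeaves) = - Real.log (T.numLeaves / δ) := by
        rw [← Real.log_inv, inv_div]
      rw [this]
      rw [voteBound, div_le_iff₀ (by positivity)] at hceil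
      nlinarith
    rw [uniformProb_eq, div_le_iff₀ (by exact_mod_cast hne.card_pos)]
    simp only [not_lt, noiseSets, Finset.card_powersetCard]
    refine htail.trans ?_
    gcongr
  have hunion := one_sub_le_uniformProb_forall hne hvote
  refine le_trans ?_ hunion
  have hcard : ((internalNodes (nwdpTree α lam δ T)).card : ℝ) ≤ T.numLeaves := by
    have h2 := Finset.card_le_card (internalNodes_prune_subset (voteBound α lam δ T.numLeaves) T)
    have h3 := card_internalNodes T
    have : (internalNodes (nwdpTree α lam δ T)).card ≤ T.numLeaves := by rw [nwdpTree]; omega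
    exact_mod_cast this
  have : ((internalNodes (nwdpTree α lam δ T)).card : ℝ) * (δ / T.numLeaves) ≤ δ := by
    rw [← mul_div_assoc, div_le_iff₀ hn0, mul_comm]
    gcongr
  linarith

theorem noiseSets_nonempty (hl0 : 0 ≤ lam) (hl1 : lam < 1 / 2) : (noiseSets T lam).Nonempty := by
  rw [noiseSets, Finset.powersetCard_nonempty, card_leafPairs]
  have h : (0 : ℝ) ≤ (T.numLeaves.choose 2 : ℝ) := Nat.cast_nonneg _
  have h2 := Nat.floor_le (mul_nonneg hl0 h)
  have h3 : lam * (T.numLeaves.choose 2 : ℝ) ≤ (T.numLeaves.choose 2 : ℝ) := by nlinarith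
  exact_mod_cast h2.trans h3

theorem voteDraws_nonempty : (voteDraws α lam δ T).Nonempty := by
  rw [voteDraws, Fintype.piFinset_nonempty]
  intro i
  rw [Finset.powersetCard_nonempty, voteSize, Nat.ceil_le]
  exact le_card_crossPairs_of_mem_prune i.2

end Guarantee

theorem theoremt :
    ∃ α₀ : ℝ, 0 < α₀ ∧ ∀ α : ℝ, α₀ ≤ α → ∃ C : ℝ, 0 < C ∧
      ∀ (T : BinaryTree Unit) (P : Node → ℝ) (lam δ : ℝ),
        IsPositivePrior T P → 0 ≤ lam → lam < 1 / 2 → 0 < δ → δ < 1 / 2 →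
        ∀ (rule : PathRule (nwdpTree α lam δ T) P) (mid : MidRule (nwdpTree α lam δ T) P),
          (∀ draw ∈ voteDraws α lam δ T,
            1 - δ ≤ uniformProb (noiseSets T lam)
              (fun flips => NWDPGuarantee C lam δ T rule mid draw flips)) ∧
          1 - δ ≤ uniformProb (voteDraws α lam δ T ×ˢ noiseSets T lam)
            (fun ω => NWDPGuarantee C lam δ T rule mid ω.1 ω.2) := by
  -- `α₀ = 2` comes from the tail bound of a single vote, `24 α` from the query count; the distance
  -- bound needs less.
  refine ⟨2, two_pos, fun α hα => ⟨24 * α, by linarith, ?_⟩⟩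
  intro T P lam δ hP hl0 hl1 h0 h1 rule mid
  have hne := noiseSets_nonempty (T := T) hl0 hl1
  have hall : ∀ draw ∈ voteDraws α lam δ T, 1 - δ ≤ uniformProb (noiseSets T lam)
      (fun flips => NWDPGuarantee (24 * α) lam δ T rule mid draw flips) := fun draw hdraw =>
    (le_uniformProb_votesCorrect hα hl0 hl1 h0 h1 hdraw hne).trans
      (uniformProb_mono fun flips _ hgood =>
        nwdpGuarantee_of_votesCorrect hα hP hl0 hl1 h0 h1 rule mid hdraw hgood)
  exact ⟨hall, le_uniformProb_product voteDraws_nonempty hne hall⟩
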